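/- **Setting.** Let $q\ge 4$ be a prime power. For a vector or a subspace in coordinates over an extension of $\mathbb F_q$, $X\mapsto X^q$ denotes the coordinatewise $q$-th power map. Let $\Gamma$ be a plane of $\mathrm{PG}(8,q^3)$ such that $\Gamma,\Gamma^q,\Gamma^{q^2}$ span $\mathrm{PG}(8,q^3)$ (a transversal plane of a regular $2$-spread of $\mathrm{PG}(8,q)$), and identify $\mathrm{PG}(2,q^3)$ with $\Gamma$ by a linear isomorphism $\bar X\leftrightarrow X$, extended linearly to $\mathrm{PG}(2,q^6)$. Let $\ell_\infty$ be a line of $\mathrm{PG}(2,q^3)$, $g$ the corresponding line of $\Gamma$, $\Sigma_\infty=\langle g,g^q,g^{q^2}\rangle\cap\mathrm{PG}(8,q)$ (a $5$-space), and $\Sigma_6$ a $6$-space of $\mathrm{PG}(8,q)$ containing $\Sigma_\infty$. The point $\bar X$ has the Bose representation $[\![X]\!]=\langle X,X^q,X^{q^2}\rangle\cap\mathrm{PG}(8,q)$, a plane, and the (exact-at-infinity) Bruck–Bose representation $[X]=[\![X]\!]\cap\Sigma_6$ in $\Sigma_6\cong\mathrm{PG}(6,q)$; this is a point outside $\Sigma_\infty$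 if $\bar X\notin\ell_\infty$, and a plane of the regular $2$-spread of $\Sigma_\infty$ with transversal lines $g,g^q,g^{q^2}$ if $\bar X\in\ell_\infty$. For a point set $\bar{\mathcal K}$ let $[\mathcal K]=\bigcup_{\bar X\in\bar{\mathcal K}}[X]$. An $\mathbb F_q$-subplane of $\mathrm{PG}(2,q^3)$ is an image of $\mathrm{PG}(2,q)$ under a homography of $\mathrm{PG}(2,q^3)$, and an $\mathbb F_q$-conic in it is the image of a non-degenerate conic of $\mathrm{PG}(2,q)$ under the same homography. For an $\mathbb F_q$-conic $\bar{\mathcal C}$, let $\bar{\mathcal C}^+$ and $\bar{\mathcal C}^{++}$ be the conics of $\mathrm{PG}(2,q^3)$ and $\mathrm{PG}(2,q^6)$ with the same equation. Let $\mathcal V([\![\mathcal C]\!])$ be the variety of $\mathrm{PG}(8,q)$ formed by the planes $[\![X]\!]$, $\bar X\in\bar{\mathcal C}$, as the intersection of all quadrics over $\mathbb F_q$ that contain these planes, and let $\mathcal V([\mathcal C])=\mathcal V([\![\mathcal C]\!])\cap\Sigma_6$. A star ${}^\star$ (resp. ${}^{\star\star}$) denotes the extension of a subspace, variety or curve to $\mathbb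 F_{q^3}$ (resp. $\mathbb F_{q^6}$). An $r$-dim nrc over a field $E$ is the image of the curve $\{(s^r,s^{r-1}t,\dots,t^r)\mid (s:t)\in\mathrm{PG}(1,E)\}$ under an injective linear map; for an nrc over $\mathbb F_q$ its extensions are given by the same map over $\mathbb F_{q^3}$, $\mathbb F_{q^6}$. Such a curve meets a hyperplane not containing it in $r$ points, counted with multiplicity, possibly in an extension field. **Theorem.** Let $\bar{\mathcal C}$ be an $\mathbb F_q$-conic in an $\mathbb F_q$-subplane $\bar\pi$ of $\mathrm{PG}(2,q^3)$ with $\bar\pi\cap\ell_\infty=\{\bar T\}$. 1. If $\bar T\in\bar{\mathcal C}$, then $\bar{\mathcal C}^+\cap\ell_\infty=\{\bar T,\bar Q\}$ with $\bar Q\ne\bar T$, and there is a $4$-dim nrc $\mathcal N_4$ over $\mathbb F_q$ such that $[\mathcal C]=[T]\cup\mathcal N_4$, $\mathcal V([\mathcal C])^\star=[T]^\star\cup\mathcal N_4^\star$ and $\mathcal V([\mathcal C])^{\star\star}=[T]^{\star\star}\cup\mathcal N_4^{\star\star}$. Moreover $\mathcal N_4^\star$ meets $\Sigma_\infty^\star$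 in exactly the four points $Z,Q,Q^q,Q^{q^2}$ (with multiplicity), where $Z$ is a point of the plane $[T]$ over $\mathbb F_q$. 2. If $\bar T\notin\bar{\mathcal C}$, then there is a $6$-dim nrc $\mathcal N_6$ over $\mathbb F_q$ such that $[\mathcal C]=\mathcal N_6$, $\mathcal V([\mathcal C])^\star=\mathcal N_6^\star$ and $\mathcal V([\mathcal C])^{\star\star}=\mathcal N_6^{\star\star}$, and one of the following holds. - $\bar{\mathcal C}^+\cap\ell_\infty=\{\bar P,\bar Q\}$ (possibly $\bar P=\bar Q$), and $\mathcal N_6^\star$ meets $\Sigma_\infty^\star$ in exactly the points $P,P^q,P^{q^2},Q,Q^q,Q^{q^2}$, counted with multiplicity. - $\bar{\mathcal C}^+\cap\ell_\infty=\emptyset$; over $\mathbb F_{q^6}$, $\bar{\mathcal C}^{++}\cap\ell_\infty^{++}=\{\bar P,\bar Q\}$ with $\bar Q=\bar P^{q^3}\neq\bar P$, also $Q=P^{q^3}$, and $\mathcal N_6^{\star\star}$ meets $\Sigma_\infty^{\star\star}$ in exactly the points $P,P^q,P^{q^2},Q,Q^q,Q^{q^2}$, counted with multiplicity. -/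

import Mathlib

open scoped LinearAlgebra.Projectivization

noncomputable section

namespace BBConic

/-! ## Projective spaces with coordinates, extension of scalars, conjugation -/

/-- `PG(n, k)` with homogeneous coordinates `(x_0, …, x_n)`. -/
abbrev PG (n : ℕ) (k : Type*) [Field k] : Type _ := ℙ k (Fin (n + 1) → k)

/-- Reading a coordinate vector over `k` as a coordinate vector over the extension `E`. -/
def vecExt (k E : Type*) [Field k] [Field E] [Algebra k E] (n : ℕ) :
    (Fin n → k) →ₛₗ[algebraMap k E] (Fin n → E) where
  toFun v i := algebraMap k E (v i)
  map_add' v w := by ext i; simp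
  map_smul' a v := by ext i; simp

theorem vecExt_injective (k E : Type*) [Field k] [Field E] [Algebra k E] (n : ℕ) :
    Function.Injective (vecExt k E n) := fun _ _ h =>
  funext fun i => (algebraMap k E).injective (congrFun h i)

/-- The embedding `PG(n, k) ⊆ PG(n, E)`. -/
def ptExt {k : Type*} (E : Type*) [Field k] [Field E] [Algebra k E] {n : ℕ} :
    PG n k → PG n E :=
  Projectivization.map (vecExt k E (n + 1)) (vecExt_injective k E (n + 1))

/-- The extension to `E` of a subspace defined over `k`. -/
def spaceExt {k : Type*} (E : Type*) [Field k] [Field E] [Algebra k E] {n : ℕ}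
    (W : Submodule k (Fin n → k)) : Submodule E (Fin n → E) :=
  Submodule.span E (vecExt k E n '' (W : Set (Fin n → k)))

/-- The set of points of a projective subspace. -/
def pointsOf {E : Type*} [Field E] {n : ℕ} (W : Submodule E (Fin (n + 1) → E)) : Set (PG n E) :=
  {Z | Z.submodule ≤ W}

/-- The map `(x_0, …) ↦ (x_0 ^ q, …)` with `q = |F|` on coordinate vectors over `E`. -/
def vecConj (F E : Type*) [Field F] [Fintype F] [Field E] [Algebra F E] (n : ℕ) :
    (Fin n → E) →ₛₗ[(FiniteField.frobeniusAlgHom F E : E →+* E)] (Fin n → E) where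
  toFun v i := v i ^ Fintype.card F
  map_add' v w := by
    ext i; exact map_add (FiniteField.frobeniusAlgHom F E) (v i) (w i)
  map_smul' a v := by
    ext i; exact map_mul (FiniteField.frobeniusAlgHom F E) a (v i)

theorem vecConj_injective (F E : Type*) [Field F] [Fintype F] [Field E] [Algebra F E] (n : ℕ) :
    Function.Injective (vecConj F E n) := fun _ _ h =>
  funext fun i => (FiniteField.frobeniusAlgHom F E : E →+* E).injective (congrFun h i)

/-- The conjugation `X ↦ X^q` of `PG(n, E)`, where `q = |F|`. -/
def conj (F : Type*) {E : Type*} [Field F] [Fintype F] [Field E] [Algebra F E] {n : ℕ} :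
    PG n E → PG n E :=
  Projectivization.map (vecConj F E (n + 1)) (vecConj_injective F E (n + 1))

/-- The conjugate subspace `W^q`. -/
def spaceConj (F : Type*) {E : Type*} [Field F] [Fintype F] [Field E] [Algebra F E] {n : ℕ}
    (W : Submodule E (Fin n → E)) : Submodule E (Fin n → E) :=
  Submodule.span E (vecConj F E n '' (W : Set (Fin n → E)))

/-- The span `⟨W, W^q, W^{q²}⟩`. -/
def conjSpan (F : Type*) {E : Type*} [Field F] [Fintype F] [Field E] [Algebra F E] {n : ℕ}
    (W : Submodule E (Fin n → E)) : Submodule E (Fin n → E) :=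
  W ⊔ spaceConj F W ⊔ spaceConj F (spaceConj F W)

theorem mulVecLin_map_injective {k : Type*} (E : Type*) [Field k] [Field E] [Algebra k E]
    {m n : ℕ} (M : Matrix (Fin m) (Fin n) k) (hM : Function.Injective M.mulVecLin) :
    Function.Injective (M.map (algebraMap k E)).mulVecLin := by
  obtain ⟨g, hg⟩ := LinearMap.exists_leftInverse_of_injective M.mulVecLin
    (LinearMap.ker_eq_bot.2 hM)
  have h1 : LinearMap.toMatrix' g * M = 1 := by
    have := congrArg LinearMap.toMatrix' hg
    rwa [LinearMap.toMatrix'_comp, LinearMap.toMatrix'_id, ← Matrix.toLin'_apply',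
      LinearMap.toMatrix'_toLin'] at this
  have h2 : (LinearMap.toMatrix' g).map (algebraMap k E) * M.map (algebraMap k E) = 1 := by
    rw [← Matrix.map_mul, h1, Matrix.map_one _ (map_zero _) (map_one _)]
  intro v w h
  have h3 := congrArg (fun x => ((LinearMap.toMatrix' g).map (algebraMap k E)).mulVec x) h
  simpa [Matrix.mulVec_mulVec, h2] using h3

/-- The projective embedding `PG(n, E) → PG(m, E)` given by an injective matrix over `k ⊆ E`. -/
def matMap {k : Type*} (E : Type*) [Field k] [Field E] [Algebra k E] {m n : ℕ}
    (M : Matrix (Fin (m + 1)) (Fin (n + 1)) k) (hM : Function.Injective M.mulVecLin) :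
    PG n E → PG m E :=
  Projectivization.map (M.map (algebraMap k E)).mulVecLin (mulVecLin_map_injective E M hM)

/-! ## Normal rational curves -/

/-- The vector `(s^r, s^{r-1} t, …, t^r)` for `u = (s, t)`. -/
def moment {E : Type*} [Field E] (r : ℕ) (u : Fin 2 → E) : Fin (r + 1) → E :=
  fun i => u 0 ^ (r - (i : ℕ)) * u 1 ^ (i : ℕ)

theorem moment_ne_zero {E : Type*} [Field E] (r : ℕ) (u : Fin 2 → E) (hu : u ≠ 0) :
    moment r u ≠ 0 := by
  intro h
  apply hu
  have h0 : u 0 ^ r = 0 := by simpa [moment] using congrFun h 0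
  have h1 : u 1 ^ r = 0 := by simpa [moment] using congrFun h (Fin.last r)
  ext i
  fin_cases i
  · exact eq_zero_of_pow_eq_zero h0
  · exact eq_zero_of_pow_eq_zero h1

/-- The standard normal rational curve `PG(1, E) → PG(r, E)`. -/
def stdCurve {E : Type*} [Field E] (r : ℕ) (u : PG 1 E) : PG r E :=
  Projectivization.mk E (moment r u.rep) (moment_ne_zero r u.rep u.rep_nonzero)

/-- An `r`-dimensional normal rational curve of `PG(n, F)`: the image of the standard one under
a projective embedding `PG(r, F) → PG(n, F)`, recorded by its matrix. -/
structure NRC (r n : ℕ) (F : Type*) [Field F] where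
  mat : Matrix (Fin (n + 1)) (Fin (r + 1)) F
  inj : Function.Injective mat.mulVecLin

namespace NRC

variable {r n : ℕ} {F : Type*} [Field F] (N : NRC r n F) (E : Type*) [Field E] [Algebra F E]

/-- The point with parameter `u` of the extension of the curve to `PG(n, E)`. -/
def pt (u : PG 1 E) : PG n E := matMap E N.mat N.inj (stdCurve r u)

/-- The points of the extension of the curve to `PG(n, E)` (of the curve itself if `E = F`). -/
def points : Set (PG n E) := Set.range (N.pt E)

/-- For a hyperplane `S` of a projective space `U` containing the curve: over `E` the curve meets
`S` in the points `Z 0, …, Z (r-1)`, counted with multiplicity, and in no other points. That is,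
the equation `h = 0` of the hyperplane, restricted to the curve, is a nonzero binary form of degree
`r` that splits over `E` into linear factors vanishing at the parameters of the points `Z i`. -/
def MeetsIn (U S : Submodule F (Fin (n + 1) → F)) (Z : Fin r → PG n E) : Prop :=
  ∃ (h : (Fin (n + 1) → E) →ₗ[E] E) (u : Fin r → PG 1 E) (c : E),
    (∀ v ∈ spaceExt E U, h v = 0 ↔ v ∈ spaceExt E S) ∧
    (∀ i, N.pt E (u i) = Z i) ∧ c ≠ 0 ∧
    ∀ w : Fin 2 → E, h ((N.mat.map (algebraMap F E)).mulVec (moment r w)) =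
      c * ∏ i, (w 0 * (u i).rep 1 - w 1 * (u i).rep 0)

end NRC

/-! ## `F`-conics of `PG(2, K)` -/

/-- An `F`-conic of `PG(2, K)` together with its `F`-subplane: the subplane is the image of
`PG(2, F)` under the homography with matrix `B`, and the conic is the image of the conic of
`PG(2, F)` with the non-degenerate quadratic equation `Q = 0`. -/
structure FqConic (F K : Type*) [Field F] [Field K] [Algebra F K] where
  B : Matrix (Fin 3) (Fin 3) K
  B_inj : Function.Injective B.mulVecLin
  Q : MvPolynomial (Fin 3) F
  homog : Q.IsHomogeneous 2
  nondeg : ∀ v : Fin 3 → F, v ≠ 0 → MvPolynomial.eval v Q = 0 →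
    ∃ i, MvPolynomial.eval v (MvPolynomial.pderiv i Q) ≠ 0

namespace FqConic

variable {F K : Type*} [Field F] [Field K] [Algebra F K] (C : FqConic F K)

/-- The `F`-subplane `π`. -/
def subplane : Set (PG 2 K) := {X | ∃ x : PG 2 F, X = matMap K C.B C.B_inj (ptExt K x)}

/-- The points of the `F`-conic. -/
def points : Set (PG 2 K) :=
  {X | ∃ x : PG 2 F, MvPolynomial.eval x.rep C.Q = 0 ∧ X = matMap K C.B C.B_inj (ptExt K x)}

/-- The conic of `PG(2, E)` with the same equation; this is `C⁺` for `E = K` and `C⁺⁺` for the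
quadratic extension `E` of `K`. -/
def ext (E : Type*) [Field E] [Algebra F E] [Algebra K E] : Set (PG 2 E) :=
  {X | ∃ x : PG 2 E, MvPolynomial.aeval x.rep C.Q = 0 ∧ X = matMap E C.B C.B_inj x}

end FqConic

/-! ## The Bruck–Bose representation inside the Bose representation -/

/-- The data of the Bruck–Bose representation of `PG(2, q³)`, realised inside the Bose
representation in `PG(8, q)`, where `F = 𝔽_q` and `K = 𝔽_{q³}`:
* `M` is the isomorphism of `PG(2, K)` onto a plane `Γ` of `PG(8, K)` for which `Γ, Γ^q, Γ^{q²}`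
  span `PG(8, K)`, that is, onto a transversal plane of a regular 2-spread of `PG(8, F)`;
* `linf` is the line at infinity of `PG(2, K)`, which corresponds to a line `g` of `Γ`, and to the
  5-space `Σ_∞ = ⟨g, g^q, g^{q²}⟩ ∩ PG(8, F)`;
* `S6` is a 6-space of `PG(8, F)` through `Σ_∞`; it is the `PG(6, F)` of the representation. -/
structure Frame (F K : Type*) [Field F] [Fintype F] [Field K] [Algebra F K] where
  M : Matrix (Fin 9) (Fin 3) K
  M_inj : Function.Injective M.mulVecLin
  span_eq_top : conjSpan F (LinearMap.range M.mulVecLin) = ⊤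
  linf : Submodule K (Fin 3 → K)
  finrank_linf : Module.finrank K linf = 2
  S6 : Submodule F (Fin 9 → F)
  finrank_S6 : Module.finrank F S6 = 7
  le_S6 : (conjSpan F (linf.map M.mulVecLin)).comap (vecExt F K 9) ≤ S6

namespace Frame

variable {F K : Type*} [Field F] [Fintype F] [Field K] [Algebra F K] (R : Frame F K)

/-- The hyperplane at infinity `Σ_∞ = ⟨g, g^q, g^{q²}⟩ ∩ PG(8, F)` of the 6-space. -/
def Sinf : Submodule F (Fin 9 → F) :=
  (conjSpan F (R.linf.map R.M.mulVecLin)).comap (vecExt F K 9)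

/-- The points of the line at infinity of `PG(2, K)`, extended to `PG(2, E)`. -/
def lineInf (E : Type*) [Field E] [Algebra K E] : Set (PG 2 E) := pointsOf (spaceExt E R.linf)

/-- The point `X` of `Γ` (extended to `E`) that corresponds to the point `X̄` of `PG(2, E)`.
It lies on the transversal line `g` (extended to `E`) when `X̄` is at infinity. -/
def toΓ {E : Type*} [Field E] [Algebra K E] : PG 2 E → PG 8 E := matMap E R.M R.M_inj

/-- The plane `⟨X, X^q, X^{q²}⟩ ∩ PG(8, F)` of the Bose spread representing `X̄`. -/
def bose (X : PG 2 K) : Submodule F (Fin 9 → F) :=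
  (conjSpan F (R.toΓ X).submodule).comap (vecExt F K 9)

/-- The subspace `[X]` of the 6-space representing `X̄`: a point outside `Σ_∞` if `X̄` is affine,
and a plane of the 2-spread of `Σ_∞` if `X̄` is at infinity. -/
def br (X : PG 2 K) : Submodule F (Fin 9 → F) := R.bose X ⊓ R.S6

/-- The point set `[𝒦]` in the exact-at-infinity Bruck–Bose representation. -/
def brSet (𝒦 : Set (PG 2 K)) : Set (PG 8 F) := {Z | ∃ X ∈ 𝒦, Z ∈ pointsOf (R.br X)}

/-- The extension to `E` of the variety formed by the Bose planes of the points in `𝒦`, as an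
intersection of quadrics: all points of `PG(8, E)` on every quadric with equation over `F` that
contains all these planes. -/
def boseVariety (𝒦 : Set (PG 2 K)) (E : Type*) [Field E] [Algebra F E] : Set (PG 8 E) :=
  {Z | ∀ f : MvPolynomial (Fin 9) F, f.IsHomogeneous 2 →
    (∀ X ∈ 𝒦, ∀ Y ∈ pointsOf (R.bose X), MvPolynomial.eval Y.rep f = 0) →
    MvPolynomial.aeval Z.rep f = 0}

/-- The extension to `E` of the variety `𝒱([𝒦])`, the section of the Bose variety by the
6-space. -/
def variety (𝒦 : Set (PG 2 K)) (E : Type*) [Field E] [Algebra F E] : Set (PG 8 E) :=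
  R.boseVariety 𝒦 E ∩ pointsOf (spaceExt E R.S6)

end Frame

end BBConic

end

/-!
Write `q = |F|`, `σ` for the `q`-th power map and `M` for the matrix of the isomorphism onto the
transversal plane. Since the plane and its conjugates span, every vector over an extension of `K`
is uniquely `M x₀ + M^σ x₁ + M^{σ²} x₂` (`comb`, `exists_coordinates`), and the vectors over `F` are
those with `x₁ = x₀^σ`, `x₂ = x₀^{σ²}`. Hence `x ↦ Tr (M x)` identifies `K³` with `F⁹`
(`traceVec_bijective`), the Bose plane of the point `⟨x⟩` being the image of the line `K x`
(`Coords.mem_bose_iff`).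

A homography brings the conic to the form `(s², st, t²)`. The planes representing its points then
lie on the scroll of planes `⟨M m, M^σ m, M^{σ²} m⟩`, `m = (s², st, t²)`, and over every extension
the quadrics over `F` through these planes have exactly the scroll in common. A quadric through the
planes contains the scroll because a quartic form vanishing on the at least five points of the
line over `F` is zero (`VanishesOnPlanes.apply_scroll`); conversely, the scroll is cut out by minors
that are quadrics over `K`, and these are combinations of quadrics over `F`
(`exists_scroll_of_quadrics`).

Let `a` be the equation of the line at infinity. After scaling, the 6-space is the set of the
vectors `Tr (M x)` with `a x` in `F`, so a point of the scroll with components `c₀ m, c₁ m, c₂ m`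
lies in the 6-space only if `c₀ δ = c₁ δ^σ = c₂ δ^{σ²}`, where `δ(s, t) = a m` and the exponents act
on the coefficients. Removing from `δ` its greatest factor `l` over `F` leaves a form `e` no two
conjugates of which have a common root (`CurveOver`). Off the roots of `l` this forces
`(c₀ : c₁ : c₂) = (e^σ e^{σ²} : e^{σ²} e : e e^σ)`, so the section is the curve
`(s, t) ↦ Tr (M (e^σ e^{σ²} m))`, of degree `2 + 2 deg e`.

That the subplane has a single point at infinity means that `a`, restricted to `F³`, has rank two
over `F`, so that `a = b₁ f₁ + b₂ f₂` with forms `f₁`, `f₂` over `F` and `b₁`, `b₂` independent over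
`F`. The point lies on the conic iff `f₁`, `f₂`, as binary quadratic forms, have a common root. If
not, `l = 1` and the degree is six; if so, the root can be moved to `(1, 0)`, where `l = t`, and the
degree is four, the root of `l` contributing the plane of that point. The coordinates of the curve
are independent because the products `m e^σ e^{σ²}` and their conjugates span all forms of that
degree (`mulMat₂_kernel`, `mulMat₁_kernel`), so the curve is a normal rational curve. The hyperplane
at infinity cuts it in `l e e^σ e^{σ²}` (`CurveOver.hyperplaneForm_curve`), and at a root of `e` the
curve passes through the corresponding point of the transversal plane (`CurveOver.isVec_of_root`).
-/

open scoped LinearAlgebra.Projectivization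

noncomputable section

namespace BBConic

/-! ### Points of projective spaces and the vectors that represent them -/

/-- The vector `v` represents the point `X`. -/
def IsVec {k V : Type*} [Field k] [AddCommGroup V] [Module k V] (X : ℙ k V) (v : V) : Prop :=
  ∃ h : v ≠ 0, X = Projectivization.mk k v h

section IsVec

variable {k V : Type*} [Field k] [AddCommGroup V] [Module k V] {X Y : ℙ k V} {v w : V}

theorem isVec_rep (X : ℙ k V) : IsVec X X.rep := ⟨X.rep_nonzero, X.mk_rep.symm⟩

theorem isVec_mk (h : v ≠ 0) : IsVec (Projectivization.mk k v h) v := ⟨h, rfl⟩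

theorem IsVec.eq (hX : IsVec X v) (hY : IsVec Y v) : X = Y := by
  obtain ⟨_, rfl⟩ := hX
  obtain ⟨_, rfl⟩ := hY
  rfl

theorem IsVec.smul (hX : IsVec X v) {c : k} (hc : c ≠ 0) : IsVec X (c • v) := by
  obtain ⟨h, rfl⟩ := hX
  refine ⟨smul_ne_zero hc h, ?_⟩
  rw [Projectivization.mk_eq_mk_iff']
  exact ⟨c⁻¹, by rw [smul_smul, inv_mul_cancel₀ hc, one_smul]⟩

theorem IsVec.exists_smul (hX : IsVec X v) (hY : IsVec X w) : ∃ c : k, c ≠ 0 ∧ w = c • v := by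
  obtain ⟨h, rfl⟩ := hX
  obtain ⟨h', e⟩ := hY
  rw [Projectivization.mk_eq_mk_iff'] at e
  obtain ⟨a, rfl⟩ := e
  have ha : a ≠ 0 := by rintro rfl; simp at h
  exact ⟨a⁻¹, inv_ne_zero ha, by rw [smul_smul, inv_mul_cancel₀ ha, one_smul]⟩

theorem IsVec.of_smul {c : k} (hX : IsVec X (c • v)) : IsVec X v := by
  have hc : c ≠ 0 := by rintro rfl; exact hX.1 (zero_smul _ _)
  have := hX.smul (inv_ne_zero hc)
  rwa [smul_smul, inv_mul_cancel₀ hc, one_smul] at this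

theorem IsVec.map {k' V' : Type*} [Field k'] [AddCommGroup V'] [Module k' V'] {σ : k →+* k'}
    (hX : IsVec X v) (f : V →ₛₗ[σ] V') (hf : Function.Injective f) :
    IsVec (Projectivization.map f hf X) (f v) := by
  obtain ⟨h, rfl⟩ := hX
  exact ⟨_, Projectivization.map_mk f hf v h⟩

end IsVec

section Coordinates

variable {k : Type*} [Field k] {n : ℕ}

theorem IsVec.submodule_eq {X : PG n k} {v : Fin (n + 1) → k} (h : IsVec X v) :
    X.submodule = Submodule.span k {v} := by
  obtain ⟨h, rfl⟩ := h
  exact Projectivization.submodule_mk v h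

theorem IsVec.mem_pointsOf {X : PG n k} {v : Fin (n + 1) → k} (h : IsVec X v)
    (W : Submodule k (Fin (n + 1) → k)) : X ∈ pointsOf W ↔ v ∈ W := by
  change X.submodule ≤ W ↔ _
  rw [h.submodule_eq, Submodule.span_singleton_le_iff_mem]

theorem IsVec.ptExt {X : PG n k} {v : Fin (n + 1) → k} (h : IsVec X v) (E : Type*) [Field E]
    [Algebra k E] : IsVec (ptExt E X) (vecExt k E (n + 1) v) :=
  h.map _ _

theorem IsVec.conj (F : Type*) [Field F] [Fintype F] [Algebra F k] {X : PG n k}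
    {v : Fin (n + 1) → k} (h : IsVec X v) : IsVec (conj F X) (vecConj F k (n + 1) v) :=
  h.map _ _

theorem IsVec.matMap {E : Type*} [Field E] [Algebra k E] {m : ℕ} {X : PG n E}
    {v : Fin (n + 1) → E} (h : IsVec X v) (M : Matrix (Fin (m + 1)) (Fin (n + 1)) k)
    (hM : Function.Injective M.mulVecLin) :
    IsVec (matMap E M hM X) ((M.map (algebraMap k E)).mulVec v) :=
  h.map (M.map (algebraMap k E)).mulVecLin _

theorem IsVec.stdCurve {X : PG 1 k} {u : Fin 2 → k} (h : IsVec X u) (r : ℕ) :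
    IsVec (stdCurve r X) (moment r u) := by
  obtain ⟨c, hc, hu⟩ := h.exists_smul (isVec_rep X)
  have h1 : IsVec (BBConic.stdCurve r X) (moment r X.rep) := isVec_mk _
  have h2 : moment r X.rep = c ^ r • moment r u := by
    rw [hu]
    ext i
    have hi : (r - (i : ℕ)) + i = r := Nat.sub_add_cancel (Nat.le_of_lt_succ i.2)
    have hp : c ^ r = c ^ (r - (i : ℕ)) * c ^ (i : ℕ) := by rw [← pow_add, hi]
    simp only [moment, Pi.smul_apply, smul_eq_mul, mul_pow, hp]
    ring
  rw [h2] at h1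
  exact h1.of_smul

theorem IsVec.nrc_pt {F : Type*} [Field F] {r m : ℕ} (N : NRC r m F) {E : Type*} [Field E]
    [Algebra F E] {X : PG 1 E} {u : Fin 2 → E} (h : IsVec X u) :
    IsVec (N.pt E X) ((N.mat.map (algebraMap F E)).mulVec (moment r u)) :=
  (h.stdCurve r).matMap N.mat N.inj

/-- Membership in a normal rational curve, in terms of representing vectors. -/
theorem NRC.mem_points_iff {F : Type*} [Field F] {r m : ℕ} (N : NRC r m F) {E : Type*} [Field E]
    [Algebra F E] {Z : PG m E} : Z ∈ N.points E ↔
      ∃ u : Fin 2 → E, u ≠ 0 ∧ IsVec Z ((N.mat.map (algebraMap F E)).mulVec (moment r u)) := by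
  constructor
  · rintro ⟨X, rfl⟩
    exact ⟨X.rep, X.rep_nonzero, (isVec_rep X).nrc_pt N⟩
  · rintro ⟨u, hu, h⟩
    exact ⟨Projectivization.mk E u hu, ((isVec_mk hu).nrc_pt N).eq h⟩

/-- The intersection of a normal rational curve with a hyperplane, computed from arbitrary vectors
representing the parameters of the common points. -/
theorem NRC.meetsIn_of_vec {F : Type*} [Field F] {r n : ℕ} (N : NRC r n F) (E : Type*) [Field E]
    [Algebra F E] {U S : Submodule F (Fin (n + 1) → F)} {Z : Fin r → PG n E}
    (h : (Fin (n + 1) → E) →ₗ[E] E) (p : Fin r → Fin 2 → E) (c : E)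
    (hS : ∀ v ∈ spaceExt E U, h v = 0 ↔ v ∈ spaceExt E S)
    (hp : ∀ i, p i ≠ 0)
    (hZ : ∀ i, IsVec (Z i) ((N.mat.map (algebraMap F E)).mulVec (moment r (p i)))) (hc : c ≠ 0)
    (hf : ∀ w : Fin 2 → E, h ((N.mat.map (algebraMap F E)).mulVec (moment r w)) =
      c * ∏ i, (w 0 * p i 1 - w 1 * p i 0)) : N.MeetsIn E U S Z := by
  have hv : ∀ i, IsVec (Projectivization.mk E (p i) (hp i)) (p i) := fun i => isVec_mk _
  choose d hd hd' using fun i => (isVec_rep (Projectivization.mk E (p i) (hp i))).exists_smul (hv i)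
  refine ⟨h, fun i => Projectivization.mk E (p i) (hp i), c * ∏ i, d i, hS,
    fun i => ((hv i).nrc_pt N).eq (hZ i), mul_ne_zero hc (Finset.prod_ne_zero_iff.2 fun i _ => hd i),
    fun w => ?_⟩
  rw [hf, mul_assoc, ← Finset.prod_mul_distrib]
  congr 1
  refine Finset.prod_congr rfl fun i _ => ?_
  have h0 := congrFun (hd' i) 0
  have h1 := congrFun (hd' i) 1
  simp only [Pi.smul_apply, smul_eq_mul] at h0 h1
  rw [h0, h1]
  ring

end Coordinates

/-! ### Extension of scalars for subspaces -/

section SpaceExt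

variable {k : Type*} (E : Type*) [Field k] [Field E] [Algebra k E] {n : ℕ}

theorem vecExt_mem_spaceExt {W : Submodule k (Fin n → k)} {v : Fin n → k} (h : v ∈ W) :
    vecExt k E n v ∈ spaceExt E W :=
  Submodule.subset_span ⟨v, h, rfl⟩

variable {E}

theorem spaceExt_le {W : Submodule k (Fin n → k)} {U : Submodule E (Fin n → E)}
    (h : ∀ v ∈ W, vecExt k E n v ∈ U) : spaceExt E W ≤ U := by
  refine Submodule.span_le.2 ?_
  rintro _ ⟨v, hv, rfl⟩
  exact h v hv

theorem spaceExt_mono {W U : Submodule k (Fin n → k)} (h : W ≤ U) :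
    spaceExt E W ≤ spaceExt E U :=
  spaceExt_le fun _ hv => vecExt_mem_spaceExt E (h hv)

variable (k E) in
theorem vecExt_single (i : Fin n) : vecExt k E n (Pi.single i 1) = Pi.single i 1 := by
  ext j
  by_cases h : j = i <;> simp [vecExt, h]

theorem spaceExt_top : spaceExt E (⊤ : Submodule k (Fin n → k)) = ⊤ := by
  rw [eq_top_iff, ← (Pi.basisFun E (Fin n)).span_eq, Submodule.span_le]
  rintro _ ⟨i, rfl⟩
  rw [Pi.basisFun_apply, ← vecExt_single k]
  exact vecExt_mem_spaceExt E Submodule.mem_top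

/-- A linear form that vanishes on `W` and cuts it out in `U` over the small field does so after
extension of scalars. -/
theorem mem_spaceExt_iff_of_hyperplane {W U : Submodule k (Fin n → k)}
    (h : (Fin n → E) →ₗ[E] E) (hW : ∀ v ∈ W, h (vecExt k E n v) = 0) {e : Fin n → k}
    (he : h (vecExt k E n e) ≠ 0) (hU : ∀ u ∈ U, ∃ c : k, u - c • e ∈ W) :
    ∀ v ∈ spaceExt E U, h v = 0 ↔ v ∈ spaceExt E W := by
  have hW' : ∀ v ∈ spaceExt E W, h v = 0 :=
    fun v hv => (spaceExt_le (U := LinearMap.ker h) (fun v hv => hW v hv)) hv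
  have key : spaceExt E U ≤ spaceExt E W ⊔ Submodule.span E {vecExt k E n e} := by
    refine spaceExt_le fun u hu => ?_
    obtain ⟨c, hc⟩ := hU u hu
    have : vecExt k E n u = vecExt k E n (u - c • e) + algebraMap k E c • vecExt k E n e := by
      rw [map_sub, LinearMap.map_smulₛₗ, sub_add_cancel]
    rw [this]
    exact Submodule.add_mem_sup (vecExt_mem_spaceExt E hc)
      (Submodule.smul_mem _ _ (Submodule.mem_span_singleton_self _))
  intro v hv
  refine ⟨fun h0 => ?_, hW' v⟩
  obtain ⟨s, hs, t, ht, rfl⟩ := Submodule.mem_sup.1 (key hv)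
  obtain ⟨c, rfl⟩ := Submodule.mem_span_singleton.1 ht
  rw [map_add, hW' s hs, zero_add, map_smul, smul_eq_mul, mul_eq_zero] at h0
  rw [h0.resolve_right he, zero_smul, add_zero]
  exact hs

/-- A vector over `E` proportional to two vectors over `k` yields proportionality over `k`. -/
theorem exists_smul_of_vecExt {v w : Fin n → k} {c : E} (hw : w ≠ 0)
    (h : vecExt k E n v = c • vecExt k E n w) : ∃ d : k, v = d • w := by
  obtain ⟨i, hi⟩ := Function.ne_iff.1 hw
  have hi' : algebraMap k E (w i) ≠ 0 := by simpa using hi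
  have h1 : ∀ j, algebraMap k E (v j) = c * algebraMap k E (w j) := fun j => congrFun h j
  have hc : c = algebraMap k E (v i / w i) := by
    rw [map_div₀, eq_div_iff hi', h1 i]
  refine ⟨v i / w i, funext fun j => (algebraMap k E).injective ?_⟩
  rw [h1 j, hc, Pi.smul_apply, smul_eq_mul, map_mul]

end SpaceExt

/-! ### Quadratic forms given by square matrices -/

section Quadrics

variable {F : Type*} [Field F] {n : ℕ}

/-- The quadratic polynomial `∑ S i j x_i x_j`. -/
def quadPoly (S : Matrix (Fin n) (Fin n) F) : MvPolynomial (Fin n) F :=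
  ∑ i, ∑ j, MvPolynomial.C (S i j) * (MvPolynomial.X i * MvPolynomial.X j)

theorem quadPoly_isHomogeneous (S : Matrix (Fin n) (Fin n) F) : (quadPoly S).IsHomogeneous 2 := by
  refine MvPolynomial.IsHomogeneous.sum _ _ _ fun i _ => MvPolynomial.IsHomogeneous.sum _ _ _
    fun j _ => ?_
  have := (MvPolynomial.isHomogeneous_C (Fin n) (S i j)).mul
    ((MvPolynomial.isHomogeneous_X F i).mul (MvPolynomial.isHomogeneous_X F j))
  simpa using this

open Matrix in
theorem aeval_quadPoly {E : Type*} [Field E] [Algebra F E] (S : Matrix (Fin n) (Fin n) F)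
    (x : Fin n → E) :
    MvPolynomial.aeval x (quadPoly S) = x ⬝ᵥ (S.map (algebraMap F E)) *ᵥ x := by
  simp only [quadPoly, map_sum, map_mul, MvPolynomial.aeval_C, MvPolynomial.aeval_X, dotProduct,
    mulVec, Finset.mul_sum, Matrix.map_apply]
  refine Finset.sum_congr rfl fun i _ => Finset.sum_congr rfl fun j _ => ?_
  ring

open Matrix in
theorem eval_quadPoly (S : Matrix (Fin n) (Fin n) F) (x : Fin n → F) :
    MvPolynomial.eval x (quadPoly S) = x ⬝ᵥ S *ᵥ x := by
  have := aeval_quadPoly (E := F) S x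
  rwa [MvPolynomial.aeval_eq_eval, Algebra.algebraMap_self, RingHom.coe_id,
    Matrix.map_id] at this

theorem exists_eq_quadPoly {f : MvPolynomial (Fin n) F} (hf : f.IsHomogeneous 2) :
    ∃ S : Matrix (Fin n) (Fin n) F, f = quadPoly S := by
  rw [f.as_sum]
  refine Finset.sum_induction (M := MvPolynomial (Fin n) F) _ (fun g => ∃ S, g = quadPoly S)
    ?_ ⟨0, by simp [quadPoly]⟩ ?_
  · rintro _ _ ⟨S, rfl⟩ ⟨S', rfl⟩
    refine ⟨S + S', ?_⟩
    simp [quadPoly, Finset.sum_add_distrib, add_mul]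
  · intro d hd
    have hd2 : d.degree = 2 := by
      rw [Finsupp.degree_eq_weight_one (R := ℕ)]
      exact hf (MvPolynomial.mem_support_iff.1 hd)
    have hcard : d.toMultiset.card = 2 := by
      rw [Finsupp.card_toMultiset]
      simpa [Finsupp.degree_eq_sum, Finsupp.sum_fintype] using hd2
    obtain ⟨i, j, hij⟩ := Multiset.card_eq_two.1 hcard
    have hdij : d = Finsupp.single i 1 + Finsupp.single j 1 := by
      apply Multiset.toFinsupp.symm.injective
      change Finsupp.toMultiset _ = Finsupp.toMultiset _
      rw [hij, map_add, Finsupp.toMultiset_single, Finsupp.toMultiset_single, one_smul, one_smul]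
      rfl
    refine ⟨Matrix.single i j (f.coeff d), ?_⟩
    rw [quadPoly, Finset.sum_eq_single i, Finset.sum_eq_single j, Matrix.single_apply_same]
    · conv_lhs => rw [hdij]
      rw [MvPolynomial.X, MvPolynomial.X, MvPolynomial.monomial_mul, MvPolynomial.C_mul_monomial,
        ← hdij]
      simp
    · intro b _ hb
      simp [hb.symm]
    · simp
    · intro b _ hb
      simp [hb.symm]
    · simp

end Quadrics

/-! ### The normal form of a non-degenerate conic with a rational point -/

section Conic

open Matrix

variable {F : Type*} [Field F]

/-- The polar form of the quadratic form `v ↦ v ⬝ᵥ S *ᵥ v`, as a linear form in the second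
variable. -/
def polarForm (S : Matrix (Fin 3) (Fin 3) F) (v : Fin 3 → F) : (Fin 3 → F) →ₗ[F] F where
  toFun w := v ⬝ᵥ S *ᵥ w + w ⬝ᵥ S *ᵥ v
  map_add' x y := by simp only [mulVec_add, dotProduct_add, add_dotProduct]; ring
  map_smul' c x := by
    simp only [mulVec_smul, dotProduct_smul, smul_dotProduct, smul_eq_mul, RingHom.id_apply]; ring

theorem polarForm_comm (S : Matrix (Fin 3) (Fin 3) F) (v w : Fin 3 → F) :
    polarForm S v w = polarForm S w v := add_comm _ _

theorem eval_pderiv_quadPoly (S : Matrix (Fin 3) (Fin 3) F) (v : Fin 3 → F) (i : Fin 3) :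
    MvPolynomial.eval v (MvPolynomial.pderiv i (quadPoly S)) =
      polarForm S v (Pi.single i 1) := by
  fin_cases i <;>
  simp [quadPoly, polarForm, Fin.sum_univ_three, MvPolynomial.pderiv_X, dotProduct, mulVec] <;> ring

/-- Every non-degenerate conic with a rational point `p` has the equation `x₀ x₂ = x₁²` in suitable
coordinates, in which `p` is the first base point. The conclusion lists the coefficients of the
transformed quadratic form, since these survive extension of scalars. -/
theorem exists_conic_normal_form (S : Matrix (Fin 3) (Fin 3) F)
    (hS : ∀ v : Fin 3 → F, v ≠ 0 → v ⬝ᵥ S *ᵥ v = 0 → polarForm S v ≠ 0)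
    (p : Fin 3 → F) (hp : p ≠ 0) (hp0 : p ⬝ᵥ S *ᵥ p = 0) :
    ∃ (A : Matrix (Fin 3) (Fin 3) F) (c : F), c ≠ 0 ∧ Function.Injective A.mulVecLin ∧
      A *ᵥ ![1, 0, 0] = p ∧
      Aᵀ * S * A + (Aᵀ * S * A)ᵀ = !![0, 0, c; 0, -2 * c, 0; c, 0, 0] ∧
      (Aᵀ * S * A) 0 0 = 0 ∧ (Aᵀ * S * A) 1 1 = -c ∧ (Aᵀ * S * A) 2 2 = 0 := by
  set q : (Fin 3 → F) → F := fun v => v ⬝ᵥ S *ᵥ v with hq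
  have hqp : q p = 0 := hp0
  have hself : ∀ v, polarForm S v v = 2 * q v := fun v => (two_mul (q v)).symm
  have hadd : ∀ v w, q (v + w) = q v + q w + polarForm S v w := by
    intro v w
    simp only [hq, polarForm, LinearMap.coe_mk, AddHom.coe_mk, mulVec_add, dotProduct_add,
      add_dotProduct]
    ring
  have hsmul : ∀ (c : F) v, q (c • v) = c ^ 2 * q v := by
    intro c v
    simp only [hq, mulVec_smul, dotProduct_smul, smul_dotProduct, smul_eq_mul]
    ring
  have hpp : polarForm S p p = 0 := by rw [hself, hqp, mul_zero]
  -- a vector `f₂` on the conic with `⟨p, f₂⟩ = 1`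
  obtain ⟨f, hf⟩ : ∃ f, polarForm S p f = 1 := by
    obtain ⟨g, hg⟩ := DFunLike.ne_iff.1 (hS p hp hp0)
    refine ⟨(polarForm S p g)⁻¹ • g, ?_⟩
    rw [map_smul, smul_eq_mul]
    exact inv_mul_cancel₀ hg
  obtain ⟨f₂, hpf₂, hqf₂⟩ : ∃ f₂, polarForm S p f₂ = 1 ∧ q f₂ = 0 := by
    refine ⟨f + (-q f) • p, ?_, ?_⟩
    · rw [map_add, map_smul, hpp, hf, smul_zero, add_zero]
    · rw [hadd, hsmul, hqp, map_smul, polarForm_comm S f p, hf]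
      simp
  -- a vector `f₁` orthogonal to `p` and `f₂`, and independent of `p`
  obtain ⟨g, hg0, hgp⟩ : ∃ g, polarForm S p g = 0 ∧ ∀ c : F, g ≠ c • p := by
    by_contra! hcon
    have hle : LinearMap.ker (polarForm S p) ≤ Submodule.span F {p} := by
      intro g hg
      obtain ⟨c, rfl⟩ := hcon g hg
      exact Submodule.smul_mem _ _ (Submodule.mem_span_singleton_self p)
    have h1 := Submodule.finrank_mono hle
    have h2 := (polarForm S p).finrank_range_add_finrank_ker
    have h3 := (Submodule.finrank_le (LinearMap.range (polarForm S p)))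
    have h4 := finrank_span_singleton (K := F) hp
    rw [Module.finrank_fin_fun] at h2
    rw [Module.finrank_self] at h3
    omega
  obtain ⟨f₁, hpf₁, hff, hf₁p⟩ : ∃ f₁, polarForm S p f₁ = 0 ∧ polarForm S f₁ f₂ = 0 ∧
      ∀ c : F, f₁ ≠ c • p := by
    refine ⟨g + (-polarForm S g f₂) • p, ?_, ?_, fun c hc => ?_⟩
    · rw [map_add, map_smul, hpp, hg0, smul_zero, add_zero]
    · rw [polarForm_comm, map_add, map_smul, polarForm_comm S f₂ p, hpf₂, polarForm_comm S f₂ g]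
      simp
    · apply hgp (c + polarForm S g f₂)
      rw [add_smul, ← hc]
      simp
  have hspan : ∀ x : Fin 3 → F, x 0 • p + x 1 • f₁ + x 2 • f₂ = 0 → x = 0 := by
    intro x hx
    have h2 := congrArg (polarForm S p) hx
    simp only [map_add, map_smul, hpp, hpf₁, hpf₂, map_zero, smul_eq_mul, mul_zero, zero_add,
      mul_one] at h2
    rw [h2, zero_smul, add_zero] at hx
    have h1 : x 1 = 0 := by
      by_contra h1
      apply hf₁p (-(x 1)⁻¹ * x 0)
      have : x 1 • f₁ = -(x 0 • p) := by rw [eq_neg_iff_add_eq_zero, add_comm]; exact hx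
      rw [mul_smul, neg_smul, ← smul_neg, ← this, smul_smul, inv_mul_cancel₀ h1, one_smul]
    rw [h1, zero_smul, add_zero] at hx
    have h0 : x 0 = 0 := (smul_eq_zero.1 hx).resolve_right hp
    ext i
    fin_cases i <;> assumption
  have hmul : ∀ (a b e : Fin 3 → F) (x : Fin 3 → F), (Matrix.of ![a, b, e])ᵀ *ᵥ x =
      x 0 • a + x 1 • b + x 2 • e := by
    intro a b e x
    ext i
    simp [mulVec, dotProduct, Fin.sum_univ_three, mul_comm]
  -- otherwise `f₁` would be a singular point of the conic
  have hqf₁ : q f₁ ≠ 0 := by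
    intro h0
    have hne : f₁ ≠ 0 := fun h => hf₁p 0 (by rw [h, zero_smul])
    refine hS f₁ hne h0 ?_
    have hsurj : Function.Surjective ((Matrix.of ![p, f₁, f₂])ᵀ).mulVecLin := by
      rw [← LinearMap.injective_iff_surjective, ← LinearMap.ker_eq_bot, LinearMap.ker_eq_bot']
      intro x hx
      rw [mulVecLin_apply, hmul] at hx
      exact hspan x hx
    refine LinearMap.ext fun v => ?_
    obtain ⟨x, rfl⟩ := hsurj v
    rw [mulVecLin_apply, hmul]
    simp [polarForm_comm S f₁ p, hpf₁, hff, hself, h0]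
  -- the factor of the third base vector makes the coefficients of `x₀ x₂` and `-x₁²` equal
  refine ⟨(Matrix.of ![p, f₁, (-q f₁) • f₂])ᵀ, -q f₁, neg_ne_zero.2 hqf₁, ?_, ?_, ?_⟩
  · rw [← LinearMap.ker_eq_bot, LinearMap.ker_eq_bot']
    intro x hx
    rw [mulVecLin_apply, hmul, smul_smul] at hx
    have := hspan ![x 0, x 1, x 2 * -q f₁] hx
    have h0 := congrFun this 0
    have h1 := congrFun this 1
    have h2 := congrFun this 2
    simp [hqf₁] at h0 h1 h2
    ext i
    fin_cases i <;> assumption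
  · rw [hmul]; simp
  · have hent : ∀ (B : Fin 3 → Fin 3 → F) (i j : Fin 3),
        ((Matrix.of B)ᵀᵀ * S * (Matrix.of B)ᵀ) i j = B i ⬝ᵥ S *ᵥ (B j) := by
      intro B i j
      rw [Matrix.mul_assoc, transpose_transpose, Matrix.mul_apply_eq_vecMul, ← vecMul_vecMul,
        dotProduct_mulVec]
      rfl
    have hent' : ∀ (B : Fin 3 → Fin 3 → F) (i j : Fin 3),
        ((Matrix.of B)ᵀᵀ * S * (Matrix.of B)ᵀ) i j + ((Matrix.of B)ᵀᵀ * S * (Matrix.of B)ᵀ) j i =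
        polarForm S (B i) (B j) := by
      intro B i j
      rw [hent, hent]; rfl
    have e1 := hsmul (-q f₁) f₂
    have e2 : q (-(q f₁ • f₂)) = 0 := by rw [← neg_smul, e1, hqf₂, mul_zero]
    refine ⟨?_, ?_, ?_, ?_⟩
    · ext i j
      rw [Matrix.add_apply, transpose_apply, hent']
      fin_cases i <;> fin_cases j <;>
      simp [hpp, hpf₁, hpf₂, hff, hself, e2, polarForm_comm S f₁ p, polarForm_comm S (-(q f₁ • f₂))]
    · rw [hent]; exact hqp
    · rw [hent]; simp [hq]
    · rw [hent]; exact e1.trans (by rw [hqf₂, mul_zero])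

/-- The normal form, evaluated over an extension field. -/
theorem aeval_normal_form {E : Type*} [Field E] [Algebra F E] {S A : Matrix (Fin 3) (Fin 3) F}
    {c : F} (h : Aᵀ * S * A + (Aᵀ * S * A)ᵀ = !![0, 0, c; 0, -2 * c, 0; c, 0, 0])
    (h0 : (Aᵀ * S * A) 0 0 = 0) (h1 : (Aᵀ * S * A) 1 1 = -c) (h2 : (Aᵀ * S * A) 2 2 = 0)
    (x : Fin 3 → E) :
    MvPolynomial.aeval (A.map (algebraMap F E) *ᵥ x) (quadPoly S) =
      algebraMap F E c * (x 0 * x 2 - x 1 ^ 2) := by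
  set G := Aᵀ * S * A with hG
  have e : MvPolynomial.aeval (A.map (algebraMap F E) *ᵥ x) (quadPoly S) =
      x ⬝ᵥ (G.map (algebraMap F E)) *ᵥ x := by
    rw [aeval_quadPoly, hG, Matrix.map_mul, Matrix.map_mul, ← mulVec_mulVec, ← mulVec_mulVec,
      dotProduct_mulVec x, transpose_map, vecMul_transpose]
  have key : ∀ i j, algebraMap F E (G i j) + algebraMap F E (G j i) =
      algebraMap F E (!![0, 0, c; 0, -2 * c, 0; c, 0, 0] i j) := by
    intro i j
    rw [← map_add, ← h]; rfl
  have k01 := key 0 1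
  have k02 := key 0 2
  have k12 := key 1 2
  simp at k01 k02 k12
  rw [e]
  simp only [dotProduct, mulVec, Fin.sum_univ_three, map_apply, h0, h1, h2, map_neg, map_zero]
  linear_combination (x 0 * x 1) * k01 + (x 0 * x 2) * k02 + (x 1 * x 2) * k12

/-- The zeros of `x₀ x₂ = x₁²` are the multiples of the vectors `(s², st, t²)`. -/
theorem exists_moment_two {E : Type*} [Field E] {x : Fin 3 → E} (hx : x ≠ 0)
    (h : x 0 * x 2 - x 1 ^ 2 = 0) :
    ∃ (u : Fin 2 → E) (c : E), u ≠ 0 ∧ c ≠ 0 ∧ x = c • moment 2 u := by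
  by_cases h2 : x 2 = 0
  · have h1 : x 1 = 0 := by simpa [h2] using h
    have h0 : x 0 ≠ 0 := by
      intro h0
      apply hx
      ext i; fin_cases i <;> assumption
    refine ⟨![1, 0], x 0, fun h => one_ne_zero (congrFun h 0), h0, ?_⟩
    ext i; fin_cases i <;> simp [moment, h1, h2]
  · refine ⟨![x 1, x 2], (x 2)⁻¹, fun h => h2 (congrFun h 1), inv_ne_zero h2, ?_⟩
    ext i
    fin_cases i <;> simp [moment]
    · field_simp
      linear_combination h
    · field_simp
    · field_simp

theorem moment_two_eq {E : Type*} [Field E] (u : Fin 2 → E) :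
    moment 2 u = ![u 0 ^ 2, u 0 * u 1, u 1 ^ 2] := by
  ext i; fin_cases i <;> simp [moment]

/-- A quadratic form in three variables over a finite field has a nontrivial zero, by the theorem
of Chevalley and Warning. -/
theorem exists_ne_zero_eval_eq_zero [Fintype F] {Q : MvPolynomial (Fin 3) F}
    (hQ : Q.IsHomogeneous 2) : ∃ p : Fin 3 → F, p ≠ 0 ∧ MvPolynomial.eval p Q = 0 := by
  classical
  obtain ⟨ℓ, hℓ⟩ := CharP.exists F
  have := hℓ
  have hprime : ℓ.Prime := (CharP.char_is_prime_or_zero F ℓ).resolve_right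
    (CharP.char_ne_zero_of_finite F ℓ)
  have hdvd := char_dvd_card_solutions (K := F) ℓ (f := Q)
    (lt_of_le_of_lt hQ.totalDegree_le (by simp))
  have h0 : MvPolynomial.eval (0 : Fin 3 → F) Q = 0 := by
    obtain ⟨S, rfl⟩ := exists_eq_quadPoly hQ
    rw [eval_quadPoly]; simp
  by_contra! hcon
  have : Fintype.card {x : Fin 3 → F // MvPolynomial.eval x Q = 0} = 1 := by
    rw [Fintype.card_eq_one_iff]
    refine ⟨⟨0, h0⟩, fun y => Subtype.ext ?_⟩
    by_contra hy
    exact hcon y.1 hy y.2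
  rw [this] at hdvd
  exact hprime.one_lt.ne' (Nat.dvd_one.1 hdvd)

end Conic

/-! ### Powers of the Frobenius map -/

section Frobenius

variable (F : Type*) [Field F] [Fintype F]

/-- The `i`-th power `x ↦ x ^ (q ^ i)` of the Frobenius map, where `q = |F|`. -/
def tw {E : Type*} [Field E] [Algebra F E] (i : ℕ) : E →+* E :=
  ((FiniteField.frobeniusAlgHom F E) ^ i : E →ₐ[F] E)

variable {E : Type*} [Field E] [Algebra F E]

@[simp] theorem tw_zero (x : E) : tw F 0 x = x := by simp [tw]

theorem tw_succ (i : ℕ) (x : E) : tw F (i + 1) x = tw F i x ^ Fintype.card F := by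
  simp only [tw, pow_succ', RingHom.coe_coe, AlgHom.mul_apply]
  rfl

theorem tw_one (x : E) : tw F 1 x = x ^ Fintype.card F := by rw [tw_succ, tw_zero]

theorem tw_tw (i j : ℕ) (x : E) : tw F i (tw F j x) = tw F (i + j) x := by
  simp [tw, pow_add]

@[simp] theorem tw_base (i : ℕ) (c : F) : tw F i (algebraMap F E c) = algebraMap F E c := by
  simp [tw]

theorem vecConj_apply (n : ℕ) (v : Fin n → E) (j : Fin n) : vecConj F E n v j = tw F 1 (v j) :=
  (tw_one F _).symm

theorem vecConj_vecExt {n : ℕ} (v : Fin n → F) : vecConj F E n (vecExt F E n v) = vecExt F E n v :=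
  funext fun j => by rw [vecConj_apply]; exact tw_base F 1 (v j)

variable {K : Type*} [Field K] [Algebra F K]

@[simp] theorem tw_algebraMap [Algebra K E] [IsScalarTower F K E] (i : ℕ) (x : K) :
    tw F i (algebraMap K E x) = algebraMap K E (tw F i x) := by
  induction i with
  | zero => simp
  | succ i ih => rw [tw_succ, tw_succ, ih, map_pow]

variable {F}

theorem tw_three (hK : Module.finrank F K = 3) (x : K) : tw F 3 x = x := by
  have : FiniteDimensional F K := Module.finite_of_finrank_pos (by omega)
  have : Finite K := Module.finite_of_finite F
  have h := pow_orderOf_eq_one (FiniteField.frobeniusAlgHom F K)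
  rw [FiniteField.orderOf_frobeniusAlgHom, hK] at h
  rw [tw, h]; rfl

/-- The trace of a cubic extension as a sum of conjugates. -/
theorem algebraMap_trace (hK : Module.finrank F K = 3) (x : K) :
    algebraMap F K (Algebra.trace F K x) = x + tw F 1 x + tw F 2 x := by
  have : FiniteDimensional F K := Module.finite_of_finrank_pos (by omega)
  have : Finite K := Module.finite_of_finite F
  rw [FiniteField.algebraMap_trace_eq_sum_pow, hK, Nat.card_eq_fintype_card]
  simp only [Finset.sum_range_succ, Finset.sum_range_zero, tw_succ, tw_zero]
  ring

/-- The fixed elements of the Frobenius map lie in `F`, since they are roots of `X ^ q - X`. -/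
theorem mem_base_of_tw_one {x : K} (hx : tw F 1 x = x) :
    ∃ c : F, algebraMap F K c = x := by
  classical
  let p : Polynomial K := Polynomial.X ^ Fintype.card F - Polynomial.X
  have hp : p ≠ 0 := FiniteField.X_pow_card_sub_X_ne_zero K Fintype.one_lt_card
  have hdeg : p.natDegree = Fintype.card F :=
    FiniteField.X_pow_card_sub_X_natDegree_eq K Fintype.one_lt_card
  by_contra! hcon
  have hroot : ∀ y : K, tw F 1 y = y → y ∈ p.roots.toFinset := by
    intro y hy
    rw [Multiset.mem_toFinset, Polynomial.mem_roots hp]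
    rw [tw_one] at hy
    simp [p, hy]
  have hsub : insert x (Finset.univ.image (algebraMap F K)) ⊆ p.roots.toFinset := by
    intro y hy
    rcases Finset.mem_insert.1 hy with rfl | hy
    · exact hroot _ hx
    · obtain ⟨c, -, rfl⟩ := Finset.mem_image.1 hy
      exact hroot _ (tw_base F 1 c)
  have h1 := Finset.card_le_card hsub
  rw [Finset.card_insert_of_notMem (by simpa using hcon),
    Finset.card_image_of_injective _ (algebraMap F K).injective, Finset.card_univ] at h1
  have h2 := (Multiset.toFinset_card_le p.roots).trans (Polynomial.card_roots' p)
  omega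

end Frobenius

/-! ### Coordinates of `PG(8, E)` along a plane and its conjugates -/

section Coordinates

open Matrix

variable {F K : Type*} [Field F] [Fintype F] [Field K] [Algebra F K]

variable (F) in
/-- The conjugate of a matrix by the `i`-th power of the Frobenius map, read over `E`. -/
def twMat {m n : Type*} (E : Type*) [Field E] [Algebra K E] (i : ℕ) (D : Matrix m n K) :
    Matrix m n E :=
  D.map fun x => algebraMap K E (tw F i x)

variable (F) in
/-- The vector `D x₀ + D^σ x₁ + D^{σ²} x₂`, where `σ` is the Frobenius map. When the plane of
`D` and its conjugates span the space, these are coordinates of the space. -/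
def comb {n : ℕ} {E : Type*} [Field E] [Algebra K E] (D : Matrix (Fin n) (Fin 3) K)
    (x : Fin 3 → Fin 3 → E) : Fin n → E :=
  twMat F E 0 D *ᵥ x 0 + twMat F E 1 D *ᵥ x 1 + twMat F E 2 D *ᵥ x 2

/-- The vector over `F` whose coordinates are the traces of those of `D x`. -/
def traceVec {n : ℕ} (D : Matrix (Fin n) (Fin 3) K) : (Fin 3 → K) →ₗ[F] (Fin n → F) where
  toFun x k := Algebra.trace F K ((D *ᵥ x) k)
  map_add' x y := by ext k; simp [mulVec_add]
  map_smul' c x := by ext k; simp [mulVec_smul]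

variable {n : ℕ} {E : Type*} [Field E] [Algebra K E]

theorem twMat_mul {m k l : Type*} [Fintype k] (i : ℕ) (A : Matrix m k K) (B : Matrix k l K) :
    twMat F E i (A * B) = twMat F E i A * twMat F E i B :=
  Matrix.map_mul (f := (algebraMap K E).comp (tw F i))

theorem twMat_zero {m k : Type*} (A : Matrix m k K) : twMat F E 0 A = A.map (algebraMap K E) := by
  ext; simp [twMat]

theorem twMat_self {m k : Type*} (i : ℕ) (A : Matrix m k K) : twMat F K i A = A.map (tw F i) := by
  ext; simp [twMat]

theorem twMat_map {m k : Type*} (i : ℕ) (A : Matrix m k K) :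
    (twMat F K i A).map (algebraMap K E) = twMat F E i A := by
  ext; simp [twMat]

theorem twMat_mulVec {m k : Type*} [Fintype k] (i : ℕ) (A : Matrix m k K) (x : k → K) :
    twMat F E i A *ᵥ (fun j => algebraMap K E (tw F i (x j))) =
      fun j => algebraMap K E (tw F i ((A *ᵥ x) j)) := by
  ext j
  simp [twMat, mulVec, dotProduct, map_sum]

theorem comb_add (D : Matrix (Fin n) (Fin 3) K) (x y : Fin 3 → Fin 3 → E) :
    comb F D (x + y) = comb F D x + comb F D y := by
  simp only [comb, Pi.add_apply, mulVec_add]; abel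

theorem comb_smul (D : Matrix (Fin n) (Fin 3) K) (c : E) (x : Fin 3 → Fin 3 → E) :
    comb F D (c • x) = c • comb F D x := by
  simp only [comb, Pi.smul_apply, mulVec_smul, smul_add]

/-- The map `comb` as a linear map. -/
def combLin (F : Type*) [Field F] [Fintype F] [Algebra F K] (E : Type*) [Field E] [Algebra K E]
    (D : Matrix (Fin n) (Fin 3) K) : (Fin 3 → Fin 3 → E) →ₗ[E] (Fin n → E) where
  toFun := comb F D
  map_add' := comb_add D
  map_smul' := comb_smul D

/-- A vector over `F` in the coordinates `comb`: its three components are conjugate. -/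
theorem vecExt_traceVec (hK : Module.finrank F K = 3) [Algebra F E] [IsScalarTower F K E]
    (D : Matrix (Fin n) (Fin 3) K) (x : Fin 3 → K) :
    vecExt F E n (traceVec D x) = comb F D (fun i j => algebraMap K E (tw F i (x j))) := by
  ext k
  have h : ∀ i : ℕ, (twMat F E i D *ᵥ fun j => algebraMap K E (tw F i (x j))) k =
      algebraMap K E (tw F i ((D *ᵥ x) k)) := fun i => congrFun (twMat_mulVec i D x) k
  have h0 := h 0
  have h1 := h 1
  have h2 := h 2
  change algebraMap F E (Algebra.trace F K ((D *ᵥ x) k)) = _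
  rw [IsScalarTower.algebraMap_apply F K E, algebraMap_trace hK, map_add, map_add]
  simp only [comb, Pi.add_apply, Fin.val_zero, Fin.val_one, Fin.val_two, h0, h1, h2]
  rw [tw_zero]

theorem vecConj_twMat_mulVec [Algebra F E] [IsScalarTower F K E] (i : ℕ)
    (D : Matrix (Fin n) (Fin 3) K) (x : Fin 3 → E) :
    vecConj F E n (twMat F E i D *ᵥ x) = twMat F E (i + 1) D *ᵥ (vecConj F E 3 x) := by
  ext k
  simp only [vecConj_apply, mulVec, dotProduct, map_sum, map_mul, twMat, map_apply, tw_algebraMap,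
    tw_tw, add_comm]

/-- A vector over `F` in the span of the three conjugate planes is a vector of traces. -/
theorem eq_traceVec_of_vecExt_eq_comb (hK : Module.finrank F K = 3)
    {D : Matrix (Fin n) (Fin 3) K} (hD : Function.Injective (combLin F K D)) {v : Fin n → F}
    {x : Fin 3 → Fin 3 → K} (h : vecExt F K n v = comb F D x) : v = traceVec D (x 0) := by
  have h3 : twMat F K 3 D = twMat F K 0 D := by ext; simp [twMat, tw_three hK]
  -- conjugation permutes the three components cyclically, and `v` is fixed by it
  have hc : vecConj F K n (comb F D x) =
      comb F D ![vecConj F K 3 (x 2), vecConj F K 3 (x 0), vecConj F K 3 (x 1)] := by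
    simp only [comb, map_add, vecConj_twMat_mulVec, zero_add, h3, Nat.reduceAdd]
    simp only [cons_val]
    abel
  have h1 : combLin F K D ![vecConj F K 3 (x 2), vecConj F K 3 (x 0), vecConj F K 3 (x 1)] =
      combLin F K D x := by
    change comb F D _ = comb F D _
    rw [← hc, ← h, vecConj_vecExt]
  have h2 := hD h1
  have hx1 : ∀ j, x 1 j = tw F 1 (x 0 j) := fun j => by
    rw [← vecConj_apply]; exact (congrFun (congrFun h2 1) j).symm
  have hx2 : ∀ j, x 2 j = tw F 2 (x 0 j) := fun j => by
    rw [← tw_tw F 1 1, ← hx1, ← vecConj_apply]; exact (congrFun (congrFun h2 2) j).symm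
  apply vecExt_injective F K n
  rw [h, vecExt_traceVec hK]
  congr 1
  ext i j
  fin_cases i
  · simp
  · exact hx1 j
  · exact hx2 j

theorem spaceConj_range_le (i : ℕ) (D : Matrix (Fin n) (Fin 3) K) :
    spaceConj F (LinearMap.range (twMat F K i D).mulVecLin) ≤
      LinearMap.range (twMat F K (i + 1) D).mulVecLin := by
  refine Submodule.span_le.2 ?_
  rintro _ ⟨_, ⟨y, rfl⟩, rfl⟩
  exact ⟨vecConj F K 3 y, (vecConj_twMat_mulVec i D y).symm⟩

theorem spaceConj_mono {V W : Submodule K (Fin n → K)} (h : V ≤ W) :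
    spaceConj F V ≤ spaceConj F W :=
  Submodule.span_mono (Set.image_mono h)

theorem vecConj_mem_spaceConj {V : Submodule K (Fin n → K)} {v : Fin n → K} (h : v ∈ V) :
    vecConj F K n v ∈ spaceConj F V :=
  Submodule.subset_span ⟨v, h, rfl⟩

theorem exists_comb_of_mem_conjSpan {D : Matrix (Fin n) (Fin 3) K}
    {V : Submodule K (Fin 3 → K)} {v : Fin n → K}
    (h : v ∈ conjSpan F (V.map D.mulVecLin)) : ∃ x : Fin 3 → Fin 3 → K, x 0 ∈ V ∧
      v = comb F D x := by
  have hD : D = twMat F K 0 D := by ext; simp [twMat]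
  obtain ⟨y, hy, z, hz, rfl⟩ := Submodule.mem_sup.1 h
  obtain ⟨w, hw, y', hy', rfl⟩ := Submodule.mem_sup.1 hy
  obtain ⟨x, hx, rfl⟩ := hw
  have hle : V.map D.mulVecLin ≤ LinearMap.range (twMat F K 0 D).mulVecLin := by
    rw [← hD]; exact LinearMap.map_le_range
  have h1 := (spaceConj_mono hle).trans (spaceConj_range_le (F := F) 0 D)
  have h2 := (spaceConj_mono h1).trans (spaceConj_range_le (F := F) 1 D)
  obtain ⟨x', rfl⟩ := h1 hy'
  obtain ⟨x'', rfl⟩ := h2 hz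
  refine ⟨![x, x', x''], hx, ?_⟩
  simp only [comb, ← hD]
  rfl

/-- The subspace over `F` of the span of a subspace of the plane and its two conjugates. -/
theorem mem_comap_conjSpan_iff (hK : Module.finrank F K = 3) {D : Matrix (Fin n) (Fin 3) K}
    (hD : Function.Injective (combLin F K D)) (V : Submodule K (Fin 3 → K)) (v : Fin n → F) :
    v ∈ (conjSpan F (V.map D.mulVecLin)).comap (vecExt F K n) ↔ ∃ x ∈ V, v = traceVec D x := by
  rw [Submodule.mem_comap]
  constructor
  · intro h
    obtain ⟨x, hx, h⟩ := exists_comb_of_mem_conjSpan h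
    exact ⟨x 0, hx, eq_traceVec_of_vecExt_eq_comb hK hD h⟩
  · rintro ⟨x, hx, rfl⟩
    have hmem : D *ᵥ x ∈ V.map D.mulVecLin := ⟨x, hx, rfl⟩
    have h1 := vecConj_mem_spaceConj (F := F) hmem
    have h2 := vecConj_mem_spaceConj (F := F) h1
    have he : vecExt F K n (traceVec D x) = D *ᵥ x + vecConj F K n (D *ᵥ x) +
        vecConj F K n (vecConj F K n (D *ᵥ x)) := by
      ext k
      simp only [Pi.add_apply, vecConj_apply, tw_tw]
      exact algebraMap_trace hK _
    rw [he]
    exact Submodule.add_mem_sup (Submodule.add_mem_sup hmem h1) h2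

/-- Three conjugate planes that span the space give coordinates over each extension field; the
matrices `P i` compute them. -/
theorem exists_coordinates {D : Matrix (Fin 9) (Fin 3) K}
    (hD : conjSpan F (LinearMap.range D.mulVecLin) = ⊤) :
    ∃ P : Fin 3 → Matrix (Fin 3) (Fin 9) K,
      (∀ i j : Fin 3, P i * twMat F K j D = if i = j then 1 else 0) ∧
      ∑ i : Fin 3, twMat F K i D * P i = 1 := by
  -- the square matrix of `comb` is surjective, hence invertible
  let W : Matrix (Fin 9) (Fin 3 × Fin 3) K := Matrix.of fun k p => tw F p.1 (D k p.2)
  have hW : ∀ x : Fin 3 → Fin 3 → K, W *ᵥ (fun p => x p.1 p.2) = comb F D x := by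
    intro x
    ext k
    simp [W, mulVec, dotProduct, Fintype.sum_prod_type, Fin.sum_univ_three, comb, twMat]
  have hsurj : Function.Surjective W.mulVec := by
    intro v
    have hv : v ∈ conjSpan F ((⊤ : Submodule K (Fin 3 → K)).map D.mulVecLin) := by
      rw [Submodule.map_top, hD]; exact Submodule.mem_top
    obtain ⟨x, -, rfl⟩ := exists_comb_of_mem_conjSpan hv
    exact ⟨_, hW x⟩
  obtain ⟨V, hV⟩ := mulVec_surjective_iff_exists_right_inverse.1 hsurj
  have hV' : V * W = 1 := (mul_eq_one_comm_of_card_eq _ _ _ (by simp)).1 hV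
  refine ⟨fun i => Matrix.of fun j k => V (i, j) k, fun i j => ?_, ?_⟩
  · ext a b
    have := congrFun (congrFun hV' (i, a)) (j, b)
    rw [mul_apply, one_apply] at this
    simp only [mul_apply, of_apply, twMat_self, map_apply]
    refine this.trans ?_
    by_cases hij : i = j
    · simp [hij, one_apply]
    · simp [hij]
  · ext a b
    have := congrFun (congrFun hV a) b
    rw [mul_apply, Fintype.sum_prod_type] at this
    rw [← this, Matrix.sum_apply]
    refine Finset.sum_congr rfl fun i _ => ?_
    simp [mul_apply, twMat_self, W]

theorem mulVec_comb {D : Matrix (Fin 9) (Fin 3) K} {P : Fin 3 → Matrix (Fin 3) (Fin 9) K}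
    (hP : ∀ i j : Fin 3, P i * twMat F K j D = if i = j then 1 else 0) (i : Fin 3)
    (x : Fin 3 → Fin 3 → E) : (P i).map (algebraMap K E) *ᵥ comb F D x = x i := by
  have h : ∀ j : Fin 3, (P i).map (algebraMap K E) * twMat F E j D =
      if i = j then 1 else 0 := by
    intro j
    rw [← twMat_map, ← Matrix.map_mul, hP]
    split_ifs
    · exact Matrix.map_one _ (map_zero _) (map_one _)
    · exact Matrix.map_zero _ (map_zero _)
  have h0 := h 0
  have h1 := h 1
  have h2 := h 2
  simp only [comb, mulVec_add, mulVec_mulVec]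
  simp only [Fin.val_zero, Fin.val_one, Fin.val_two] at h0 h1 h2
  rw [h0, h1, h2]
  fin_cases i <;> simp

theorem comb_mulVec {D : Matrix (Fin 9) (Fin 3) K} {P : Fin 3 → Matrix (Fin 3) (Fin 9) K}
    (hP : ∑ i : Fin 3, twMat F K i D * P i = 1) (z : Fin 9 → E) :
    comb F D (fun i => (P i).map (algebraMap K E) *ᵥ z) = z := by
  have h := congrArg (fun A => A.map (algebraMap K E)) hP
  simp only [Fin.sum_univ_three, Fin.val_zero, Fin.val_one, Fin.val_two] at h
  rw [Matrix.map_one _ (map_zero _) (map_one _), Matrix.map_add _ (map_add _),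
    Matrix.map_add _ (map_add _), Matrix.map_mul, Matrix.map_mul, Matrix.map_mul, twMat_map,
    twMat_map, twMat_map] at h
  simp only [comb, mulVec_mulVec, ← add_mulVec]
  rw [h, one_mulVec]

theorem combLin_injective {D : Matrix (Fin 9) (Fin 3) K} {P : Fin 3 → Matrix (Fin 3) (Fin 9) K}
    (hP : ∀ i j : Fin 3, P i * twMat F K j D = if i = j then 1 else 0) :
    Function.Injective (combLin F E D) := by
  intro x y h
  ext1 i
  rw [← mulVec_comb (E := E) hP i x, ← mulVec_comb (E := E) hP i y]
  exact congrArg _ h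

theorem comb_injective {D : Matrix (Fin 9) (Fin 3) K} {P : Fin 3 → Matrix (Fin 3) (Fin 9) K}
    (hP : ∀ i j : Fin 3, P i * twMat F K j D = if i = j then 1 else 0)
    {x y : Fin 3 → Fin 3 → E} (h : comb F D x = comb F D y) : x = y :=
  combLin_injective (E := E) hP h

end Coordinates

/-! ### Quadrics through the planes of a conic -/

section Scroll

open Matrix

/-- If the quadratic form of `β` vanishes on an additive subgroup, it vanishes on its span: the
polar form vanishes on the subgroup as well, hence on the span. -/
theorem apply_self_eq_zero_of_mem_span {E V : Type*} [Field E] [AddCommGroup V] [Module E V]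
    (β : V →ₗ[E] V →ₗ[E] E) (s : AddSubgroup V) (h : ∀ c ∈ s, β c c = 0) {v : V}
    (hv : v ∈ Submodule.span E (s : Set V)) : β v v = 0 := by
  have h1 : ∀ c ∈ s, ∀ d ∈ s, (β + β.flip) c d = 0 := by
    intro c hc d hd
    have := h (c + d) (s.add_mem hc hd)
    simp only [map_add, LinearMap.add_apply, h c hc, h d hd] at this
    simp only [LinearMap.add_apply, LinearMap.flip_apply]
    linear_combination this
  have h2 : ∀ d ∈ s, ∀ w ∈ Submodule.span E (s : Set V), (β + β.flip) w d = 0 := by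
    intro d hd w hw
    have hle : Submodule.span E (s : Set V) ≤ LinearMap.ker ((β + β.flip).flip d) :=
      Submodule.span_le.2 fun c hc => h1 c hc d hd
    exact hle hw
  have h3 : ∀ w ∈ Submodule.span E (s : Set V), ∀ x ∈ Submodule.span E (s : Set V),
      (β + β.flip) w x = 0 := by
    intro w hw x hx
    have hle : Submodule.span E (s : Set V) ≤ LinearMap.ker ((β + β.flip) w) :=
      Submodule.span_le.2 fun c hc => h2 c hc w hw
    exact hle hx
  induction hv using Submodule.span_induction with
  | mem x hx => exact h x hx
  | zero => simp
  | add x y hx hy h4 h5 =>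
    have := h3 x hx y hy
    simp only [LinearMap.add_apply, LinearMap.flip_apply] at this
    simp only [map_add, LinearMap.add_apply, h4, h5]
    linear_combination this
  | smul a x _ h4 => simp [h4]

variable {F K : Type*} [Field F] [Fintype F] [Field K] [Algebra F K]

/-- A binary quartic form that vanishes on the at least five points of the line over `F` is zero. -/
theorem quartic_eq_zero (hq : 4 ≤ Fintype.card F) {c₀ c₁ c₂ c₃ c₄ : F}
    (h : ∀ s t : F, c₀ * s ^ 4 + c₁ * (s ^ 3 * t) + c₂ * (s ^ 2 * t ^ 2) + c₃ * (s * t ^ 3) +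
      c₄ * t ^ 4 = 0) : c₀ = 0 ∧ c₁ = 0 ∧ c₂ = 0 ∧ c₃ = 0 ∧ c₄ = 0 := by
  -- the point `(1, 0)` removes one coefficient, which leaves a cubic with at least four roots
  have h0 : c₀ = 0 := by simpa using h 1 0
  have hp : (Cubic.mk c₁ c₂ c₃ c₄).toPoly = 0 := by
    refine Polynomial.eq_zero_of_natDegree_lt_card_of_eval_eq_zero _ (f := (id : F → F))
      Function.injective_id (fun s => ?_) ?_
    · have := h s 1
      simp only [Cubic.toPoly, Polynomial.eval_add, Polynomial.eval_mul, Polynomial.eval_C,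
        Polynomial.eval_pow, Polynomial.eval_X, id]
      rw [h0] at this
      linear_combination this
    · refine lt_of_le_of_lt ?_ (lt_of_lt_of_le (by norm_num : 3 < 4) hq)
      rw [Cubic.toPoly]
      compute_degree
  have := (Cubic.toPoly_eq_zero_iff _).1 hp
  simp only [Cubic.ext_iff] at this
  exact ⟨h0, this⟩

/-- The three embeddings of a cubic extension are independent: the vectors of conjugates of its
elements span the whole space. -/
theorem span_conjugates (hK : Module.finrank F K = 3) (E : Type*) [Field E] [Algebra K E] :
    Submodule.span E (Set.range fun (ω : K) (i : Fin 3) => algebraMap K E (tw F i ω)) = ⊤ := by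
  have : FiniteDimensional F K := Module.finite_of_finrank_pos (by omega)
  have : Finite K := Module.finite_of_finite F
  let χ : Fin 3 → (K →* E) := fun i => ((algebraMap K E).comp (tw F i) : K →+* E)
  have hχ : Function.Injective χ := by
    intro i j hij
    have h1 : (FiniteField.frobeniusAlgHom F K) ^ (i : ℕ) =
        (FiniteField.frobeniusAlgHom F K) ^ (j : ℕ) := by
      ext x
      exact (algebraMap K E).injective (DFunLike.congr_fun hij x)
    have h2 := (FiniteField.bijective_frobeniusAlgHom_pow F K).1
      (a₁ := ⟨i, by omega⟩) (a₂ := ⟨j, by omega⟩) h1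
    exact Fin.ext (Fin.mk.inj_iff.1 h2)
  have hind := (linearIndependent_monoidHom K E).comp χ hχ
  -- a functional that vanishes on the span would be a linear relation between the embeddings
  by_contra hne
  obtain ⟨f, hf, hle⟩ := Submodule.exists_le_ker_of_lt_top _ (lt_top_iff_ne_top.2 hne)
  apply hf
  have h0 : ∀ i, f (Pi.single i 1) = 0 := by
    refine Fintype.linearIndependent_iff.1 hind (fun i => f (Pi.single i 1))
      (funext fun ω => ?_)
    have : f (fun i : Fin 3 => algebraMap K E (tw F i ω)) = 0 :=
      hle (Submodule.subset_span ⟨ω, rfl⟩)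
    rw [LinearMap.pi_apply_eq_sum_univ] at this
    simp only [Function.comp_apply, Finset.sum_apply, Pi.smul_apply, smul_eq_mul, Pi.zero_apply]
    rw [← this]
    refine Finset.sum_congr rfl fun i _ => ?_
    rw [smul_eq_mul, mul_comm]
    change algebraMap K E (tw F i ω) * f (Pi.single i 1) = _
    congr 2
    funext j
    simp [Pi.single_apply, eq_comm]
  refine LinearMap.pi_ext' fun i => LinearMap.ext_ring ?_
  exact h0 i

/-- The vectors of conjugates form an additive group. -/
def conjugates (F : Type*) [Field F] [Fintype F] [Algebra F K] (E : Type*) [Field E]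
    [Algebra K E] : AddSubgroup (Fin 3 → E) :=
  AddMonoidHom.range
    { toFun := fun (ω : K) (i : Fin 3) => algebraMap K E (tw F i ω)
      map_zero' := by ext; simp
      map_add' := fun x y => by ext; simp }

variable {E : Type*} [Field E] [Algebra K E]

variable (F) in
/-- The vector with components `c i • x` in the coordinates `comb`, as a linear map in `c`. -/
def scrollLin (D : Matrix (Fin 9) (Fin 3) K) (x : Fin 3 → E) : (Fin 3 → E) →ₗ[E] (Fin 9 → E) where
  toFun c := comb F D fun i => c i • x
  map_add' c d := by
    rw [← comb_add]; congr 1; ext i j; simp [add_mul]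
  map_smul' a c := by
    rw [RingHom.id_apply, ← comb_smul]; congr 1; ext i j; simp [mul_assoc]

theorem scrollLin_apply (D : Matrix (Fin 9) (Fin 3) K) (x : Fin 3 → E) (c : Fin 3 → E) :
    scrollLin F D x c = comb F D fun i => c i • x := rfl

/-- The quadric over `F` with matrix `S` contains the planes formed by the vectors
`traceVec D (ω • (s², st, t²))` with `ω` in `K` and `s`, `t` in `F`. -/
def VanishesOnPlanes (D : Matrix (Fin 9) (Fin 3) K) (S : Matrix (Fin 9) (Fin 9) F) : Prop :=
  ∀ (ω : K) (u : Fin 2 → F), traceVec D (ω • moment 2 (vecExt F K 2 u)) ⬝ᵥ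
    S *ᵥ traceVec D (ω • moment 2 (vecExt F K 2 u)) = 0

theorem vecExt_moment {k k' : Type*} [Field k] [Field k'] [Algebra k k'] (r : ℕ) (u : Fin 2 → k) :
    moment r (vecExt k k' 2 u) = vecExt k k' (r + 1) (moment r u) := by
  ext i
  simp [moment, vecExt]

/-- A quadric over `F` that contains all planes of the conic contains the cubic scroll of planes
over each extension: a quartic form in the parameter of the conic vanishes identically as soon as
it vanishes over `F`, and the vectors of conjugates span. -/
theorem VanishesOnPlanes.apply_scroll (hK : Module.finrank F K = 3) (hq : 4 ≤ Fintype.card F)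
    [Algebra F E] [IsScalarTower F K E]
    {D : Matrix (Fin 9) (Fin 3) K} {S : Matrix (Fin 9) (Fin 9) F} (hS : VanishesOnPlanes D S)
    (u : Fin 2 → E) (c : Fin 3 → E) :
    scrollLin F D (moment 2 u) c ⬝ᵥ
      S.map (algebraMap F E) *ᵥ scrollLin F D (moment 2 u) c = 0 := by
  let β := (Matrix.toLinearMap₂' E (S.map (algebraMap F E))).compl₁₂
    (scrollLin F D (moment 2 u)) (scrollLin F D (moment 2 u))
  have hβ : ∀ c, β c c = scrollLin F D (moment 2 u) c ⬝ᵥ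
      S.map (algebraMap F E) *ᵥ scrollLin F D (moment 2 u) c := fun c => by
    simp only [β, LinearMap.compl₁₂_apply, toLinearMap₂'_apply']
  rw [← hβ]
  have htop : c ∈ Submodule.span E (conjugates (K := K) F E : Set (Fin 3 → E)) := by
    have h : (conjugates (K := K) F E : Set (Fin 3 → E)) =
      Set.range fun (ω : K) (i : Fin 3) => algebraMap K E (tw F i ω) := rfl
    rw [h, span_conjugates hK E]; exact Submodule.mem_top
  refine apply_self_eq_zero_of_mem_span β _ ?_ htop
  rintro _ ⟨ω, rfl⟩
  rw [hβ]
  -- for fixed `ω`, the plane conic in question is defined over `F`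
  let A : Matrix (Fin 9) (Fin 3) F := Matrix.of fun k j => Algebra.trace F K (ω * D k j)
  have hA : ∀ x : Fin 3 → F, traceVec D (ω • vecExt F K 3 x) = A *ᵥ x := by
    intro x
    ext k
    simp only [traceVec, LinearMap.coe_mk, AddHom.coe_mk, A, mulVec, dotProduct, map_sum, of_apply,
      Pi.smul_apply, vecExt, smul_eq_mul]
    refine Finset.sum_congr rfl fun j _ => ?_
    rw [mul_comm (Algebra.trace F K _), ← smul_eq_mul (x j), ← map_smul, Algebra.smul_def]
    congr 1; ring
  have hAE : ∀ x : Fin 3 → E, scrollLin F D x (fun i => algebraMap K E (tw F i ω)) =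
      A.map (algebraMap F E) *ᵥ x := by
    intro x
    ext k
    simp only [scrollLin, LinearMap.coe_mk, AddHom.coe_mk, comb, Pi.add_apply, mulVec, dotProduct,
      ← Finset.sum_add_distrib, map_apply, twMat]
    refine Finset.sum_congr rfl fun j _ => ?_
    simp only [A, of_apply, IsScalarTower.algebraMap_apply F K E, algebraMap_trace hK, map_add,
      map_mul, Pi.smul_apply, smul_eq_mul, Fin.val_zero, Fin.val_one, Fin.val_two, tw_zero]
    ring
  set G := Aᵀ * S * A with hG
  have hval : ∀ s t : F, (moment 2 ![s, t]) ⬝ᵥ G *ᵥ (moment 2 ![s, t]) = 0 := by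
    intro s t
    have := hS ω ![s, t]
    rw [vecExt_moment, hA] at this
    rw [hG, ← mulVec_mulVec, ← mulVec_mulVec, dotProduct_mulVec (moment 2 ![s, t]),
      vecMul_transpose]
    exact this
  obtain ⟨h0, h1, h2, h3, h4⟩ := quartic_eq_zero hq (c₀ := G 0 0) (c₁ := G 0 1 + G 1 0)
    (c₂ := G 0 2 + G 2 0 + G 1 1) (c₃ := G 1 2 + G 2 1) (c₄ := G 2 2) (by
      intro s t
      have := hval s t
      simp [moment_two_eq, dotProduct, mulVec, Fin.sum_univ_three] at this
      linear_combination this)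
  have e : scrollLin F D (moment 2 u) (fun i => algebraMap K E (tw F i ω)) ⬝ᵥ
      S.map (algebraMap F E) *ᵥ
        scrollLin F D (moment 2 u) (fun i => algebraMap K E (tw F i ω)) =
      moment 2 u ⬝ᵥ G.map (algebraMap F E) *ᵥ moment 2 u := by
    rw [hAE, hG, Matrix.map_mul, Matrix.map_mul, ← mulVec_mulVec, ← mulVec_mulVec,
      dotProduct_mulVec (moment 2 u), transpose_map, vecMul_transpose]
  refine e.trans ?_
  have g1 := congrArg (algebraMap F E) h1
  have g2 := congrArg (algebraMap F E) h2
  have g3 := congrArg (algebraMap F E) h3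
  simp only [map_add, map_zero] at g1 g2 g3
  simp [moment_two_eq, dotProduct, mulVec, Fin.sum_univ_three, h0, h4]
  linear_combination (u 0 ^ 3 * u 1) * g1 + (u 0 ^ 2 * u 1 ^ 2) * g2 + (u 0 * u 1 ^ 3) * g3

/-- A quadric over `K` that contains all planes of the conic contains every point common to the
quadrics over `F` that do: expand its equation along a basis of `K` over `F`. -/
theorem quadric_over_cubic_eq_zero (hK : Module.finrank F K = 3) [Algebra F E]
    [IsScalarTower F K E] {D : Matrix (Fin 9) (Fin 3) K} {z : Fin 9 → E}
    (hz : ∀ S : Matrix (Fin 9) (Fin 9) F, VanishesOnPlanes D S →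
      z ⬝ᵥ S.map (algebraMap F E) *ᵥ z = 0)
    (S : Matrix (Fin 9) (Fin 9) K)
    (hS : ∀ (ω : K) (u : Fin 2 → F),
      vecExt F K 9 (traceVec D (ω • moment 2 (vecExt F K 2 u))) ⬝ᵥ
        S *ᵥ vecExt F K 9 (traceVec D (ω • moment 2 (vecExt F K 2 u))) = 0) :
    z ⬝ᵥ S.map (algebraMap K E) *ᵥ z = 0 := by
  have : FiniteDimensional F K := Module.finite_of_finrank_pos (by omega)
  let b := Module.finBasis F K
  let T : Fin (Module.finrank F K) → Matrix (Fin 9) (Fin 9) F := fun m =>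
    S.map fun x => b.repr x m
  have hsum : ∀ k l, S k l = ∑ m, algebraMap F K (T m k l) * b m := by
    intro k l
    conv_lhs => rw [← b.sum_repr (S k l)]
    simp [T, Algebra.smul_def]
  have hT : ∀ m, VanishesOnPlanes D (T m) := by
    intro m ω u
    set v : Fin 9 → F := traceVec D (ω • moment 2 (vecExt F K 2 u)) with hv
    have h1 := hS ω u
    rw [← hv] at h1
    have h2 : ∑ m, (v ⬝ᵥ T m *ᵥ v) • b m = 0 := by
      rw [← h1]
      simp only [dotProduct, mulVec, Finset.mul_sum, Finset.sum_smul, hsum, Finset.sum_mul]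
      rw [Finset.sum_comm]
      refine Finset.sum_congr rfl fun k _ => ?_
      rw [Finset.sum_comm]
      refine Finset.sum_congr rfl fun l _ => Finset.sum_congr rfl fun m _ => ?_
      simp only [Algebra.smul_def, map_mul, vecExt, LinearMap.coe_mk, AddHom.coe_mk]
      ring
    exact Fintype.linearIndependent_iff.1 b.linearIndependent _ h2 m
  have h3 : z ⬝ᵥ S.map (algebraMap K E) *ᵥ z =
      ∑ m, algebraMap K E (b m) * (z ⬝ᵥ (T m).map (algebraMap F E) *ᵥ z) := by
    simp only [dotProduct, mulVec, Finset.mul_sum, hsum, Matrix.map_apply, map_sum, Finset.sum_mul]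
    rw [Finset.sum_comm' (t' := Finset.univ) (s' := fun _ => Finset.univ) (by simp)]
    conv_lhs =>
      enter [2, k]
      rw [Finset.sum_comm]
    rw [Finset.sum_comm]
    conv_lhs =>
      enter [2, m]
      rw [Finset.sum_comm]
    refine Finset.sum_congr rfl fun m _ => Finset.sum_congr rfl fun k _ =>
      Finset.sum_congr rfl fun l _ => ?_
    simp only [map_mul, IsScalarTower.algebraMap_apply F K E]
    ring
  rw [h3]
  exact Finset.sum_eq_zero fun m _ => by rw [hz _ (hT m), mul_zero]

/-- A vector whose consecutive coordinates are in the ratio `u 0 : u 1`. -/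
theorem exists_smul_moment_two {u : Fin 2 → E} (hu : u ≠ 0) {x : Fin 3 → E}
    (h1 : u 0 * x 1 = u 1 * x 0) (h2 : u 0 * x 2 = u 1 * x 1) :
    ∃ c : E, x = c • moment 2 u := by
  rw [moment_two_eq]
  by_cases h : u 0 = 0
  · have hu1 : u 1 ≠ 0 := by
      intro h'
      apply hu
      ext i; fin_cases i <;> assumption
    have hx0 : x 0 = 0 := by simpa [h, hu1] using h1
    have hx1 : x 1 = 0 := by simpa [h, hu1] using h2
    refine ⟨x 2 / u 1 ^ 2, ?_⟩
    ext i
    fin_cases i <;> simp [h, hx0, hx1]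
    field_simp
  · refine ⟨x 0 / u 0 ^ 2, ?_⟩
    ext i
    fin_cases i <;> simp
    · field_simp
    · field_simp; linear_combination h1
    · field_simp; linear_combination u 0 * h2 + u 1 * h1

theorem dotProduct_vecMulVec_sub {k : Type*} [Field k] {n : ℕ} (p q p' q' v : Fin n → k) :
    v ⬝ᵥ (vecMulVec p q - vecMulVec p' q') *ᵥ v =
      (p ⬝ᵥ v) * (q ⬝ᵥ v) - (p' ⬝ᵥ v) * (q' ⬝ᵥ v) := by
  rw [sub_mulVec, vecMulVec_mulVec, vecMulVec_mulVec, dotProduct_sub, dotProduct_comm p,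
    dotProduct_comm p']
  simp only [dotProduct_smul, MulOpposite.smul_eq_mul_unop, MulOpposite.unop_op]

/-- The points common to all quadrics over `F` through the planes of the conic lie on the scroll,
since the scroll is cut out by the `2 × 2` minors of the matrix with rows
`(x₀, x₁, y₀, y₁, z₀, z₁)` and `(x₁, x₂, y₁, y₂, z₁, z₂)`. -/
theorem exists_scroll_of_quadrics (hK : Module.finrank F K = 3) [Algebra F E]
    [IsScalarTower F K E] {D : Matrix (Fin 9) (Fin 3) K} {P : Fin 3 → Matrix (Fin 3) (Fin 9) K}
    (hP : ∀ i j : Fin 3, P i * twMat F K j D = if i = j then 1 else 0)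
    (hP' : ∑ i : Fin 3, twMat F K i D * P i = 1) {z : Fin 9 → E} (hz0 : z ≠ 0)
    (hz : ∀ S : Matrix (Fin 9) (Fin 9) F, VanishesOnPlanes D S →
      z ⬝ᵥ S.map (algebraMap F E) *ᵥ z = 0) :
    ∃ (u : Fin 2 → E) (c : Fin 3 → E), u ≠ 0 ∧ z = scrollLin F D (moment 2 u) c := by
  set X : Fin 3 → Fin 3 → E := fun i => (P i).map (algebraMap K E) *ᵥ z with hX
  have hminor : ∀ (i i' : Fin 3) (j j' : Fin 2),
      X i j.castSucc * X i' j'.succ = X i j.succ * X i' j'.castSucc := by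
    intro i i' j j'
    have h := quadric_over_cubic_eq_zero hK hz
      (vecMulVec (P i j.castSucc) (P i' j'.succ) - vecMulVec (P i j.succ) (P i' j'.castSucc)) (by
        intro ω u
        rw [vecExt_traceVec hK]
        have hc : ∀ (i : Fin 3) (j : Fin 3), P i j ⬝ᵥ comb F D (fun (i : Fin 3) j =>
            algebraMap K K (tw F i ((ω • moment 2 (vecExt F K 2 u)) j))) =
            tw F i ((ω • moment 2 (vecExt F K 2 u)) j) := by
          intro i j
          have := congrFun (mulVec_comb (E := K) hP i (fun (i : Fin 3) j =>
            algebraMap K K (tw F i ((ω • moment 2 (vecExt F K 2 u)) j)))) j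
          rw [Algebra.algebraMap_self, RingHom.coe_id, Matrix.map_id] at this
          exact this
        refine (dotProduct_vecMulVec_sub _ _ _ _ _).trans ?_
        rw [hc, hc, hc, hc, vecExt_moment]
        simp only [Pi.smul_apply, smul_eq_mul, map_mul, vecExt, LinearMap.coe_mk, AddHom.coe_mk,
          tw_base, moment_two_eq]
        fin_cases j <;> fin_cases j' <;> simp <;> ring)
    have hm : (vecMulVec (P i j.castSucc) (P i' j'.succ) -
        vecMulVec (P i j.succ) (P i' j'.castSucc)).map (algebraMap K E) =
        vecMulVec (((P i).map (algebraMap K E)) j.castSucc)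
          (((P i').map (algebraMap K E)) j'.succ) -
        vecMulVec (((P i).map (algebraMap K E)) j.succ)
          (((P i').map (algebraMap K E)) j'.castSucc) := by
      ext; simp [vecMulVec_apply]
    rw [hm] at h
    exact sub_eq_zero.1 ((dotProduct_vecMulVec_sub _ _ _ _ _).symm.trans h)
  -- a nonzero column of the matrix gives the parameter `u`
  have hne : ∃ (i : Fin 3) (j : Fin 2), ¬ (X i j.castSucc = 0 ∧ X i j.succ = 0) := by
    by_contra! hcon
    apply hz0
    rw [← comb_mulVec (E := E) hP' z]
    have : X = 0 := by
      ext i j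
      fin_cases j
      · exact (hcon i 0).1
      · exact (hcon i 0).2
      · exact (hcon i 1).2
    rw [← hX, this]
    exact map_zero (combLin F E D)
  obtain ⟨i, j, hij⟩ := hne
  have hu : ![X i j.castSucc, X i j.succ] ≠ 0 := fun h =>
    hij ⟨congrFun h 0, congrFun h 1⟩
  choose c hc using fun i' => exists_smul_moment_two hu (x := X i') (hminor i i' j 0)
    (hminor i i' j 1)
  refine ⟨_, c, hu, ?_⟩
  conv_lhs => rw [← comb_mulVec (E := E) hP' z]
  exact congrArg (comb F D) (funext hc)

end Scroll

/-! ### Coordinates adapted to a conic and to the line at infinity -/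

section Adapted

open Matrix

theorem traceVec_mul {F K : Type*} [Field F] [Field K] [Algebra F K] (M : Matrix (Fin 9) (Fin 3) K)
    (G : Matrix (Fin 3) (Fin 3) K) (x : Fin 3 → K) :
    traceVec (F := F) (M * G) x = traceVec M (G *ᵥ x) := by
  ext k
  simp [traceVec, mulVec_mulVec]

theorem vecExt_mulVec {k E : Type*} [Field k] [Field E] [Algebra k E] {m n : ℕ}
    (A : Matrix (Fin m) (Fin n) k) (x : Fin n → k) :
    vecExt k E m (A *ᵥ x) = A.map (algebraMap k E) *ᵥ vecExt k E n x := by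
  ext i
  simp [vecExt, mulVec, dotProduct, map_sum]

variable {F K : Type*} [Field F] [Fintype F] [Field K] [Algebra F K]

/-- Coordinates adapted to the frame `R` and the conic `C`: in `PG(2, K)` with coordinates given by
`G`, the conic is `{(s², st, t²)}` and the line at infinity has the equation `a ⬝ᵥ x = 0`, scaled
so that the 6-space consists of the vectors `traceVec D x` with `a ⬝ᵥ x` in `F`. The matrix
`D` is that of the isomorphism onto the transversal plane, and the matrices `P i` compute
coordinates with respect to `D` and its conjugates. -/
structure Coords (R : Frame F K) (C : FqConic F K) (G : Matrix (Fin 3) (Fin 3) K)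
    (D : Matrix (Fin 9) (Fin 3) K) (P : Fin 3 → Matrix (Fin 3) (Fin 9) K) (a : Fin 3 → K) :
    Prop where
  D_eq : D = R.M * G
  G_unit : IsUnit G
  G_eq : ∃ (A : Matrix (Fin 3) (Fin 3) F) (c : F), G = C.B * A.map (algebraMap F K) ∧
    IsUnit A ∧ c ≠ 0 ∧
    ∃ S, C.Q = quadPoly S ∧ Aᵀ * S * A + (Aᵀ * S * A)ᵀ = !![0, 0, c; 0, -2 * c, 0; c, 0, 0] ∧
      (Aᵀ * S * A) 0 0 = 0 ∧ (Aᵀ * S * A) 1 1 = -c ∧ (Aᵀ * S * A) 2 2 = 0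
  P_mul : ∀ i j : Fin 3, P i * twMat F K j D = if i = j then 1 else 0
  sum_mul_P : ∑ i : Fin 3, twMat F K i D * P i = 1
  a_ne : a ≠ 0
  linf_iff : ∀ x, G *ᵥ x ∈ R.linf ↔ a ⬝ᵥ x = 0
  S6_iff : ∀ x, traceVec D x ∈ R.S6 ↔ ∃ κ : F, a ⬝ᵥ x = algebraMap F K κ

theorem traceVec_bijective (hK : Module.finrank F K = 3) {D : Matrix (Fin 9) (Fin 3) K}
    {P : Fin 3 → Matrix (Fin 3) (Fin 9) K}
    (hP : ∀ i j : Fin 3, P i * twMat F K j D = if i = j then 1 else 0)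
    (hP' : ∑ i : Fin 3, twMat F K i D * P i = 1) :
    Function.Bijective (traceVec (F := F) D) := by
  constructor
  · intro x y h
    have h1 := congrArg (vecExt F K 9) h
    rw [vecExt_traceVec hK, vecExt_traceVec hK] at h1
    have h2 := comb_injective hP h1
    ext j
    simpa using congrFun (congrFun h2 0) j
  · intro v
    exact ⟨_, (eq_traceVec_of_vecExt_eq_comb hK (combLin_injective hP)
      (comb_mulVec hP' (vecExt F K 9 v)).symm).symm⟩

/-- The equation of the line at infinity can be scaled so that the 6-space consists of the vectors
on which it takes values in `F`. -/
theorem exists_normalized_equation (hK : Module.finrank F K = 3) (R : Frame F K)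
    (hb : Function.Bijective (traceVec (F := F) R.M))
    (hlinf : ∀ y ∈ R.linf, traceVec R.M y ∈ R.S6) :
    ∃ a : Fin 3 → K, a ≠ 0 ∧ (∀ y, y ∈ R.linf ↔ a ⬝ᵥ y = 0) ∧
      ∀ y, traceVec R.M y ∈ R.S6 ↔ ∃ κ : F, a ⬝ᵥ y = algebraMap F K κ := by
  have : FiniteDimensional F K := Module.finite_of_finrank_pos (by omega)
  obtain ⟨f, hf⟩ : ∃ f : (Fin 3 → K) →ₗ[K] K, LinearMap.ker f = R.linf := by
    have h1 : Module.finrank K ((Fin 3 → K) ⧸ R.linf) = Module.finrank K K := by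
      have := R.linf.finrank_quotient_add_finrank
      rw [R.finrank_linf, Module.finrank_fin_fun] at this
      rw [Module.finrank_self]
      omega
    let e := LinearEquiv.ofFinrankEq _ _ h1
    refine ⟨e.toLinearMap ∘ₗ R.linf.mkQ, ?_⟩
    rw [LinearEquiv.ker_comp, Submodule.ker_mkQ]
  let φ := LinearEquiv.ofBijective (traceVec (F := F) R.M) hb
  let U : Submodule F (Fin 3 → K) := R.S6.comap φ.toLinearMap
  -- on the 6-space `U`, the form `f` has rank one over `F`, since its kernel has dimension six
  have hUf : Module.finrank F U = 7 := by
    have : U = R.S6.map φ.symm.toLinearMap := Submodule.comap_equiv_eq_map_symm φ R.S6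
    rw [this, ← R.finrank_S6]
    exact LinearEquiv.finrank_map_eq φ.symm R.S6
  have hlU : R.linf.restrictScalars F ≤ U := fun y hy => hlinf y hy
  let g : U →ₗ[F] K := (f.restrictScalars F).domRestrict U
  have hker : Module.finrank F (LinearMap.ker g) = 6 := by
    have h1 : LinearMap.ker g = (R.linf.restrictScalars F).comap U.subtype := by
      ext x
      rw [LinearMap.mem_ker, Submodule.mem_comap, Submodule.restrictScalars_mem, ← hf]
      rfl
    rw [h1, (Submodule.comapSubtypeEquivOfLe hlU).finrank_eq]
    have := Module.finrank_mul_finrank F K R.linf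
    rw [hK, R.finrank_linf] at this
    exact this.symm
  have hrange : Module.finrank F (LinearMap.range g) = 1 := by
    have := g.finrank_range_add_finrank_ker
    omega
  obtain ⟨⟨κ, hκ'⟩, hκ0, hκs⟩ := finrank_eq_one_iff'.1 hrange
  have hκ : κ ≠ 0 := fun h => hκ0 (Subtype.ext h)
  obtain ⟨⟨y₁, hy₁U⟩, hy₁⟩ := hκ'
  change f y₁ = κ at hy₁
  let a : Fin 3 → K := fun j => κ⁻¹ * f (Pi.single j 1)
  have ha : ∀ y, a ⬝ᵥ y = κ⁻¹ * f y := by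
    intro y
    rw [LinearMap.pi_apply_eq_sum_univ f y, dotProduct, Finset.mul_sum]
    refine Finset.sum_congr rfl fun j _ => ?_
    have : (fun i => if j = i then (1 : K) else 0) = Pi.single j 1 := by
      funext i; simp [Pi.single_apply, eq_comm]
    simp only [a, this, smul_eq_mul]
    ring
  have hal : ∀ y, y ∈ R.linf ↔ a ⬝ᵥ y = 0 := by
    intro y
    rw [ha, ← hf, LinearMap.mem_ker]
    simp [hκ]
  refine ⟨a, ?_, hal, fun y => ⟨fun hy => ?_, ?_⟩⟩
  · intro h0
    have := ha y₁
    rw [h0, hy₁, zero_dotProduct, inv_mul_cancel₀ hκ] at this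
    exact zero_ne_one this
  · obtain ⟨c, hc⟩ := hκs ⟨f y, ⟨⟨y, hy⟩, rfl⟩⟩
    have hc : c • κ = f y := congrArg Subtype.val hc
    refine ⟨c, ?_⟩
    rw [ha, ← hc, Algebra.smul_def]
    field_simp
  · rintro ⟨c, hc⟩
    have h1 : y - c • y₁ ∈ R.linf := by
      rw [hal, dotProduct_sub, dotProduct_smul, hc, ha, hy₁, inv_mul_cancel₀ hκ,
        Algebra.smul_def, mul_one, sub_self]
    have h2 := U.add_mem (hlU h1) (U.smul_mem c hy₁U)
    rw [sub_add_cancel] at h2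
    exact h2

/-- Adapted coordinates exist, and any given vector of the conic can be taken as the first base
vector. -/
theorem exists_coords (hK : Module.finrank F K = 3) (R : Frame F K) (C : FqConic F K)
    (p : Fin 3 → F) (hp : p ≠ 0) (hp0 : MvPolynomial.eval p C.Q = 0) :
    ∃ (G : Matrix (Fin 3) (Fin 3) K) (D : Matrix (Fin 9) (Fin 3) K)
      (P : Fin 3 → Matrix (Fin 3) (Fin 9) K) (a : Fin 3 → K), Coords R C G D P a ∧
      G *ᵥ ![1, 0, 0] = C.B *ᵥ (vecExt F K 3 p) := by
  obtain ⟨S, hS⟩ := exists_eq_quadPoly C.homog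
  obtain ⟨A, c, hc, hA, hAp, h1, h2, h3, h4⟩ := exists_conic_normal_form S (by
    intro v hv hv0 hpol
    obtain ⟨i, hi⟩ := C.nondeg v hv (by rw [hS, eval_quadPoly]; exact hv0)
    rw [hS, eval_pderiv_quadPoly, hpol] at hi
    exact hi rfl) p hp (by rw [← eval_quadPoly, ← hS]; exact hp0)
  have hAu : IsUnit A := mulVec_injective_iff_isUnit.1 hA
  have hBu : IsUnit C.B := mulVec_injective_iff_isUnit.1 C.B_inj
  set G := C.B * A.map (algebraMap F K) with hG
  have hGu : IsUnit G := hBu.mul (hAu.map (algebraMap F K).mapMatrix)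
  obtain ⟨PM, hPM, hPM'⟩ := exists_coordinates R.span_eq_top
  have hb := traceVec_bijective hK hPM hPM'
  have hinjM := combLin_injective (E := K) hPM
  have hlinf : ∀ y ∈ R.linf, traceVec R.M y ∈ R.S6 := fun y hy =>
    R.le_S6 ((mem_comap_conjSpan_iff hK hinjM _ _).2 ⟨y, hy, rfl⟩)
  obtain ⟨a, ha0, hal, haS⟩ := exists_normalized_equation hK R hb hlinf
  have hrange : LinearMap.range (R.M * G).mulVecLin = LinearMap.range R.M.mulVecLin := by
    rw [mulVecLin_mul, LinearMap.range_comp_of_range_eq_top]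
    exact LinearMap.range_eq_top.2 (mulVec_surjective_iff_isUnit.2 hGu)
  obtain ⟨P, hP, hP'⟩ := exists_coordinates (D := R.M * G) (F := F)
    (by rw [hrange]; exact R.span_eq_top)
  refine ⟨G, R.M * G, P, a ᵥ* G, ⟨rfl, hGu, ⟨A, c, rfl, hAu, hc, S, hS, h1, h2, h3, h4⟩, hP, hP',
    ?_, ?_, ?_⟩, ?_⟩
  · intro h0
    apply ha0
    have : a ᵥ* G = 0 ᵥ* G := by rw [h0, zero_vecMul]
    exact vecMul_injective_of_isUnit hGu this
  · intro x
    rw [hal, dotProduct_mulVec]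
  · intro x
    rw [traceVec_mul, haS, dotProduct_mulVec]
  · rw [hG, ← mulVec_mulVec]
    congr 1
    rw [← hAp, vecExt_mulVec]
    congr 1
    ext i
    fin_cases i <;> simp [vecExt]

/-- The `i`-th conjugate of the linear form with coefficients `a`, at the vector `x` over `E`. -/
def conjForm (F : Type*) [Field F] [Fintype F] [Algebra F K] {E : Type*} [Field E] [Algebra K E]
    {n : ℕ} (a : Fin n → K) (i : ℕ) (x : Fin n → E) : E :=
  (fun j => algebraMap K E (tw F i (a j))) ⬝ᵥ x

theorem conjForm_smul {E : Type*} [Field E] [Algebra K E] {n : ℕ} (a : Fin n → K) (i : ℕ)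
    (c : E) (x : Fin n → E) : conjForm F a i (c • x) = c * conjForm F a i x := by
  rw [conjForm, dotProduct_smul, smul_eq_mul]; rfl

theorem conjForm_conj {E : Type*} [Field E] [Algebra K E] {n : ℕ} (a : Fin n → K) (i : ℕ)
    (x : Fin n → K) : conjForm F (E := E) a i (fun j => algebraMap K E (tw F i (x j))) =
      algebraMap K E (tw F i (a ⬝ᵥ x)) := by
  simp [conjForm, dotProduct, map_sum]

namespace Coords

variable {R : Frame F K} {C : FqConic F K} {G : Matrix (Fin 3) (Fin 3) K}
  {D : Matrix (Fin 9) (Fin 3) K} {P : Fin 3 → Matrix (Fin 3) (Fin 9) K} {a : Fin 3 → K}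

section Ext

variable {E : Type*} [Field E] [Algebra K E]

/-- The parametrization of the conic over an extension. -/
theorem mem_ext_iff (h : Coords R C G D P a) [Algebra F E] [IsScalarTower F K E] {X : PG 2 E} :
    X ∈ C.ext E ↔
      ∃ u : Fin 2 → E, u ≠ 0 ∧ IsVec X (G.map (algebraMap K E) *ᵥ moment 2 u) := by
  obtain ⟨A, c, hG, hA, hc, S, hQ, h1, h2, h3, h4⟩ := h.G_eq
  have hGE : ∀ x : Fin 3 → E, G.map (algebraMap K E) *ᵥ x =
      C.B.map (algebraMap K E) *ᵥ (A.map (algebraMap F E) *ᵥ x) := by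
    intro x
    rw [hG, Matrix.map_mul, mulVec_mulVec, Matrix.map_map]
    congr 3
    ext i
    exact (IsScalarTower.algebraMap_apply F K E _).symm
  have hAE : IsUnit (A.map (algebraMap F E)) := hA.map (algebraMap F E).mapMatrix
  have hc' : algebraMap F E c ≠ 0 := by simpa using hc
  constructor
  · rintro ⟨x, hx, rfl⟩
    obtain ⟨w, hw⟩ := mulVec_surjective_iff_isUnit.2 hAE x.rep
    rw [hQ, ← hw, aeval_normal_form h1 h2 h3 h4, mul_eq_zero] at hx
    have hw0 : w ≠ 0 := by
      rintro rfl
      rw [mulVec_zero] at hw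
      exact x.rep_nonzero hw.symm
    obtain ⟨u, d, hu, hd, rfl⟩ := exists_moment_two hw0 (hx.resolve_left hc')
    refine ⟨u, hu, ?_⟩
    have := (isVec_rep x).matMap C.B C.B_inj
    rw [← hw, ← hGE, mulVec_smul] at this
    exact this.of_smul
  · rintro ⟨u, hu, hX⟩
    have hne : A.map (algebraMap F E) *ᵥ moment 2 u ≠ 0 := by
      intro h0
      apply hX.1
      rw [hGE, h0, mulVec_zero]
    refine ⟨Projectivization.mk E _ hne, ?_, ?_⟩
    · obtain ⟨d, hd, he⟩ := (isVec_mk hne).exists_smul (isVec_rep (Projectivization.mk E _ hne))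
      rw [he, ← mulVec_smul, hQ, aeval_normal_form h1 h2 h3 h4, moment_two_eq]
      simp
      right
      ring
    · rw [hGE] at hX
      exact hX.eq ((isVec_mk hne).matMap C.B C.B_inj)

theorem mulVec_injective (h : Coords R C G D P a) {x y : Fin 3 → E}
    (hxy : G.map (algebraMap K E) *ᵥ x = G.map (algebraMap K E) *ᵥ y) : x = y :=
  mulVec_injective_iff_isUnit.2 (h.G_unit.map (algebraMap K E).mapMatrix) hxy

theorem isVec_toΓ (h : Coords R C G D P a) {X : PG 2 E} {x : Fin 3 → E}
    (hX : IsVec X (G.map (algebraMap K E) *ᵥ x)) : IsVec (R.toΓ X) (twMat F E 0 D *ᵥ x) := by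
  have := hX.matMap R.M R.M_inj
  rw [mulVec_mulVec, ← Matrix.map_mul, ← h.D_eq] at this
  rwa [twMat_zero]

theorem mem_lineInf_iff (h : Coords R C G D P a) {X : PG 2 E} {x : Fin 3 → E}
    (hX : IsVec X (G.map (algebraMap K E) *ᵥ x)) :
    X ∈ R.lineInf E ↔ conjForm F a 0 x = 0 := by
  change X ∈ pointsOf _ ↔ _
  rw [hX.mem_pointsOf]
  obtain ⟨G', hG'⟩ := isUnit_iff_exists_inv.1 h.G_unit
  have hG'' : G' * G = 1 := mul_eq_one_comm.1 hG'
  -- the equation in the original coordinates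
  let b : Fin 3 → K := a ᵥ* G'
  have hb : ∀ y, y ∈ R.linf ↔ b ⬝ᵥ y = 0 := by
    intro y
    rw [← dotProduct_mulVec, ← h.linf_iff, mulVec_mulVec, hG', one_mulVec]
  have hb0 : b ≠ 0 := by
    intro h0
    apply h.a_ne
    have : a ᵥ* G' ᵥ* G = 0 := by rw [show a ᵥ* G' = 0 from h0, zero_vecMul]
    rwa [vecMul_vecMul, hG'', vecMul_one] at this
  let f : (Fin 3 → E) →ₗ[E] E := dotProductBilin E E (fun j => algebraMap K E (b j))
  have hf : ∀ y : Fin 3 → K, f (vecExt K E 3 y) = algebraMap K E (b ⬝ᵥ y) := by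
    intro y
    simp [f, dotProduct, vecExt, map_sum]
  obtain ⟨j, hj⟩ := Function.ne_iff.1 hb0
  have hbj : b ⬝ᵥ Pi.single j 1 = b j := by simp
  have key := mem_spaceExt_iff_of_hyperplane (W := R.linf) (U := ⊤) f
    (fun v hv => by rw [hf, (hb v).1 hv, map_zero]) (e := Pi.single j 1)
    (by rw [hf, hbj]; simpa using hj)
    (fun u _ => ⟨b ⬝ᵥ u / b j, by
      rw [hb, dotProduct_sub, dotProduct_smul, hbj, smul_eq_mul, div_mul_cancel₀ _ hj, sub_self]⟩)
    (G.map (algebraMap K E) *ᵥ x) (by rw [spaceExt_top]; exact Submodule.mem_top)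
  rw [← key]
  have : f (G.map (algebraMap K E) *ᵥ x) = conjForm F a 0 x := by
    change (fun j => algebraMap K E (b j)) ⬝ᵥ _ = _
    rw [dotProduct_mulVec]
    have e : (fun j => algebraMap K E (b j)) ᵥ* G.map (algebraMap K E) =
        fun j => algebraMap K E (a j) := by
      have h1 : b ᵥ* G = a := by
        change a ᵥ* G' ᵥ* G = a
        rw [vecMul_vecMul, hG'', vecMul_one]
      funext j
      conv_rhs => rw [← h1]
      simp [vecMul, dotProduct, map_sum]
    rw [e, conjForm]
    simp
  rw [this]

end Ext

/-- The parametrization of the `F`-conic. -/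
theorem mem_points_iff (h : Coords R C G D P a) {X : PG 2 K} :
    X ∈ C.points ↔
      ∃ u : Fin 2 → F, u ≠ 0 ∧ IsVec X (G *ᵥ moment 2 (vecExt F K 2 u)) := by
  obtain ⟨A, c, hG, hA, hc, S, hQ, h1, h2, h3, h4⟩ := h.G_eq
  have hBE : C.B.map (algebraMap K K) = C.B := by
    rw [Algebra.algebraMap_self, RingHom.coe_id, Matrix.map_id]
  have hGE : ∀ x : Fin 3 → F, G *ᵥ vecExt F K 3 x = C.B *ᵥ (vecExt F K 3 (A *ᵥ x)) := by
    intro x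
    rw [hG, ← mulVec_mulVec, vecExt_mulVec]
  have hev : ∀ x : Fin 3 → F, MvPolynomial.eval (A *ᵥ x) C.Q = c * (x 0 * x 2 - x 1 ^ 2) := by
    intro x
    have := aeval_normal_form (E := F) h1 h2 h3 h4 x
    rw [Algebra.algebraMap_self, RingHom.coe_id, Matrix.map_id, MvPolynomial.aeval_eq_eval] at this
    rw [hQ]
    exact this
  constructor
  · rintro ⟨x, hx, rfl⟩
    obtain ⟨w, hw⟩ := mulVec_surjective_iff_isUnit.2 hA x.rep
    rw [← hw, hev, mul_eq_zero] at hx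
    have hw0 : w ≠ 0 := by
      rintro rfl
      rw [mulVec_zero] at hw
      exact x.rep_nonzero hw.symm
    obtain ⟨u, d, hu, hd, rfl⟩ := exists_moment_two hw0 (hx.resolve_left hc)
    refine ⟨u, hu, ?_⟩
    have := ((isVec_rep x).ptExt K).matMap C.B C.B_inj
    rw [← hw, hBE, ← hGE, LinearMap.map_smulₛₗ, mulVec_smul, ← vecExt_moment] at this
    exact this.of_smul
  · rintro ⟨u, hu, hX⟩
    rw [vecExt_moment, hGE] at hX
    have hne : A *ᵥ moment 2 u ≠ 0 := by
      intro h0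
      apply hX.1
      rw [h0, map_zero, mulVec_zero]
    refine ⟨Projectivization.mk F _ hne, ?_, ?_⟩
    · obtain ⟨d, hd, he⟩ := (isVec_mk hne).exists_smul (isVec_rep (Projectivization.mk F _ hne))
      rw [he, ← mulVec_smul, hev, moment_two_eq]
      simp
      right
      ring
    · have := ((isVec_mk hne).ptExt K).matMap C.B C.B_inj
      rw [hBE] at this
      exact hX.eq this

theorem mem_subplane (h : Coords R C G D P a) {X : PG 2 K} {x : Fin 3 → F}
    (hX : IsVec X (G *ᵥ vecExt F K 3 x)) : X ∈ C.subplane := by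
  obtain ⟨A, c, hG, -⟩ := h.G_eq
  have hBE : C.B.map (algebraMap K K) = C.B := by
    rw [Algebra.algebraMap_self, RingHom.coe_id, Matrix.map_id]
  have hGE : G *ᵥ vecExt F K 3 x = C.B *ᵥ (vecExt F K 3 (A *ᵥ x)) := by
    rw [hG, ← mulVec_mulVec, vecExt_mulVec]
  rw [hGE] at hX
  have hne : A *ᵥ x ≠ 0 := by
    intro h0
    apply hX.1
    rw [h0, map_zero, mulVec_zero]
  refine ⟨Projectivization.mk F _ hne, ?_⟩
  have := ((isVec_mk hne).ptExt K).matMap C.B C.B_inj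
  rw [hBE] at this
  exact hX.eq this

theorem exists_isVec_of_mem_subplane (h : Coords R C G D P a) {X : PG 2 K}
    (hX : X ∈ C.subplane) : ∃ x : Fin 3 → F, x ≠ 0 ∧ IsVec X (G *ᵥ vecExt F K 3 x) := by
  obtain ⟨A, c, hG, hA, -⟩ := h.G_eq
  obtain ⟨y, rfl⟩ := hX
  obtain ⟨w, hw⟩ := mulVec_surjective_iff_isUnit.2 hA y.rep
  refine ⟨w, ?_, ?_⟩
  · rintro rfl
    rw [mulVec_zero] at hw
    exact y.rep_nonzero hw.symm
  · have := ((isVec_rep y).ptExt K).matMap C.B C.B_inj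
    rw [Algebra.algebraMap_self, RingHom.coe_id, Matrix.map_id] at this
    rwa [hG, ← mulVec_mulVec, ← vecExt_mulVec, hw]

theorem bijective_traceVec (h : Coords R C G D P a) (hK : Module.finrank F K = 3) :
    Function.Bijective (traceVec (F := F) D) :=
  traceVec_bijective hK h.P_mul h.sum_mul_P

/-- The Bose plane of a point is the image of a line `K x` under the map `traceVec`. -/
theorem mem_bose_iff (h : Coords R C G D P a) (hK : Module.finrank F K = 3) {X : PG 2 K}
    {x : Fin 3 → K} (hX : IsVec X (G *ᵥ x)) {v : Fin 9 → F} :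
    v ∈ R.bose X ↔ ∃ ω : K, v = traceVec D (ω • x) := by
  have h1 : (R.toΓ X).submodule = (Submodule.span K {x}).map D.mulVecLin := by
    have h2 := h.isVec_toΓ (E := K) (X := X) (x := x) (by
      rwa [Algebra.algebraMap_self, RingHom.coe_id, Matrix.map_id])
    rw [twMat_zero, Algebra.algebraMap_self, RingHom.coe_id, Matrix.map_id] at h2
    rw [h2.submodule_eq, Submodule.map_span, Set.image_singleton]
    rfl
  rw [Frame.bose, h1, mem_comap_conjSpan_iff hK (combLin_injective h.P_mul)]
  constructor
  · rintro ⟨y, hy, rfl⟩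
    obtain ⟨ω, rfl⟩ := Submodule.mem_span_singleton.1 hy
    exact ⟨ω, rfl⟩
  · rintro ⟨ω, rfl⟩
    exact ⟨_, Submodule.smul_mem _ _ (Submodule.mem_span_singleton_self x), rfl⟩

theorem Sinf_iff (h : Coords R C G D P a) (hK : Module.finrank F K = 3) (x : Fin 3 → K) :
    traceVec D x ∈ R.Sinf ↔ a ⬝ᵥ x = 0 := by
  have h1 : R.linf.map R.M.mulVecLin = (R.linf.comap G.mulVecLin).map D.mulVecLin := by
    rw [h.D_eq, mulVecLin_mul, Submodule.map_comp, Submodule.map_comap_eq_of_surjective]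
    exact mulVec_surjective_iff_isUnit.2 h.G_unit
  rw [Frame.Sinf, h1, mem_comap_conjSpan_iff hK (combLin_injective h.P_mul), ← h.linf_iff]
  constructor
  · rintro ⟨y, hy, he⟩
    rw [(h.bijective_traceVec hK).1 he]
    exact hy
  · intro hx
    exact ⟨x, hx, rfl⟩

/-- The equation `a = 0` of the hyperplane at infinity of the 6-space, over `E`. -/
def hyperplaneForm (P : Fin 3 → Matrix (Fin 3) (Fin 9) K) (a : Fin 3 → K) (E : Type*) [Field E]
    [Algebra K E] (F : Type*) [Field F] [Fintype F] [Algebra F K] (i : Fin 3) :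
    (Fin 9 → E) →ₗ[E] E :=
  dotProductBilin E E (fun j => algebraMap K E (tw F i (a j))) ∘ₗ
    ((P i).map (algebraMap K E)).mulVecLin

section Ext

variable {E : Type*} [Field E] [Algebra K E]

theorem hyperplaneForm_comb (h : Coords R C G D P a) (i : Fin 3) (x : Fin 3 → Fin 3 → E) :
    hyperplaneForm P a E F i (comb F D x) = conjForm F a i (x i) := by
  change (fun j => algebraMap K E (tw F i (a j))) ⬝ᵥ _ = _
  rw [mulVecLin_apply, mulVec_comb h.P_mul]
  rfl

variable [Algebra F E] [IsScalarTower F K E]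

theorem hyperplaneForm_vecExt (h : Coords R C G D P a) (hK : Module.finrank F K = 3) (i : Fin 3)
    (x : Fin 3 → K) : hyperplaneForm P a E F i (vecExt F E 9 (traceVec D x)) =
      algebraMap K E (tw F i (a ⬝ᵥ x)) := by
  rw [vecExt_traceVec hK, h.hyperplaneForm_comb, conjForm_conj]

theorem hyperplaneForm_eq_zero_iff (h : Coords R C G D P a) (hK : Module.finrank F K = 3) :
    ∀ v ∈ spaceExt E R.S6, hyperplaneForm P a E F 0 v = 0 ↔ v ∈ spaceExt E R.Sinf := by
  obtain ⟨j, hj⟩ := Function.ne_iff.1 h.a_ne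
  have hj : a j ≠ 0 := hj
  -- a vector with `a ⬝ᵥ e = 1`
  have he : a ⬝ᵥ (Pi.single j (a j)⁻¹ : Fin 3 → K) = 1 := by
    rw [dotProduct_single, mul_inv_cancel₀ hj]
  refine mem_spaceExt_iff_of_hyperplane _ ?_ (e := traceVec D (Pi.single j (a j)⁻¹)) ?_ ?_
  · intro v hv
    obtain ⟨x, rfl⟩ := (h.bijective_traceVec hK).2 v
    rw [h.hyperplaneForm_vecExt hK, (h.Sinf_iff hK x).1 hv, map_zero, map_zero]
  · rw [h.hyperplaneForm_vecExt hK, he, map_one, map_one]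
    exact one_ne_zero
  · intro u hu
    obtain ⟨x, rfl⟩ := (h.bijective_traceVec hK).2 u
    obtain ⟨κ, hκ⟩ := (h.S6_iff x).1 hu
    refine ⟨κ, ?_⟩
    rw [← map_smul, ← map_sub, h.Sinf_iff hK, dotProduct_sub, hκ, dotProduct_smul, he,
      Algebra.smul_def, mul_one, sub_self]

/-- On the extension of the 6-space, the three conjugates of the form `a` agree. -/
theorem conjForm_eq_of_mem_spaceExt (h : Coords R C G D P a) (hK : Module.finrank F K = 3)
    {x : Fin 3 → Fin 3 → E} (hx : comb F D x ∈ spaceExt E R.S6) (i : Fin 3) :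
    conjForm F a i (x i) = conjForm F a 0 (x 0) := by
  have hle : spaceExt E R.S6 ≤
      LinearMap.ker (hyperplaneForm P a E F i - hyperplaneForm P a E F 0) := by
    refine spaceExt_le fun v hv => ?_
    obtain ⟨y, rfl⟩ := (h.bijective_traceVec hK).2 v
    obtain ⟨κ, hκ⟩ := (h.S6_iff y).1 hv
    rw [LinearMap.mem_ker, LinearMap.sub_apply, h.hyperplaneForm_vecExt hK,
      h.hyperplaneForm_vecExt hK, hκ, tw_base, tw_base, sub_self]
  have := hle hx
  rw [LinearMap.mem_ker, LinearMap.sub_apply, h.hyperplaneForm_comb, h.hyperplaneForm_comb] at this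
  exact sub_eq_zero.1 this

/-- The points of the Bose variety of the conic, over any extension, are the points of the scroll
of planes spanned by `(s², st, t²)` and its conjugates. -/
theorem mem_boseVariety_iff (h : Coords R C G D P a) (hK : Module.finrank F K = 3)
    (hq : 4 ≤ Fintype.card F) {Z : PG 8 E} {z : Fin 9 → E} (hz : IsVec Z z) :
    Z ∈ R.boseVariety C.points E ↔
      ∃ (u : Fin 2 → E) (c : Fin 3 → E), u ≠ 0 ∧ z = scrollLin F D (moment 2 u) c := by
  obtain ⟨d, hd, hdz⟩ := hz.exists_smul (isVec_rep Z)
  -- a quadric contains the Bose planes of the points of the conic iff it vanishes on the vectors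
  have hvan : ∀ S : Matrix (Fin 9) (Fin 9) F,
      (∀ X ∈ C.points, ∀ Y ∈ pointsOf (R.bose X), MvPolynomial.eval Y.rep (quadPoly S) = 0) ↔
        VanishesOnPlanes D S := by
    intro S
    constructor
    · intro hS ω u
      set v := traceVec (F := F) D (ω • moment 2 (vecExt F K 2 u)) with hv
      by_cases hu : u = 0
      · have : v = 0 := by
          rw [hv, hu, map_zero]
          have : moment 2 (0 : Fin 2 → K) = 0 := by rw [moment_two_eq]; ext i; fin_cases i <;> simp
          rw [this, smul_zero, map_zero]
        rw [this]; simp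
      by_cases hv0 : v = 0
      · rw [hv0]; simp
      have hu' : vecExt F K 2 u ≠ 0 := fun h0 => hu (vecExt_injective F K 2 (by rw [h0, map_zero]))
      have hne : G *ᵥ moment 2 (vecExt F K 2 u) ≠ 0 := by
        intro h0
        apply moment_ne_zero 2 _ hu'
        exact mulVec_injective_iff_isUnit.2 h.G_unit (h0.trans (mulVec_zero G).symm)
      have hY : IsVec (Projectivization.mk F v hv0) v := isVec_mk hv0
      have h1 := hS _ (h.mem_points_iff.2 ⟨u, hu, isVec_mk hne⟩) _
        ((hY.mem_pointsOf _).2 ((h.mem_bose_iff hK (isVec_mk hne)).2 ⟨ω, hv⟩))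
      obtain ⟨b, hb, hbv⟩ := hY.exists_smul (isVec_rep _)
      rw [hbv, eval_quadPoly, mulVec_smul, dotProduct_smul, smul_dotProduct, smul_eq_mul,
        smul_eq_mul] at h1
      exact (mul_eq_zero.1 ((mul_eq_zero.1 h1).resolve_left hb)).resolve_left hb
    · intro hS X hX Y hY
      obtain ⟨u, hu, hXu⟩ := h.mem_points_iff.1 hX
      obtain ⟨ω, hω⟩ := (h.mem_bose_iff hK hXu).1 (((isVec_rep Y).mem_pointsOf _).1 hY)
      rw [eval_quadPoly, hω]
      exact hS ω u
  constructor
  · intro hZ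
    refine exists_scroll_of_quadrics hK h.P_mul h.sum_mul_P hz.1 fun S hS => ?_
    have := hZ (quadPoly S) (quadPoly_isHomogeneous S) ((hvan S).2 hS)
    rw [hdz, aeval_quadPoly, mulVec_smul, dotProduct_smul, smul_dotProduct, smul_eq_mul,
      smul_eq_mul] at this
    exact (mul_eq_zero.1 ((mul_eq_zero.1 this).resolve_left hd)).resolve_left hd
  · rintro ⟨u, c, hu, rfl⟩ f hf hfv
    obtain ⟨S, rfl⟩ := exists_eq_quadPoly hf
    rw [hdz, ← map_smul, aeval_quadPoly]
    exact VanishesOnPlanes.apply_scroll hK hq ((hvan S).1 hfv) u _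

end Ext

end Coords

end Adapted

/-! ### Binary forms and their conjugates -/

section Forms

open Matrix

/-- Two binary quadratic forms with nonzero resultant generate all cubic forms: a linear functional
`y` on the cubic forms that kills their multiples is zero. -/
theorem eq_zero_of_resultant_ne_zero {k : Type*} [Field k] {a b : Fin 3 → k}
    (h : (a 0 * b 2 - a 2 * b 0) ^ 2 ≠ (a 0 * b 1 - a 1 * b 0) * (a 1 * b 2 - a 2 * b 1))
    {y₀ y₁ y₂ y₃ : k} (h1 : a 0 * y₀ + a 1 * y₁ + a 2 * y₂ = 0)
    (h2 : a 0 * y₁ + a 1 * y₂ + a 2 * y₃ = 0) (h3 : b 0 * y₀ + b 1 * y₁ + b 2 * y₂ = 0)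
    (h4 : b 0 * y₁ + b 1 * y₂ + b 2 * y₃ = 0) : y₀ = 0 ∧ y₁ = 0 ∧ y₂ = 0 ∧ y₃ = 0 := by
  set p := a 0 * b 1 - a 1 * b 0 with hp
  set m := a 0 * b 2 - a 2 * b 0 with hm
  set r := a 1 * b 2 - a 2 * b 1 with hr
  have hdet : m ^ 2 - p * r ≠ 0 := sub_ne_zero.2 h
  have e1 : p * y₁ + m * y₂ = 0 := by linear_combination a 0 * h3 - b 0 * h1
  have e2 : m * y₀ + r * y₁ = 0 := by linear_combination b 2 * h1 - a 2 * h3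
  have e3 : p * y₀ - r * y₂ = 0 := by linear_combination b 1 * h1 - a 1 * h3
  have e4 : p * y₂ + m * y₃ = 0 := by linear_combination a 0 * h4 - b 0 * h2
  have e5 : m * y₁ + r * y₂ = 0 := by linear_combination b 2 * h2 - a 2 * h4
  have e6 : p * y₁ - r * y₃ = 0 := by linear_combination b 1 * h2 - a 1 * h4
  clear_value p m r
  refine ⟨?_, ?_, ?_, ?_⟩ <;> refine (mul_eq_zero.1 ?_).resolve_left hdet
  · linear_combination m * e2 - r * e3 - r * e5
  · linear_combination m * e5 - r * e1
  · linear_combination m * e1 - p * e5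
  · linear_combination m * e4 + p * e6 - p * e1

/-- Two independent binary quadratic forms with vanishing resultant have a common root over the
field of their coefficients. -/
theorem exists_common_root {k : Type*} [Field k] {a b : Fin 3 → k}
    (h : (a 0 * b 2 - a 2 * b 0) ^ 2 = (a 0 * b 1 - a 1 * b 0) * (a 1 * b 2 - a 2 * b 1))
    (hind : ¬(a 0 * b 1 - a 1 * b 0 = 0 ∧ a 0 * b 2 - a 2 * b 0 = 0 ∧
      a 1 * b 2 - a 2 * b 1 = 0)) :
    ∃ u : Fin 2 → k, u ≠ 0 ∧ a ⬝ᵥ moment 2 u = 0 ∧ b ⬝ᵥ moment 2 u = 0 := by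
  simp only [moment_two_eq, dotProduct, Fin.sum_univ_three]
  -- the root is `(a₀b₂ - a₂b₀, a₁b₀ - a₀b₁)`, unless this vanishes and `(1, 0)` is one
  by_cases h0 : a 0 * b 1 - a 1 * b 0 = 0 ∧ a 0 * b 2 - a 2 * b 0 = 0
  · obtain ⟨hp, hm⟩ := h0
    have hr : a 1 * b 2 - a 2 * b 1 ≠ 0 := fun hr => hind ⟨hp, hm, hr⟩
    have ha : a 0 = 0 := by
      refine (mul_eq_zero.1 ?_).resolve_right hr
      linear_combination a 1 * hm - a 2 * hp
    have hb : b 0 = 0 := by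
      refine (mul_eq_zero.1 ?_).resolve_right hr
      linear_combination b 1 * hm - b 2 * hp
    refine ⟨![1, 0], fun h => one_ne_zero (congrFun h 0), ?_, ?_⟩ <;> simp [ha, hb]
  · refine ⟨![a 0 * b 2 - a 2 * b 0, -(a 0 * b 1 - a 1 * b 0)], fun hu => h0 ?_, ?_, ?_⟩
    · exact ⟨neg_eq_zero.1 (congrFun hu 1), congrFun hu 0⟩
    · simp
      linear_combination a 0 * h
    · simp
      linear_combination b 0 * h

/-- Three pairwise independent linear forms `x i X + y i Y`: their pairwise products span the
quadratic forms in `X`, `Y`. -/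
theorem eq_zero_of_pairwise_products {k : Type*} [Field k] {x y : Fin 3 → k}
    (h01 : x 0 * y 1 ≠ x 1 * y 0) (h12 : x 1 * y 2 ≠ x 2 * y 1) (h20 : x 2 * y 0 ≠ x 0 * y 2)
    {A B C : k} (e12 : x 1 * x 2 * A + (x 1 * y 2 + y 1 * x 2) * B + y 1 * y 2 * C = 0)
    (e20 : x 2 * x 0 * A + (x 2 * y 0 + y 2 * x 0) * B + y 2 * y 0 * C = 0)
    (e01 : x 0 * x 1 * A + (x 0 * y 1 + y 0 * x 1) * B + y 0 * y 1 * C = 0) :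
    A = 0 ∧ B = 0 ∧ C = 0 := by
  have d01 := sub_ne_zero.2 h01
  have d12 := sub_ne_zero.2 h12
  have d20 := sub_ne_zero.2 h20
  have f1 : x 2 * A + y 2 * B = 0 := by
    refine (mul_eq_zero.1 ?_).resolve_left d01
    linear_combination y 1 * e20 - y 0 * e12
  have f2 : x 2 * B + y 2 * C = 0 := by
    refine (mul_eq_zero.1 ?_).resolve_left d01
    linear_combination x 0 * e12 - x 1 * e20
  have f3 : x 0 * A + y 0 * B = 0 := by
    refine (mul_eq_zero.1 ?_).resolve_left d12
    linear_combination y 2 * e01 - y 1 * e20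
  have f4 : x 0 * B + y 0 * C = 0 := by
    refine (mul_eq_zero.1 ?_).resolve_left d12
    linear_combination x 1 * e20 - x 2 * e01
  refine ⟨?_, ?_, ?_⟩ <;> refine (mul_eq_zero.1 ?_).resolve_left d20
  · linear_combination y 0 * f1 - y 2 * f3
  · linear_combination x 2 * f3 - x 0 * f1
  · linear_combination x 2 * f4 - x 0 * f2

/-- If the products `c i * x i` are all equal and no two of the `x i` vanish, then the `c i` are
proportional to the products of the other two `x j`. -/
theorem exists_smul_products {k : Type*} [Field k] {x c : Fin 3 → k} {κ : k}
    (h : ∀ i, c i * x i = κ) (hx : ∀ i j, i ≠ j → x i ≠ 0 ∨ x j ≠ 0) :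
    ∃ d : k, ∀ i, c i = d * (x (i + 1) * x (i + 2)) := by
  have h0 := h 0
  have h1 := h 1
  have h2 := h 2
  have x01 := hx 0 1 (by decide)
  have x12 := hx 1 2 (by decide)
  have x20 := hx 2 0 (by decide)
  have hfin : ∀ d : k, c 0 = d * (x 1 * x 2) → c 1 = d * (x 2 * x 0) → c 2 = d * (x 0 * x 1) →
      ∃ d : k, ∀ i, c i = d * (x (i + 1) * x (i + 2)) := by
    intro d e0 e1 e2
    refine ⟨d, fun i => ?_⟩
    fin_cases i
    · exact e0
    · exact e1
    · exact e2
  by_cases z0 : x 0 = 0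
  · have z1 : x 1 ≠ 0 := x01.resolve_left (not_not.2 z0)
    have z2 : x 2 ≠ 0 := x20.resolve_right (not_not.2 z0)
    have hκ : κ = 0 := by rw [← h0, z0, mul_zero]
    rw [hκ] at h1 h2
    refine hfin (c 0 / (x 1 * x 2)) (by field_simp) ?_ ?_
    · rw [z0, (mul_eq_zero.1 h1).resolve_right z1]; ring
    · rw [z0, (mul_eq_zero.1 h2).resolve_right z2]; ring
  by_cases z1 : x 1 = 0
  · have z2 : x 2 ≠ 0 := x12.resolve_left (not_not.2 z1)
    have hκ : κ = 0 := by rw [← h1, z1, mul_zero]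
    rw [hκ] at h0 h2
    refine hfin (c 1 / (x 2 * x 0)) ?_ (by field_simp) ?_
    · rw [z1, (mul_eq_zero.1 h0).resolve_right z0]; ring
    · rw [z1, (mul_eq_zero.1 h2).resolve_right z2]; ring
  · refine hfin (c 2 / (x 0 * x 1)) ?_ ?_ (by field_simp)
    · field_simp
      linear_combination h0 - h2
    · field_simp
      linear_combination h1 - h2

variable {F K : Type*} [Field F] [Fintype F] [Field K] [Algebra F K]

/-- If `b` is not proportional to a vector over `F`, then neither are two of its conjugates
proportional. -/
theorem conjugates_independent (hK : Module.finrank F K = 3) {b₁ b₂ : K}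
    (hb : ∀ c d : F, algebraMap F K c * b₁ + algebraMap F K d * b₂ = 0 → c = 0 ∧ d = 0) :
    b₁ * tw F 1 b₂ ≠ tw F 1 b₁ * b₂ ∧ tw F 1 b₁ * tw F 2 b₂ ≠ tw F 2 b₁ * tw F 1 b₂ ∧
      tw F 2 b₁ * b₂ ≠ b₁ * tw F 2 b₂ := by
  have h0 : b₁ * tw F 1 b₂ ≠ tw F 1 b₁ * b₂ := by
    intro h
    have hb₂ : b₂ ≠ 0 := by
      rintro rfl
      exact one_ne_zero (hb 0 1 (by simp)).2
    have hb₂' : tw F 1 b₂ ≠ 0 := by simpa using hb₂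
    obtain ⟨c, hc⟩ := mem_base_of_tw_one (F := F) (x := b₁ / b₂) (by
      rw [map_div₀, div_eq_div_iff hb₂' hb₂, ← h])
    have := (hb 1 (-c) (by rw [map_neg, hc, map_one]; field_simp; ring)).1
    exact one_ne_zero this
  -- the other two pairs are conjugate to the first
  refine ⟨h0, fun h => h0 ((tw F 1).injective ?_), fun h => h0 ((tw F 2).injective ?_)⟩
  · rw [map_mul, map_mul, tw_tw, tw_tw]
    exact h
  · have h3 : ∀ x : K, tw F 2 (tw F 1 x) = x := fun x => by rw [tw_tw]; exact tw_three hK x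
    rw [map_mul, map_mul, h3, h3]
    exact h

/-- The matrix of multiplication by the product of two quadratic forms, from quadratic forms to
sextic forms. -/
def mulMat₂ {k : Type*} [Field k] (p r : Fin 3 → k) : Matrix (Fin 3) (Fin 7) k :=
  !![p 0 * r 0, p 0 * r 1 + p 1 * r 0, p 0 * r 2 + p 1 * r 1 + p 2 * r 0,
      p 1 * r 2 + p 2 * r 1, p 2 * r 2, 0, 0;
    0, p 0 * r 0, p 0 * r 1 + p 1 * r 0, p 0 * r 2 + p 1 * r 1 + p 2 * r 0,
      p 1 * r 2 + p 2 * r 1, p 2 * r 2, 0;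
    0, 0, p 0 * r 0, p 0 * r 1 + p 1 * r 0, p 0 * r 2 + p 1 * r 1 + p 2 * r 0,
      p 1 * r 2 + p 2 * r 1, p 2 * r 2]

/-- The matrix of multiplication by the product of two linear forms, from quadratic forms to
quartic forms. -/
def mulMat₁ {k : Type*} [Field k] (p r : Fin 2 → k) : Matrix (Fin 3) (Fin 5) k :=
  !![p 0 * r 0, p 0 * r 1 + p 1 * r 0, p 1 * r 1, 0, 0;
    0, p 0 * r 0, p 0 * r 1 + p 1 * r 0, p 1 * r 1, 0;
    0, 0, p 0 * r 0, p 0 * r 1 + p 1 * r 0, p 1 * r 1]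

theorem mulMat₂_mulVec {k : Type*} [Field k] (p r : Fin 3 → k) (u : Fin 2 → k) :
    mulMat₂ p r *ᵥ moment 6 u = ((p ⬝ᵥ moment 2 u) * (r ⬝ᵥ moment 2 u)) • moment 2 u := by
  ext i
  fin_cases i <;>
  simp [mulMat₂, mulVec, dotProduct, Fin.sum_univ_succ, moment] <;> ring

theorem mulMat₁_mulVec {k : Type*} [Field k] (p r : Fin 2 → k) (u : Fin 2 → k) :
    mulMat₁ p r *ᵥ moment 4 u = ((p ⬝ᵥ moment 1 u) * (r ⬝ᵥ moment 1 u)) • moment 2 u := by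
  ext i
  fin_cases i <;>
  simp [mulMat₁, mulVec, dotProduct, Fin.sum_univ_succ, moment] <;> ring

theorem mulMat₂_map {k k' : Type*} [Field k] [Field k'] (f : k →+* k') (p r : Fin 3 → k) :
    (mulMat₂ p r).map f = mulMat₂ (fun j => f (p j)) (fun j => f (r j)) := by
  ext i j
  fin_cases i <;> fin_cases j <;> simp [mulMat₂]

theorem mulMat₁_map {k k' : Type*} [Field k] [Field k'] (f : k →+* k') (p r : Fin 2 → k) :
    (mulMat₁ p r).map f = mulMat₁ (fun j => f (p j)) (fun j => f (r j)) := by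
  ext i j
  fin_cases i <;> fin_cases j <;> simp [mulMat₁]

variable {E : Type*} [Field E] [Algebra K E] {d r : ℕ}

/-- The data from which the normal rational curve is built, over the extension `E`. On the conic,
the equation `a` of the line at infinity is the product of a form `l` over `F` and a form of degree
`d` with coefficients `e`, no two conjugates of which have a common root; the matrix `T` is that of
multiplication by the product of the second and third conjugates. -/
structure CurveOver (a : Fin 3 → K) (e : Fin (d + 1) → K) (T : Matrix (Fin 3) (Fin (r + 1)) K)
    (F : Type*) [Field F] [Fintype F] [Algebra F K]
    (E : Type*) [Field E] [Algebra K E] (l : (Fin 2 → E) → E) : Prop where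
  mulVec_moment : ∀ (i : Fin 3) (u : Fin 2 → E), twMat F E i T *ᵥ moment r u =
    (conjForm F e (i + 1 : Fin 3) (moment d u) * conjForm F e (i + 2 : Fin 3) (moment d u)) •
      moment 2 u
  factor : ∀ (i : Fin 3) (u : Fin 2 → E),
    conjForm F a i (moment 2 u) = l u * conjForm F e i (moment d u)
  coprime : ∀ u : Fin 2 → E, u ≠ 0 → ∀ i j : Fin 3, i ≠ j →
    conjForm F e i (moment d u) ≠ 0 ∨ conjForm F e j (moment d u) ≠ 0

theorem twMat_mulMat₂ (i : ℕ) (e₁ e₂ : Fin 3 → K) :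
    twMat F E i (mulMat₂ e₁ e₂) = mulMat₂ (fun j => algebraMap K E (tw F i (e₁ j)))
      (fun j => algebraMap K E (tw F i (e₂ j))) :=
  mulMat₂_map ((algebraMap K E).comp (tw F i)) _ _

theorem twMat_mulMat₁ (i : ℕ) (e₁ e₂ : Fin 2 → K) :
    twMat F E i (mulMat₁ e₁ e₂) = mulMat₁ (fun j => algebraMap K E (tw F i (e₁ j)))
      (fun j => algebraMap K E (tw F i (e₂ j))) :=
  mulMat₁_map ((algebraMap K E).comp (tw F i)) _ _

/-- Exponents of the Frobenius map may be reduced modulo three on `K`. -/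
theorem tw_add_fin (hK : Module.finrank F K = 3) (i j : Fin 3) (x : K) :
    tw F i (tw F j x) = tw F (i + j : Fin 3) x := by
  rw [tw_tw]
  have h3 : tw F 3 x = x := tw_three hK x
  have h4 : tw F 4 x = tw F 1 x := by rw [← tw_tw F 1 3, h3]
  fin_cases i <;> fin_cases j <;> simp [h3, h4]

/-- The coprimality of conjugate forms `b₁ f₁ + b₂ f₂`, where `f₁`, `f₂` are forms over `F` without
common root. -/
theorem conjForm_ne_zero_of_coprime (hK : Module.finrank F K = 3) {b₁ b₂ : K}
    (hb : ∀ c d : F, algebraMap F K c * b₁ + algebraMap F K d * b₂ = 0 → c = 0 ∧ d = 0)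
    [Algebra F E] [IsScalarTower F K E] {e : Fin (d + 1) → K} {f₁ f₂ : Fin (d + 1) → F}
    (he : ∀ j, e j = algebraMap F K (f₁ j) * b₁ + algebraMap F K (f₂ j) * b₂)
    {u : Fin 2 → E}
    (hu : ¬((fun j => algebraMap F E (f₁ j)) ⬝ᵥ moment d u = 0 ∧
      (fun j => algebraMap F E (f₂ j)) ⬝ᵥ moment d u = 0)) (i j : Fin 3) (hij : i ≠ j) :
    conjForm F e i (moment d u) ≠ 0 ∨ conjForm F e j (moment d u) ≠ 0 := by
  obtain ⟨h01, h12, h20⟩ := conjugates_independent hK hb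
  set A := (fun j => algebraMap F E (f₁ j)) ⬝ᵥ moment d u with hA
  set B := (fun j => algebraMap F E (f₂ j)) ⬝ᵥ moment d u with hB
  have hval : ∀ i : ℕ, conjForm F e i (moment d u) =
      algebraMap K E (tw F i b₁) * A + algebraMap K E (tw F i b₂) * B := by
    intro i
    simp only [conjForm, hA, hB, dotProduct, Finset.mul_sum, ← Finset.sum_add_distrib]
    refine Finset.sum_congr rfl fun j _ => ?_
    rw [he, map_add, map_mul, map_mul, tw_base, tw_base, map_add, map_mul, map_mul,
      IsScalarTower.algebraMap_apply F K E, IsScalarTower.algebraMap_apply F K E]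
    ring
  have hdet : tw F i b₁ * tw F j b₂ - tw F j b₁ * tw F i b₂ ≠ 0 := by
    rw [sub_ne_zero]
    fin_cases i <;> fin_cases j <;> first | exact absurd rfl hij | skip
    · simpa using h01
    · simpa using h20.symm
    · simpa using h01.symm
    · simpa using h12
    · simpa using h20
    · simpa using h12.symm
  have hdet' : algebraMap K E (tw F i b₁ * tw F j b₂ - tw F j b₁ * tw F i b₂) ≠ 0 := by
    rwa [Ne, map_eq_zero]
  rw [hval, hval]
  by_contra! hcon
  obtain ⟨e1, e2⟩ := hcon
  refine hu ⟨(mul_eq_zero.1 ?_).resolve_left hdet', (mul_eq_zero.1 ?_).resolve_left hdet'⟩ <;>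
    simp only [map_sub, map_mul]
  · linear_combination algebraMap K E (tw F j b₂) * e1 - algebraMap K E (tw F i b₂) * e2
  · linear_combination algebraMap K E (tw F i b₁) * e2 - algebraMap K E (tw F j b₁) * e1

/-- The value at `p * q` of the functional on quartic forms with values `v` on the monomials. -/
def pairing {k : Type*} [Field k] (p q : Fin 3 → k) (v : Fin 5 → k) : k :=
  p 0 * q 0 * v 0 + (p 0 * q 1 + p 1 * q 0) * v 1 + (p 0 * q 2 + p 1 * q 1 + p 2 * q 0) * v 2 +
    (p 1 * q 2 + p 2 * q 1) * v 3 + p 2 * q 2 * v 4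

/-- The multiples of the pairwise products of `x i * a + y i * b` span the sextic forms: these
products span `a²`, `a b`, `b²`, and `a`, `b` generate all cubic forms. -/
theorem mulMat₂_kernel {k : Type*} [Field k] {x y : Fin 3 → k} {a b : Fin 3 → k}
    (h01 : x 0 * y 1 ≠ x 1 * y 0) (h12 : x 1 * y 2 ≠ x 2 * y 1) (h20 : x 2 * y 0 ≠ x 0 * y 2)
    (hres : (a 0 * b 2 - a 2 * b 0) ^ 2 ≠
      (a 0 * b 1 - a 1 * b 0) * (a 1 * b 2 - a 2 * b 1))
    {c : Fin 7 → k}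
    (hc : ∀ i : Fin 3, mulMat₂ (fun j => x (i + 1) * a j + y (i + 1) * b j)
      (fun j => x (i + 2) * a j + y (i + 2) * b j) *ᵥ c = 0) : c = 0 := by
  -- the coefficient vector `c` is a functional on sextic forms; its three shifts are functionals on
  -- quartic forms, to be multiplied by one of the quadratic monomials
  have hpair : ∀ v : Fin 5 → k, (∀ i : Fin 3, pairing (fun j => x (i + 1) * a j + y (i + 1) * b j)
      (fun j => x (i + 2) * a j + y (i + 2) * b j) v = 0) →
      pairing a a v = 0 ∧ pairing a b v = 0 ∧ pairing b b v = 0 := by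
    intro v hv
    have e12 := hv 0
    have e20 := hv 1
    have e01 := hv 2
    simp only [pairing, zero_add, Fin.isValue, Fin.reduceAdd] at e12 e20 e01
    refine eq_zero_of_pairwise_products h01 h12 h20 ?_ ?_ ?_ <;> simp only [pairing]
    · linear_combination e12
    · linear_combination e20
    · linear_combination e01
  have hrow : ∀ (p q : Fin 3 → k), mulMat₂ p q *ᵥ c = 0 →
      pairing p q ![c 0, c 1, c 2, c 3, c 4] = 0 ∧ pairing p q ![c 1, c 2, c 3, c 4, c 5] = 0 ∧
        pairing p q ![c 2, c 3, c 4, c 5, c 6] = 0 := by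
    intro p q h
    have r0 := congrFun h 0
    have r1 := congrFun h 1
    have r2 := congrFun h 2
    simp [mulMat₂, mulVec, dotProduct, Fin.sum_univ_succ] at r0 r1 r2
    refine ⟨?_, ?_, ?_⟩ <;> simp [pairing]
    · linear_combination r0
    · linear_combination r1
    · linear_combination r2
  obtain ⟨A0, B0, C0⟩ := hpair _ fun i => (hrow _ _ (hc i)).1
  obtain ⟨A1, B1, C1⟩ := hpair _ fun i => (hrow _ _ (hc i)).2.1
  obtain ⟨A2, B2, C2⟩ := hpair _ fun i => (hrow _ _ (hc i)).2.2
  simp [pairing] at A0 B0 C0 A1 B1 C1 A2 B2 C2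
  -- a form `p` with `p a` and `p b` in the kernel is in the kernel
  have key : ∀ p : Fin 3 → k,
      pairing p a ![c 0, c 1, c 2, c 3, c 4] = 0 → pairing p a ![c 1, c 2, c 3, c 4, c 5] = 0 →
      pairing p a ![c 2, c 3, c 4, c 5, c 6] = 0 → pairing p b ![c 0, c 1, c 2, c 3, c 4] = 0 →
      pairing p b ![c 1, c 2, c 3, c 4, c 5] = 0 → pairing p b ![c 2, c 3, c 4, c 5, c 6] = 0 →
      (p 0 * c 0 + p 1 * c 1 + p 2 * c 2 = 0 ∧ p 0 * c 1 + p 1 * c 2 + p 2 * c 3 = 0 ∧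
        p 0 * c 2 + p 1 * c 3 + p 2 * c 4 = 0 ∧ p 0 * c 3 + p 1 * c 4 + p 2 * c 5 = 0) ∧
        p 0 * c 4 + p 1 * c 5 + p 2 * c 6 = 0 := by
    intro p g0 g1 g2 g3 g4 g5
    simp [pairing] at g0 g1 g2 g3 g4 g5
    refine ⟨eq_zero_of_resultant_ne_zero hres ?_ ?_ ?_ ?_,
      (eq_zero_of_resultant_ne_zero hres (y₀ := p 0 * c 1 + p 1 * c 2 + p 2 * c 3)
        (y₁ := p 0 * c 2 + p 1 * c 3 + p 2 * c 4) (y₂ := p 0 * c 3 + p 1 * c 4 + p 2 * c 5)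
        ?_ ?_ ?_ ?_).2.2.2⟩
    · linear_combination g0
    · linear_combination g1
    · linear_combination g3
    · linear_combination g4
    · linear_combination g1
    · linear_combination g2
    · linear_combination g4
    · linear_combination g5
  obtain ⟨⟨y0, y1, y2, y3⟩, y4⟩ := key a (by simp [pairing]; linear_combination A0)
    (by simp [pairing]; linear_combination A1) (by simp [pairing]; linear_combination A2)
    (by simp [pairing]; linear_combination B0) (by simp [pairing]; linear_combination B1)
    (by simp [pairing]; linear_combination B2)
  obtain ⟨⟨z0, z1, z2, z3⟩, z4⟩ := key b (by simp [pairing]; linear_combination B0)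
    (by simp [pairing]; linear_combination B1) (by simp [pairing]; linear_combination B2)
    (by simp [pairing]; linear_combination C0) (by simp [pairing]; linear_combination C1)
    (by simp [pairing]; linear_combination C2)
  obtain ⟨c0, c1, c2, c3⟩ := eq_zero_of_resultant_ne_zero hres y0 y1 z0 z1
  obtain ⟨-, -, c4, c5⟩ := eq_zero_of_resultant_ne_zero hres y2 y3 z2 z3
  obtain ⟨-, -, -, c6⟩ := eq_zero_of_resultant_ne_zero hres y3 y4 z3 z4
  ext i
  fin_cases i <;> assumption

/-- The multiples of the pairwise products of three linear forms, no two of them proportional, span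
the quartic forms. -/
theorem mulMat₁_kernel {k : Type*} [Field k] {x y : Fin 3 → k}
    (h01 : x 0 * y 1 ≠ x 1 * y 0) (h12 : x 1 * y 2 ≠ x 2 * y 1) (h20 : x 2 * y 0 ≠ x 0 * y 2)
    {c : Fin 5 → k} (hc : ∀ i : Fin 3, mulMat₁ ![x (i + 1), y (i + 1)]
      ![x (i + 2), y (i + 2)] *ᵥ c = 0) : c = 0 := by
  have hrow : ∀ p q : Fin 2 → k, mulMat₁ p q *ᵥ c = 0 →
      p 0 * q 0 * c 0 + (p 0 * q 1 + p 1 * q 0) * c 1 + p 1 * q 1 * c 2 = 0 ∧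
      p 0 * q 0 * c 2 + (p 0 * q 1 + p 1 * q 0) * c 3 + p 1 * q 1 * c 4 = 0 := by
    intro p q h
    have r0 := congrFun h 0
    have r2 := congrFun h 2
    simp [mulMat₁, mulVec, dotProduct, Fin.sum_univ_succ] at r0 r2
    exact ⟨by linear_combination r0, by linear_combination r2⟩
  obtain ⟨c0, c1, c2⟩ := eq_zero_of_pairwise_products h01 h12 h20
    (hrow _ _ (hc 0)).1 (hrow _ _ (hc 1)).1 (hrow _ _ (hc 2)).1
  obtain ⟨-, c3, c4⟩ := eq_zero_of_pairwise_products h01 h12 h20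
    (hrow _ _ (hc 0)).2 (hrow _ _ (hc 1)).2 (hrow _ _ (hc 2)).2
  ext i
  fin_cases i <;> assumption

end Forms

/-! ### The section of the scroll by the 6-space -/

section Curve

open Matrix

variable {F K : Type*} [Field F] [Field K] [Algebra F K] {r : ℕ}

/-- The matrix over `F` whose entries are the traces of those of `D * T`. -/
def curveMat (D : Matrix (Fin 9) (Fin 3) K) (T : Matrix (Fin 3) (Fin (r + 1)) K) :
    Matrix (Fin 9) (Fin (r + 1)) F :=
  Matrix.of fun k m => Algebra.trace F K ((D * T) k m)

theorem curveMat_mulVec (D : Matrix (Fin 9) (Fin 3) K) (T : Matrix (Fin 3) (Fin (r + 1)) K)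
    (w : Fin (r + 1) → F) :
    curveMat D T *ᵥ w = traceVec D (T *ᵥ vecExt F K (r + 1) w) := by
  ext k
  simp only [traceVec, LinearMap.coe_mk, AddHom.coe_mk, mulVec_mulVec]
  simp only [curveMat, mulVec, dotProduct, of_apply, vecExt, LinearMap.coe_mk, AddHom.coe_mk,
    map_sum]
  refine Finset.sum_congr rfl fun m _ => ?_
  rw [mul_comm _ (algebraMap F K _), ← Algebra.smul_def, map_smul, smul_eq_mul, mul_comm]

variable [Fintype F] {d : ℕ} {R : Frame F K} {C : FqConic F K} {G : Matrix (Fin 3) (Fin 3) K}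
  {D : Matrix (Fin 9) (Fin 3) K} {P : Fin 3 → Matrix (Fin 3) (Fin 9) K} {a : Fin 3 → K}
  {e : Fin (d + 1) → K} {T : Matrix (Fin 3) (Fin (r + 1)) K}

theorem curveMat_map_mulVec (hK : Module.finrank F K = 3) {E : Type*} [Field E] [Algebra K E]
    [Algebra F E] [IsScalarTower F K E] (w : Fin (r + 1) → E) :
    (curveMat D T).map (algebraMap F E) *ᵥ w = comb F D fun i => twMat F E i T *ᵥ w := by
  have h : (curveMat D T).map (algebraMap F E) =
      twMat F E 0 (D * T) + twMat F E 1 (D * T) + twMat F E 2 (D * T) := by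
    ext k m
    simp only [curveMat, map_apply, of_apply, IsScalarTower.algebraMap_apply F K E,
      algebraMap_trace hK, map_add, Matrix.add_apply, twMat, tw_zero]
  rw [h]
  simp only [twMat_mul, add_mulVec, comb, mulVec_mulVec, Fin.val_zero, Fin.val_one, Fin.val_two]

/-- The curve spans a space of dimension `r`, provided that the columns of `T` and of its conjugates
are jointly independent. -/
theorem curveMat_injective (hK : Module.finrank F K = 3) (h : Coords R C G D P a)
    (hT : ∀ c, (∀ i : Fin 3, twMat F K i T *ᵥ c = 0) → c = 0) :
    Function.Injective (curveMat (F := F) D T).mulVecLin := by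
  rw [← LinearMap.ker_eq_bot, LinearMap.ker_eq_bot']
  intro w hw
  have h1 : (curveMat D T).map (algebraMap F K) *ᵥ vecExt F K (r + 1) w = 0 := by
    rw [← vecExt_mulVec]
    have : curveMat D T *ᵥ w = 0 := hw
    rw [this, map_zero]
  rw [curveMat_map_mulVec hK] at h1
  have h0 : comb F D (0 : Fin 3 → Fin 3 → K) = 0 := map_zero (combLin F K D)
  have h2 := comb_injective h.P_mul (h1.trans h0.symm)
  have h3 := hT _ fun i => congrFun h2 i
  exact vecExt_injective F K _ (h3.trans (map_zero _).symm)

/-- The curve lies in the 6-space as soon as the columns of its matrix do. -/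
theorem curveMat_mem_spaceExt (h : Coords R C G D P a)
    (hTa : ∀ m, ∃ κ : F, (a ᵥ* T) m = algebraMap F K κ) (E : Type*) [Field E] [Algebra F E]
    (w : Fin (r + 1) → E) : (curveMat D T).map (algebraMap F E) *ᵥ w ∈ spaceExt E R.S6 := by
  have h1 : (curveMat D T).map (algebraMap F E) *ᵥ w =
      ∑ m, w m • vecExt F E 9 (curveMat D T *ᵥ Pi.single m 1) := by
    ext k
    simp only [Finset.sum_apply, Pi.smul_apply, smul_eq_mul, mulVec_single_one]
    simp only [mulVec, dotProduct, map_apply]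
    exact Finset.sum_congr rfl fun m _ => mul_comm _ _
  rw [h1]
  refine Submodule.sum_mem _ fun m _ => Submodule.smul_mem _ _ (vecExt_mem_spaceExt E ?_)
  obtain ⟨κ, hκ⟩ := hTa m
  rw [curveMat_mulVec, h.S6_iff]
  refine ⟨κ, ?_⟩
  rw [vecExt_single, dotProduct_mulVec, dotProduct_single, mul_one, hκ]

section Ext

variable {E : Type*} [Field E] [Algebra K E] {l : (Fin 2 → E) → E}

section

variable [Algebra F E] [IsScalarTower F K E]

/-- The curve lies on the scroll. -/
theorem CurveOver.curveMat_moment (hK : Module.finrank F K = 3) (hc : CurveOver a e T F E l)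
    (u : Fin 2 → E) : (curveMat D T).map (algebraMap F E) *ᵥ moment r u =
      scrollLin F D (moment 2 u) fun i => conjForm F e (i + 1 : Fin 3) (moment d u) *
        conjForm F e (i + 2 : Fin 3) (moment d u) := by
  rw [curveMat_map_mulVec hK]
  exact congrArg (comb F D) (funext fun i => hc.mulVec_moment i u)

/-- A point of the scroll in the 6-space lies on the curve, unless the factor `l` of the equation
of the line at infinity vanishes at its parameter. -/
theorem CurveOver.exists_smul_of_scroll (hK : Module.finrank F K = 3) (h : Coords R C G D P a)
    (hc : CurveOver a e T F E l) {u : Fin 2 → E} (hu : u ≠ 0) (hl : l u ≠ 0) {c : Fin 3 → E}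
    (hS : scrollLin F D (moment 2 u) c ∈ spaceExt E R.S6) :
    ∃ b : E, scrollLin F D (moment 2 u) c =
      b • ((curveMat D T).map (algebraMap F E) *ᵥ moment r u) := by
  have h1 : ∀ i, c i * conjForm F e i (moment d u) =
      c 0 * conjForm F e (0 : Fin 3) (moment d u) := by
    intro i
    have := h.conjForm_eq_of_mem_spaceExt hK (x := fun i => c i • moment 2 u) hS i
    rw [conjForm_smul, conjForm_smul, hc.factor] at this
    have h0 := hc.factor 0 u
    rw [Fin.val_zero] at h0
    rw [h0] at this
    apply mul_left_cancel₀ hl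
    rw [Fin.val_zero]
    linear_combination this
  obtain ⟨b, hb⟩ := exists_smul_products h1 (hc.coprime u hu)
  refine ⟨b, ?_⟩
  rw [hc.curveMat_moment hK, ← map_smul]
  congr 1
  ext i
  exact hb i

/-- At a root of the `i`-th conjugate of the form `e`, the curve passes through the `i`-th
conjugate of the transversal plane. -/
theorem CurveOver.exists_smul_of_root (hK : Module.finrank F K = 3)
    (hc : CurveOver a e T F E l) {u : Fin 2 → E} (hu : u ≠ 0) (i : Fin 3)
    (hi : conjForm F e i (moment d u) = 0) :
    ∃ b : E, b ≠ 0 ∧ (curveMat D T).map (algebraMap F E) *ᵥ moment r u =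
      b • (twMat F E i D *ᵥ moment 2 u) := by
  have hne : ∀ j : Fin 3, i ≠ j → conjForm F e j (moment d u) ≠ 0 := fun j hj =>
    (hc.coprime u hu i j hj).resolve_left (not_not.2 hi)
  refine ⟨conjForm F e (i + 1 : Fin 3) (moment d u) * conjForm F e (i + 2 : Fin 3) (moment d u),
    mul_ne_zero (hne _ (by fin_cases i <;> decide)) (hne _ (by fin_cases i <;> decide)), ?_⟩
  rw [hc.curveMat_moment hK]
  simp only [scrollLin, LinearMap.coe_mk, AddHom.coe_mk, comb, Fin.isValue]
  fin_cases i <;>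
  simp only [Fin.zero_eta, Fin.mk_one, Fin.reduceFinMk, Fin.isValue, Fin.val_zero, Fin.val_one,
    Fin.val_two, zero_add, Fin.reduceAdd] at hi ⊢ <;>
  simp only [hi, zero_mul, mul_zero, zero_smul, mulVec_zero, add_zero, zero_add, mulVec_smul]

/-- The equation of the hyperplane at infinity, restricted to the curve. -/
theorem CurveOver.hyperplaneForm_curve (hK : Module.finrank F K = 3) (h : Coords R C G D P a)
    (hc : CurveOver a e T F E l) (u : Fin 2 → E) :
    Coords.hyperplaneForm P a E F 0 ((curveMat D T).map (algebraMap F E) *ᵥ moment r u) =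
      l u * (conjForm F e 0 (moment d u) * conjForm F e 1 (moment d u) *
        conjForm F e 2 (moment d u)) := by
  rw [hc.curveMat_moment hK, scrollLin_apply, h.hyperplaneForm_comb, conjForm_smul, hc.factor]
  simp only [zero_add, Fin.val_zero, Fin.val_one, Fin.val_two]
  ring

theorem CurveOver.nrc_subset_variety (hK : Module.finrank F K = 3) (hq : 4 ≤ Fintype.card F)
    (h : Coords R C G D P a) (hc : CurveOver a e T F E l)
    (hTa : ∀ m, ∃ κ : F, (a ᵥ* T) m = algebraMap F K κ) {N : NRC r 8 F}
    (hN : N.mat = curveMat D T) : N.points E ⊆ R.variety C.points E := by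
  intro Z hZ
  obtain ⟨u, hu, hZu⟩ := N.mem_points_iff.1 hZ
  rw [hN] at hZu
  refine ⟨?_, (hZu.mem_pointsOf _).2 (curveMat_mem_spaceExt h hTa E _)⟩
  rw [h.mem_boseVariety_iff hK hq hZu, hc.curveMat_moment hK]
  exact ⟨u, _, hu, rfl⟩

/-- A point of the section of the scroll by the 6-space lies on the curve, unless `l` vanishes at
the parameter. -/
theorem CurveOver.mem_nrc_of_mem_variety (hK : Module.finrank F K = 3)
    (hq : 4 ≤ Fintype.card F) (h : Coords R C G D P a) (hc : CurveOver a e T F E l) {N : NRC r 8 F}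
    (hN : N.mat = curveMat D T) {Z : PG 8 E} (hZ : Z ∈ R.variety C.points E) :
    Z ∈ N.points E ∨ ∃ (u : Fin 2 → E) (c : Fin 3 → E), u ≠ 0 ∧ l u = 0 ∧
      IsVec Z (scrollLin F D (moment 2 u) c) := by
  obtain ⟨u, c, hu, hz⟩ := (h.mem_boseVariety_iff hK hq (isVec_rep Z)).1 hZ.1
  have hZu := isVec_rep Z
  rw [hz] at hZu
  by_cases hl : l u = 0
  · exact Or.inr ⟨u, c, hu, hl, hZu⟩
  · left
    obtain ⟨b, hb⟩ := hc.exists_smul_of_scroll hK h hu hl ((hZu.mem_pointsOf _).1 hZ.2)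
    rw [hb, ← hN] at hZu
    exact N.mem_points_iff.2 ⟨u, hu, hZu.of_smul⟩

end

end Ext

/-- The points of the curve over `F` lie in the Bruck–Bose representation of the conic. -/
theorem CurveOver.nrc_subset_brSet (hK : Module.finrank F K = 3) (h : Coords R C G D P a)
    {l : (Fin 2 → K) → K} (hc : CurveOver a e T F K l)
    (hTa : ∀ m, ∃ κ : F, (a ᵥ* T) m = algebraMap F K κ) {N : NRC r 8 F}
    (hN : N.mat = curveMat D T) {u : Fin 2 → F} {X : PG 2 K}
    (hX : IsVec X (G *ᵥ moment 2 (vecExt F K 2 u))) {Z : PG 8 F}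
    (hZ : IsVec Z (N.mat *ᵥ moment r u)) : Z ∈ pointsOf (R.br X) := by
  rw [hZ.mem_pointsOf, hN]
  have hT0 : T = twMat F K (0 : Fin 3) T := by ext; simp [twMat]
  refine ⟨(h.mem_bose_iff hK hX).2 ?_, ?_⟩
  · rw [curveMat_mulVec, ← vecExt_moment, hT0, hc.mulVec_moment]
    exact ⟨_, rfl⟩
  · have := curveMat_mem_spaceExt h hTa F (moment r u)
    rw [Algebra.algebraMap_self, RingHom.coe_id, Matrix.map_id] at this
    refine spaceExt_le (U := R.S6) (fun v hv => ?_) this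
    have hv' : vecExt F F 9 v = v := by ext; simp [vecExt]
    rwa [hv']

/-- A point of the 6-space that represents a point of the conic over `F` lies on the curve, unless
`l` vanishes at the parameter. -/
theorem CurveOver.mem_nrc_of_mem_br (hK : Module.finrank F K = 3) (h : Coords R C G D P a)
    {l : (Fin 2 → K) → K} (hc : CurveOver a e T F K l) {N : NRC r 8 F}
    (hN : N.mat = curveMat D T) {u : Fin 2 → F} (hu : u ≠ 0) (hl : l (vecExt F K 2 u) ≠ 0)
    {X : PG 2 K} (hX : IsVec X (G *ᵥ moment 2 (vecExt F K 2 u))) {Z : PG 8 F}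
    (hZ : Z ∈ pointsOf (R.br X)) : Z ∈ N.points F := by
  obtain ⟨hZb, hZS⟩ := ((isVec_rep Z).mem_pointsOf _).1 hZ
  obtain ⟨ω, hω⟩ := (h.mem_bose_iff hK hX).1 hZb
  have hu' : vecExt F K 2 u ≠ 0 := fun h0 => hu (vecExt_injective F K 2 (by rw [h0, map_zero]))
  have h1 : vecExt F K 9 Z.rep =
      scrollLin F D (moment 2 (vecExt F K 2 u))
        (fun i => algebraMap K K (tw F i ω)) := by
    rw [hω, vecExt_traceVec hK, vecExt_moment]
    rw [scrollLin_apply]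
    congr 1
    ext i j
    simp [vecExt]
  have h2 : vecExt F K 9 Z.rep ∈ spaceExt K R.S6 := vecExt_mem_spaceExt K hZS
  rw [h1] at h2
  obtain ⟨b, hb⟩ := hc.exists_smul_of_scroll hK h hu' hl h2
  rw [← h1, vecExt_moment, ← vecExt_mulVec] at hb
  have hne : curveMat (F := F) D T *ᵥ moment r u ≠ 0 := by
    rw [← hN]
    intro h0
    exact moment_ne_zero r u hu (N.inj (h0.trans (map_zero N.mat.mulVecLin).symm))
  obtain ⟨c, hcZ⟩ := exists_smul_of_vecExt hne hb
  have hZv := isVec_rep Z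
  rw [hcZ] at hZv
  refine N.mem_points_iff.2 ⟨u, hu, ?_⟩
  rw [Algebra.algebraMap_self, RingHom.coe_id, Matrix.map_id, hN]
  exact hZv.of_smul

end Curve

/-! ### Roots of a binary quadratic form over a finite field and its quadratic extension -/

section Roots

open Matrix

theorem exists_factor_of_root {k : Type*} [Field k] {a : Fin 3 → k} (ha : a ≠ 0) {p : Fin 2 → k}
    (hp : p ≠ 0) (h : a ⬝ᵥ moment 2 p = 0) :
    ∃ q : Fin 2 → k, q ≠ 0 ∧ ∀ w : Fin 2 → k, a ⬝ᵥ moment 2 w =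
      (w 0 * p 1 - w 1 * p 0) * (w 0 * q 1 - w 1 * q 0) := by
  simp only [moment_two_eq, dotProduct, Fin.sum_univ_three, cons_val] at h ⊢
  obtain ⟨q, hq⟩ : ∃ q : Fin 2 → k, a 0 = p 1 * q 1 ∧ a 1 = -(p 1 * q 0 + p 0 * q 1) ∧
      a 2 = p 0 * q 0 := by
    by_cases h0 : p 0 = 0
    · have h1 : p 1 ≠ 0 := fun h1 => hp (by ext i; fin_cases i <;> assumption)
      refine ⟨![-(a 1) / p 1, a 0 / p 1], ?_, ?_, ?_⟩ <;> simp [h0]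
      · field_simp
      · field_simp
      · simpa [h0, h1] using h
    · refine ⟨![a 2 / p 0, -(a 1 + p 1 * (a 2 / p 0)) / p 0], ?_, ?_, ?_⟩ <;> simp
      · field_simp
        linear_combination h
      · field_simp
        ring
      · field_simp
  refine ⟨q, ?_, fun w => ?_⟩
  · rintro rfl
    apply ha
    ext i
    fin_cases i <;> simp [hq]
  · rw [hq.1, hq.2.1, hq.2.2]; ring

/-- A binary quadratic form without roots over a finite field `K` has two distinct roots, conjugate
over `K`, in the quadratic extension. -/
theorem exists_conjugate_roots {K L : Type*} [Field K] [Fintype K] [Field L] [Algebra K L]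
    (hL : Module.finrank K L = 2) {a : Fin 3 → K}
    (h : ∀ p : Fin 2 → K, p ≠ 0 → a ⬝ᵥ moment 2 p ≠ 0) :
    ∃ θ : L, tw K 1 θ ≠ θ ∧ a 0 ≠ 0 ∧ ∀ w : Fin 2 → L,
      (fun j => algebraMap K L (a j)) ⬝ᵥ moment 2 w =
        algebraMap K L (a 0) * ((w 0 - w 1 * θ) * (w 0 - w 1 * tw K 1 θ)) := by
  have : FiniteDimensional K L := Module.finite_of_finrank_pos (by omega)
  have : Finite L := Module.finite_of_finite K
  simp only [moment_two_eq, dotProduct, Fin.sum_univ_three, cons_val] at h ⊢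
  have ha0 : a 0 ≠ 0 := by
    have := h ![1, 0] (fun h => one_ne_zero (congrFun h 0))
    simpa using this
  have hroot : ∀ x : K, a 0 * x ^ 2 + a 1 * x + a 2 ≠ 0 := by
    intro x hx
    refine h ![x, 1] (fun h => one_ne_zero (congrFun h 1)) ?_
    simpa using hx
  let f : Polynomial K := Polynomial.C (a 0) * Polynomial.X ^ 2 + Polynomial.C (a 1) * Polynomial.X
    + Polynomial.C (a 2)
  have hdeg : f.natDegree = 2 := Polynomial.natDegree_quadratic ha0
  have hf0 : f ≠ 0 := fun h0 => by rw [h0] at hdeg; simp at hdeg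
  have hirr : Irreducible f := by
    rw [Polynomial.irreducible_iff_roots_eq_zero_of_degree_le_three (by omega) (by omega)]
    refine Multiset.eq_zero_of_forall_notMem fun x hx => ?_
    rw [Polynomial.mem_roots hf0, Polynomial.IsRoot.def] at hx
    exact hroot x (by simpa [f] using hx)
  have := Fact.mk hirr
  have hfin : Module.finrank K (AdjoinRoot f) = 2 := by
    rw [(AdjoinRoot.powerBasis hf0).finrank, AdjoinRoot.powerBasis_dim, hdeg]
  obtain ⟨φ⟩ := FiniteField.nonempty_algHom_of_finrank_dvd (F := K) (K := AdjoinRoot f) (L := L)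
    (by rw [hfin, hL])
  set θ := φ (AdjoinRoot.root f) with hθ
  have hθ0 : algebraMap K L (a 0) * θ ^ 2 + algebraMap K L (a 1) * θ + algebraMap K L (a 2) = 0 := by
    have h1 : Polynomial.aeval (AdjoinRoot.root f) f = 0 := by
      rw [AdjoinRoot.aeval_eq, AdjoinRoot.mk_self]
    have h2 := congrArg φ h1
    rw [← Polynomial.aeval_algHom_apply, map_zero] at h2
    simpa only [f, map_add, map_mul, map_pow, Polynomial.aeval_C, Polynomial.aeval_X] using h2
  have hne : tw K 1 θ ≠ θ := by
    intro hfix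
    obtain ⟨x, hx⟩ := mem_base_of_tw_one hfix
    apply hroot x
    apply (algebraMap K L).injective
    rw [map_add, map_add, map_mul, map_mul, map_pow, hx, hθ0, map_zero]
  have hθ1 := congrArg (tw K 1) hθ0
  simp only [map_add, map_mul, map_pow, tw_base, map_zero] at hθ1
  set θ' := tw K 1 θ
  -- the sum of the roots, from the difference of the two equations
  have hsum : algebraMap K L (a 0) * (θ + θ') + algebraMap K L (a 1) = 0 := by
    refine (mul_eq_zero.1 ?_).resolve_left (sub_ne_zero.2 hne)
    linear_combination hθ1 - hθ0
  refine ⟨θ, hne, ha0, fun w => ?_⟩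
  change _ = _ * ((w 0 - w 1 * θ) * (w 0 - w 1 * θ'))
  linear_combination w 1 ^ 2 * hθ0 + (w 0 * w 1 - w 1 ^ 2 * θ) * hsum

theorem exists_smul_of_cross_eq_zero {k : Type*} [Field k] {u p : Fin 2 → k} (hp : p ≠ 0)
    (h : u 0 * p 1 - u 1 * p 0 = 0) : ∃ c : k, u = c • p := by
  by_cases h0 : p 0 = 0
  · have h1 : p 1 ≠ 0 := fun h1 => hp (by ext i; fin_cases i <;> assumption)
    refine ⟨u 1 / p 1, ?_⟩
    ext i
    fin_cases i <;> simp [h0]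
    · simpa [h0, h1] using h
    · field_simp
  · refine ⟨u 0 / p 0, ?_⟩
    ext i
    fin_cases i <;> simp
    · field_simp
    · field_simp
      linear_combination -h

variable {F K : Type*} [Field F] [Fintype F] [Field K] [Algebra F K]

theorem moment_vecConj {E : Type*} [Field E] [Algebra F E] (r : ℕ) (u : Fin 2 → E) :
    moment r (vecConj F E 2 u) = vecConj F E (r + 1) (moment r u) := by
  ext i
  simp [moment, vecConj_apply]

theorem conjForm_vecConj {E : Type*} [Field E] [Algebra K E] [Algebra F E] [IsScalarTower F K E]
    {n : ℕ} (a : Fin n → K) (i : ℕ) (x : Fin n → E) :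
    conjForm F a (i + 1) (vecConj F E n x) = tw F 1 (conjForm F a i x) := by
  simp only [conjForm, dotProduct, map_sum, map_mul, vecConj_apply, tw_algebraMap, tw_tw, add_comm]

theorem vecConj_surjective {E : Type*} [Field E] [Finite E] [Algebra F E] (n : ℕ) :
    Function.Surjective (vecConj F E n) := by
  have h : Function.Surjective (tw F 1 : E →+* E) :=
    Finite.surjective_of_injective (tw F 1 : E →+* E).injective
  intro v
  choose w hw using fun j => h (v j)
  exact ⟨w, funext fun j => by rw [vecConj_apply, hw]⟩

/-- A factor `w ↦ w × p` of a form over `E` turns into the factor `w ↦ w × p^σ` of its conjugate. -/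
theorem tw_cross {E : Type*} [Field E] [Algebra F E] (w p : Fin 2 → E) :
    tw F 1 (w 0 * p 1 - w 1 * p 0) =
      vecConj F E 2 w 0 * vecConj F E 2 p 1 - vecConj F E 2 w 1 * vecConj F E 2 p 0 := by
  simp only [vecConj_apply, map_sub, map_mul]

end Roots

/-! ### The points at infinity of the curve -/

section Infinity

open Matrix

variable {F K : Type*} [Field F] [Fintype F] [Field K] [Algebra F K]
  {R : Frame F K} {C : FqConic F K} {G : Matrix (Fin 3) (Fin 3) K}
  {D : Matrix (Fin 9) (Fin 3) K} {P : Fin 3 → Matrix (Fin 3) (Fin 9) K} {a : Fin 3 → K}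
  {E : Type*} [Field E] [Algebra K E]

/-- The points at infinity of the conic over `E`, when its equation at infinity is a product of
two linear forms. -/
theorem Coords.ext_inter_lineInf [Algebra F E] [IsScalarTower F K E] (h : Coords R C G D P a)
    {p q : Fin 2 → E} (hp : p ≠ 0) (hq : q ≠ 0) {c : E} (hc : c ≠ 0)
    (hf : ∀ w, conjForm F a 0 (moment 2 w) =
      c * ((w 0 * p 1 - w 1 * p 0) * (w 0 * q 1 - w 1 * q 0))) {X Y : PG 2 E}
    (hX : IsVec X (G.map (algebraMap K E) *ᵥ moment 2 p))
    (hY : IsVec Y (G.map (algebraMap K E) *ᵥ moment 2 q)) :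
    C.ext E ∩ R.lineInf E = {X, Y} := by
  have hprop : ∀ (p : Fin 2 → E) (X W : PG 2 E) (u : Fin 2 → E), p ≠ 0 →
      IsVec X (G.map (algebraMap K E) *ᵥ moment 2 p) →
      IsVec W (G.map (algebraMap K E) *ᵥ moment 2 u) → u 0 * p 1 - u 1 * p 0 = 0 → W = X := by
    intro p X W u hp hX hW hu
    obtain ⟨b, rfl⟩ := exists_smul_of_cross_eq_zero hp hu
    have : moment 2 (b • p) = b ^ 2 • moment 2 p := by
      rw [moment_two_eq, moment_two_eq]
      ext i; fin_cases i <;> simp <;> ring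
    rw [this, mulVec_smul] at hW
    exact hW.of_smul.eq hX
  ext W
  constructor
  · rintro ⟨hW, hWl⟩
    obtain ⟨u, hu, hWu⟩ := h.mem_ext_iff.1 hW
    rw [h.mem_lineInf_iff hWu, hf] at hWl
    rcases mul_eq_zero.1 ((mul_eq_zero.1 hWl).resolve_left hc) with h1 | h1
    · exact Or.inl (hprop p X W u hp hX hWu h1)
    · exact Or.inr (hprop q Y W u hq hY hWu h1)
  · rintro (rfl | rfl)
    · refine ⟨h.mem_ext_iff.2 ⟨p, hp, hX⟩, ?_⟩
      rw [h.mem_lineInf_iff hX, hf]; ring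
    · refine ⟨h.mem_ext_iff.2 ⟨q, hq, hY⟩, ?_⟩
      rw [h.mem_lineInf_iff hY, hf]; ring

variable {r d : ℕ} {e : Fin (d + 1) → K} {T : Matrix (Fin 3) (Fin (r + 1)) K}
  {l : (Fin 2 → E) → E} [Algebra F E] [IsScalarTower F K E]

/-- A root `p` of the form `e` gives the points `X`, `X^q`, `X^{q²}` of the curve, where `X` is the
corresponding point of the transversal plane; their parameters are the conjugates of `p`. -/
theorem CurveOver.isVec_of_root (hK : Module.finrank F K = 3) (h : Coords R C G D P a)
    (hc : CurveOver a e T F E l) {p : Fin 2 → E} (hp : p ≠ 0)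
    (hpe : conjForm F e 0 (moment d p) = 0) {X : PG 2 E}
    (hX : IsVec X (G.map (algebraMap K E) *ᵥ moment 2 p)) :
    IsVec (R.toΓ X) ((curveMat D T).map (algebraMap F E) *ᵥ moment r p) ∧
    IsVec (conj F (R.toΓ X))
      ((curveMat D T).map (algebraMap F E) *ᵥ moment r (vecConj F E 2 p)) ∧
    IsVec (conj F (conj F (R.toΓ X)))
      ((curveMat D T).map (algebraMap F E) *ᵥ moment r (vecConj F E 2 (vecConj F E 2 p))) := by
  have hΓ := h.isVec_toΓ hX
  have hne : ∀ u : Fin 2 → E, u ≠ 0 → vecConj F E 2 u ≠ 0 := fun u hu h0 =>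
    hu (vecConj_injective F E 2 (h0.trans (map_zero _).symm))
  have hpe1 : conjForm F e 1 (moment d (vecConj F E 2 p)) = 0 := by
    rw [moment_vecConj, conjForm_vecConj, hpe, map_zero]
  have hpe2 : conjForm F e 2 (moment d (vecConj F E 2 (vecConj F E 2 p))) = 0 := by
    rw [moment_vecConj, conjForm_vecConj, hpe1, map_zero]
  have hΓ1 := hΓ.conj F
  rw [vecConj_twMat_mulVec, ← moment_vecConj] at hΓ1
  have hΓ2 := hΓ1.conj F
  rw [vecConj_twMat_mulVec, ← moment_vecConj] at hΓ2
  obtain ⟨b0, hb0, e0⟩ := hc.exists_smul_of_root (D := D) hK hp 0 hpe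
  obtain ⟨b1, hb1, e1⟩ := hc.exists_smul_of_root (D := D) hK (hne _ hp) 1 hpe1
  obtain ⟨b2, hb2, e2⟩ := hc.exists_smul_of_root (D := D) hK (hne _ (hne _ hp)) 2 hpe2
  exact ⟨e0 ▸ hΓ.smul hb0, e1 ▸ hΓ1.smul hb1, e2 ▸ hΓ2.smul hb2⟩

end Infinity

/-! ### A conic that misses the point at infinity of its subplane -/

section Sextic

open Matrix

/-- A linear form over `K` in three variables whose kernel over `F` is one-dimensional is a
combination `b₁ f₁ + b₂ f₂` of two independent forms over `F`, with independent `b₁`, `b₂`. -/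
theorem exists_decomposition {F K : Type*} [Field F] [Field K] [Algebra F K] {a : Fin 3 → K} {t : Fin 3 → F} (ht : t ≠ 0)
    (hker : ∀ x : Fin 3 → F, a ⬝ᵥ vecExt F K 3 x = 0 ↔ ∃ c : F, x = c • t) :
    ∃ (b₁ b₂ : K) (f₁ f₂ : Fin 3 → F),
      (∀ c d : F, algebraMap F K c * b₁ + algebraMap F K d * b₂ = 0 → c = 0 ∧ d = 0) ∧
      (∀ j, a j = algebraMap F K (f₁ j) * b₁ + algebraMap F K (f₂ j) * b₂) ∧
      ¬(f₁ 0 * f₂ 1 - f₁ 1 * f₂ 0 = 0 ∧ f₁ 0 * f₂ 2 - f₁ 2 * f₂ 0 = 0 ∧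
        f₁ 1 * f₂ 2 - f₁ 2 * f₂ 1 = 0) := by
  let φ : (Fin 3 → F) →ₗ[F] K := Fintype.linearCombination F a
  have hφ : ∀ x, φ x = a ⬝ᵥ vecExt F K 3 x := by
    intro x
    simp only [φ, Fintype.linearCombination_apply, Algebra.smul_def, dotProduct]
    exact Finset.sum_congr rfl fun j _ => mul_comm _ _
  have hk : LinearMap.ker φ = Submodule.span F {t} := by
    ext x
    rw [LinearMap.mem_ker, hφ, hker, Submodule.mem_span_singleton]
    simp only [eq_comm]
  have hr : Module.finrank F (LinearMap.range φ) = 2 := by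
    have h1 := φ.finrank_range_add_finrank_ker
    rw [hk, finrank_span_singleton ht, Module.finrank_fin_fun] at h1
    omega
  let b := Module.finBasisOfFinrankEq F (LinearMap.range φ) hr
  -- `f₁`, `f₂` are the coordinates of the form with respect to a basis of its image over `F`
  let g : (Fin 3 → F) →ₗ[F] (Fin 2 → F) := b.equivFun.toLinearMap ∘ₗ φ.rangeRestrict
  have hg : ∀ x, φ x = algebraMap F K (g x 0) * (b 0 : K) + algebraMap F K (g x 1) * (b 1 : K) := by
    intro x
    have h1 := congrArg Subtype.val (b.sum_equivFun (φ.rangeRestrict x))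
    rw [Fin.sum_univ_two] at h1
    rw [← Algebra.smul_def, ← Algebra.smul_def]
    exact h1.symm
  have hgs : Function.Surjective g :=
    b.equivFun.surjective.comp (LinearMap.surjective_rangeRestrict φ)
  have hgx : ∀ x i, g x i = ∑ j, x j * g (Pi.single j 1) i := by
    intro x i
    conv_lhs => rw [LinearMap.pi_apply_eq_sum_univ g x]
    simp only [Finset.sum_apply, Pi.smul_apply, smul_eq_mul]
    refine Finset.sum_congr rfl fun j _ => ?_
    have : (fun m => if j = m then (1 : F) else 0) = Pi.single j 1 := by
      funext m; simp [Pi.single_apply, eq_comm]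
    rw [this]
  refine ⟨b 0, b 1, fun j => g (Pi.single j 1) 0, fun j => g (Pi.single j 1) 1, ?_, ?_, ?_⟩
  · intro c d h
    rw [← Algebra.smul_def, ← Algebra.smul_def] at h
    have h1 : c • b 0 + d • b 1 = 0 := Subtype.ext h
    have h2 := Fintype.linearIndependent_iff.1 b.linearIndependent ![c, d]
      (by rw [Fin.sum_univ_two]; exact h1)
    exact ⟨h2 0, h2 1⟩
  · intro j
    rw [← hg, hφ, vecExt_single, dotProduct_single, mul_one]
  · rintro ⟨m01, m02, m12⟩
    -- by the Cauchy–Binet formula the identity matrix would have determinant zero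
    obtain ⟨x, hx⟩ := hgs ![1, 0]
    obtain ⟨y, hy⟩ := hgs ![0, 1]
    have x0 : g x 0 = 1 := by rw [hx]; rfl
    have x1 : g x 1 = 0 := by rw [hx]; rfl
    have y0 : g y 0 = 0 := by rw [hy]; rfl
    have y1 : g y 1 = 1 := by rw [hy]; rfl
    rw [hgx, Fin.sum_univ_three] at x0 x1 y0 y1
    apply one_ne_zero (α := F)
    beta_reduce at m01 m02 m12
    generalize g (Pi.single 0 1) = g0 at *
    generalize g (Pi.single 1 1) = g1 at *
    generalize g (Pi.single 2 1) = g2 at *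
    linear_combination (x 0 * y 1 - x 1 * y 0) * m01 + (x 0 * y 2 - x 2 * y 0) * m02 +
      (x 1 * y 2 - x 2 * y 1) * m12 - (y 0 * g0 1 + y 1 * g1 1 + y 2 * g2 1) * x0 - y1 +
      (x 0 * g0 1 + x 1 * g1 1 + x 2 * g2 1) * y0

theorem dotProduct_moment_two {k : Type*} [Field k] (f : Fin 3 → k) (u : Fin 2 → k) :
    f ⬝ᵥ moment 2 u = f 0 * u 0 ^ 2 + f 1 * (u 0 * u 1) + f 2 * u 1 ^ 2 := by
  rw [moment_two_eq, dotProduct, Fin.sum_univ_three]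
  rfl

variable {F K : Type*} [Field F] [Fintype F] [Field K] [Algebra F K]

theorem tw_one_fin (hK : Module.finrank F K = 3) (i : Fin 3) (x : K) :
    tw F i (tw F 1 x) = tw F (i + 1 : Fin 3) x := by
  have := tw_add_fin (F := F) hK i 1 x
  rwa [Fin.val_one] at this

theorem tw_two_fin (hK : Module.finrank F K = 3) (i : Fin 3) (x : K) :
    tw F i (tw F 2 x) = tw F (i + 2 : Fin 3) x := by
  have := tw_add_fin (F := F) hK i 2 x
  rwa [Fin.val_two] at this

/-- The multiplication matrix of the sextic curve. -/
def sexticMat (F : Type*) [Field F] [Fintype F] [Algebra F K] (a : Fin 3 → K) :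
    Matrix (Fin 3) (Fin 7) K :=
  mulMat₂ (fun j => tw F 1 (a j)) fun j => tw F 2 (a j)

/-- The entries are the coefficients of the norm of the form `a`, hence lie in `F`. -/
theorem sexticMat_vecMul (hK : Module.finrank F K = 3) (a : Fin 3 → K) (m : Fin 7) :
    ∃ κ : F, (a ᵥ* sexticMat F a) m = algebraMap F K κ := by
  obtain ⟨κ, hκ⟩ := mem_base_of_tw_one (F := F) (x := (a ᵥ* sexticMat F a) m) (by
    have h3 : ∀ x : K, tw F 3 x = x := tw_three hK
    fin_cases m <;>
    simp [vecMul, dotProduct, sexticMat, mulMat₂, Fin.sum_univ_three, tw_tw, h3] <;> ring)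
  exact ⟨κ, hκ.symm⟩

variable {b₁ b₂ : K} {a : Fin 3 → K} {f₁ f₂ : Fin 3 → F}

theorem sexticMat_kernel (hK : Module.finrank F K = 3)
    (hb : ∀ c d : F, algebraMap F K c * b₁ + algebraMap F K d * b₂ = 0 → c = 0 ∧ d = 0)
    (ha : ∀ j, a j = algebraMap F K (f₁ j) * b₁ + algebraMap F K (f₂ j) * b₂)
    (hres : (f₁ 0 * f₂ 2 - f₁ 2 * f₂ 0) ^ 2 ≠
      (f₁ 0 * f₂ 1 - f₁ 1 * f₂ 0) * (f₁ 1 * f₂ 2 - f₁ 2 * f₂ 1)) (c : Fin 7 → K)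
    (hc : ∀ i : Fin 3, twMat F K i (sexticMat F a) *ᵥ c = 0) : c = 0 := by
  obtain ⟨h01, h12, h20⟩ := conjugates_independent hK hb
  refine mulMat₂_kernel (x := fun i => tw F i b₁) (y := fun i => tw F i b₂)
    (a := fun j => algebraMap F K (f₁ j)) (b := fun j => algebraMap F K (f₂ j))
    (by simpa using h01) (by simpa using h12) (by simpa using h20) ?_ fun i => ?_
  · intro h
    apply hres
    apply (algebraMap F K).injective
    simpa using h
  · rw [← hc i, sexticMat, twMat_mulMat₂]
    congr 2 <;> funext j
    · rw [tw_one_fin hK, ha, map_add, map_mul, map_mul, tw_base, tw_base]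
      simp [mul_comm]
    · rw [tw_two_fin hK, ha, map_add, map_mul, map_mul, tw_base, tw_base]
      simp [mul_comm]

theorem sexticMat_curveOver (hK : Module.finrank F K = 3)
    (hb : ∀ c d : F, algebraMap F K c * b₁ + algebraMap F K d * b₂ = 0 → c = 0 ∧ d = 0)
    (ha : ∀ j, a j = algebraMap F K (f₁ j) * b₁ + algebraMap F K (f₂ j) * b₂)
    (hres : (f₁ 0 * f₂ 2 - f₁ 2 * f₂ 0) ^ 2 ≠
      (f₁ 0 * f₂ 1 - f₁ 1 * f₂ 0) * (f₁ 1 * f₂ 2 - f₁ 2 * f₂ 1))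
    (E : Type*) [Field E] [Algebra K E] [Algebra F E] [IsScalarTower F K E] :
    CurveOver (d := 2) a a (sexticMat F a) F E (fun _ => 1) where
  mulVec_moment i u := by
    rw [sexticMat, twMat_mulMat₂, mulMat₂_mulVec]
    simp only [tw_one_fin hK, tw_two_fin hK]
    rfl
  factor i u := (one_mul _).symm
  coprime u hu i j hij := by
    refine conjForm_ne_zero_of_coprime hK hb ha ?_ i j hij
    rintro ⟨h1, h2⟩
    replace h1 := (dotProduct_moment_two _ u).symm.trans h1
    replace h2 := (dotProduct_moment_two _ u).symm.trans h2
    -- the cubic monomials at a common root would form a functional killing all cubic forms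
    have := eq_zero_of_resultant_ne_zero (a := fun j => algebraMap F E (f₁ j))
      (b := fun j => algebraMap F E (f₂ j)) (y₀ := u 0 ^ 3) (y₁ := u 0 ^ 2 * u 1)
      (y₂ := u 0 * u 1 ^ 2) (y₃ := u 1 ^ 3) (fun h => hres ?_)
      (by linear_combination u 0 * h1) (by linear_combination u 1 * h1)
      (by linear_combination u 0 * h2) (by linear_combination u 1 * h2)
    · apply hu
      ext i
      fin_cases i
      · exact eq_zero_of_pow_eq_zero this.1
      · exact eq_zero_of_pow_eq_zero this.2.2.2
    · apply (algebraMap F E).injective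
      simpa using h

variable {R : Frame F K} {C : FqConic F K} {G : Matrix (Fin 3) (Fin 3) K}
  {D : Matrix (Fin 9) (Fin 3) K} {P : Fin 3 → Matrix (Fin 3) (Fin 9) K}

/-- A factorization of the equation at infinity of the conic, and its conjugate. -/
theorem conjForm_factor_succ {E : Type*} [Field E] [Finite E] [Algebra K E] [Algebra F E]
    [IsScalarTower F K E] {i : ℕ} {p q : Fin 2 → E} {c : E}
    (hf : ∀ w, conjForm F a i (moment 2 w) =
      c * ((w 0 * p 1 - w 1 * p 0) * (w 0 * q 1 - w 1 * q 0))) (w : Fin 2 → E) :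
    conjForm F a (i + 1) (moment 2 w) = tw F 1 c *
      ((w 0 * vecConj F E 2 p 1 - w 1 * vecConj F E 2 p 0) *
        (w 0 * vecConj F E 2 q 1 - w 1 * vecConj F E 2 q 0)) := by
  obtain ⟨w, rfl⟩ := vecConj_surjective (F := F) 2 w
  rw [moment_vecConj, conjForm_vecConj, hf, map_mul, map_mul, tw_cross, tw_cross]

/-- The six points at infinity of the sextic curve. -/
theorem sextic_meetsIn (hK : Module.finrank F K = 3) (h : Coords R C G D P a)
    {E : Type*} [Field E] [Finite E] [Algebra K E] [Algebra F E] [IsScalarTower F K E]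
    (hc : CurveOver (d := 2) a a (sexticMat F a) F E (fun _ => 1)) {N : NRC 6 8 F}
    (hN : N.mat = curveMat D (sexticMat F a)) {p q : Fin 2 → E} (hp : p ≠ 0) (hq : q ≠ 0) {c : E}
    (hc0 : c ≠ 0)
    (hf : ∀ w, conjForm F a 0 (moment 2 w) =
      c * ((w 0 * p 1 - w 1 * p 0) * (w 0 * q 1 - w 1 * q 0))) {X Y : PG 2 E}
    (hX : IsVec X (G.map (algebraMap K E) *ᵥ moment 2 p))
    (hY : IsVec Y (G.map (algebraMap K E) *ᵥ moment 2 q)) :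
    N.MeetsIn E R.S6 R.Sinf
      ![R.toΓ X, conj F (R.toΓ X), conj F (conj F (R.toΓ X)),
        R.toΓ Y, conj F (R.toΓ Y), conj F (conj F (R.toΓ Y))] := by
  have hne : ∀ u : Fin 2 → E, u ≠ 0 → vecConj F E 2 u ≠ 0 := fun u hu h0 =>
    hu (vecConj_injective F E 2 (h0.trans (map_zero _).symm))
  have hf1 := conjForm_factor_succ hf
  have hf2 := conjForm_factor_succ hf1
  obtain ⟨X0, X1, X2⟩ := hc.isVec_of_root hK h hp (by rw [hf]; ring) hX
  obtain ⟨Y0, Y1, Y2⟩ := hc.isVec_of_root hK h hq (by rw [hf]; ring) hY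
  rw [← hN] at X0 X1 X2 Y0 Y1 Y2
  refine N.meetsIn_of_vec E (Coords.hyperplaneForm P a E F 0)
    ![p, vecConj F E 2 p, vecConj F E 2 (vecConj F E 2 p),
      q, vecConj F E 2 q, vecConj F E 2 (vecConj F E 2 q)] (c * tw F 1 c * tw F 1 (tw F 1 c))
    (h.hyperplaneForm_eq_zero_iff hK) ?_ ?_ ?_ ?_
  · intro i
    fin_cases i
    exacts [hp, hne _ hp, hne _ (hne _ hp), hq, hne _ hq, hne _ (hne _ hq)]
  · intro i
    fin_cases i
    exacts [X0, X1, X2, Y0, Y1, Y2]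
  · simpa using hc0
  · intro w
    rw [hN, hc.hyperplaneForm_curve hK h, hf, hf1, hf2, Fin.prod_univ_six]
    simp only [cons_val]
    ring

theorem sextic_variety (hK : Module.finrank F K = 3) (hq : 4 ≤ Fintype.card F)
    (h : Coords R C G D P a) {E : Type*} [Field E] [Algebra K E] [Algebra F E]
    [IsScalarTower F K E] (hc : CurveOver (d := 2) a a (sexticMat F a) F E (fun _ => 1))
    {N : NRC 6 8 F} (hN : N.mat = curveMat D (sexticMat F a)) :
    R.variety C.points E = N.points E := by
  refine Set.Subset.antisymm (fun Z hZ => ?_)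
    (hc.nrc_subset_variety hK hq h (sexticMat_vecMul hK a) hN)
  rcases hc.mem_nrc_of_mem_variety hK hq h hN hZ with h1 | ⟨_, _, _, h1, _⟩
  · exact h1
  · exact absurd h1 one_ne_zero

theorem sextic_brSet (hK : Module.finrank F K = 3) (h : Coords R C G D P a)
    (hc : CurveOver (d := 2) a a (sexticMat F a) F K (fun _ => 1))
    {N : NRC 6 8 F} (hN : N.mat = curveMat D (sexticMat F a)) :
    R.brSet C.points = N.points F := by
  apply Set.Subset.antisymm
  · rintro Z ⟨X, hX, hZ⟩
    obtain ⟨u, hu, hXu⟩ := h.mem_points_iff.1 hX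
    exact hc.mem_nrc_of_mem_br hK h hN hu one_ne_zero hXu hZ
  · intro Z hZ
    obtain ⟨u, hu, hZu⟩ := N.mem_points_iff.1 hZ
    rw [Algebra.algebraMap_self, RingHom.coe_id, Matrix.map_id] at hZu
    obtain ⟨X, hXu⟩ : ∃ X : PG 2 K, IsVec X (G *ᵥ moment 2 (vecExt F K 2 u)) := by
      refine ⟨_, isVec_mk fun h0 => ?_⟩
      refine moment_ne_zero 2 (vecExt F K 2 u) (fun h1 => hu (vecExt_injective F K 2
        (by rw [h1, map_zero]))) ?_
      exact mulVec_injective_iff_isUnit.2 h.G_unit (h0.trans (mulVec_zero G).symm)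
    exact ⟨X, h.mem_points_iff.2 ⟨u, hu, hXu⟩,
      hc.nrc_subset_brSet hK h (sexticMat_vecMul hK a) hN hXu hZu⟩

end Sextic

/-! ### A conic through the point at infinity of its subplane -/

section Quartic

open Matrix

variable {F K : Type*} [Field F] [Fintype F] [Field K] [Algebra F K]

/-- The multiplication matrix of the quartic curve, for the linear form with coefficients `e`. -/
def quarticMat (F : Type*) [Field F] [Fintype F] [Algebra F K] (e : Fin 2 → K) :
    Matrix (Fin 3) (Fin 5) K :=
  mulMat₁ (fun j => tw F 1 (e j)) fun j => tw F 2 (e j)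

variable {a : Fin 3 → K}

/-- The entries are those of the norm of the form `e`, multiplied by the factor `t`, hence lie in
`F`. -/
theorem quarticMat_vecMul (hK : Module.finrank F K = 3) (ha : a 0 = 0) (m : Fin 5) :
    ∃ κ : F, (a ᵥ* quarticMat F ![a 1, a 2]) m = algebraMap F K κ := by
  obtain ⟨κ, hκ⟩ := mem_base_of_tw_one (F := F) (x := (a ᵥ* quarticMat F ![a 1, a 2]) m) (by
    have h3 : ∀ x : K, tw F 3 x = x := tw_three hK
    fin_cases m <;>
    simp [vecMul, dotProduct, quarticMat, mulMat₁, Fin.sum_univ_three, tw_tw, h3, ha] <;> ring)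
  exact ⟨κ, hκ.symm⟩

theorem quarticMat_kernel (hK : Module.finrank F K = 3)
    (hb : ∀ c d : F, algebraMap F K c * a 1 + algebraMap F K d * a 2 = 0 → c = 0 ∧ d = 0)
    (c : Fin 5 → K) (hc : ∀ i : Fin 3, twMat F K i (quarticMat F ![a 1, a 2]) *ᵥ c = 0) :
    c = 0 := by
  obtain ⟨h01, h12, h20⟩ := conjugates_independent hK hb
  refine mulMat₁_kernel (x := fun i => tw F i (a 1)) (y := fun i => tw F i (a 2))
    (by simpa using h01) (by simpa using h12) (by simpa using h20) fun i => ?_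
  rw [← hc i, quarticMat, twMat_mulMat₁]
  congr 2 <;> funext j
  · rw [tw_one_fin hK]
    fin_cases j <;> simp
  · rw [tw_two_fin hK]
    fin_cases j <;> simp

theorem moment_one {k : Type*} [Field k] (u : Fin 2 → k) : moment 1 u = u := by
  ext i
  fin_cases i <;> simp [moment]

theorem quarticMat_curveOver (hK : Module.finrank F K = 3) (ha : a 0 = 0)
    (hb : ∀ c d : F, algebraMap F K c * a 1 + algebraMap F K d * a 2 = 0 → c = 0 ∧ d = 0)
    (E : Type*) [Field E] [Algebra K E] [Algebra F E] [IsScalarTower F K E] :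
    CurveOver (d := 1) a ![a 1, a 2] (quarticMat F ![a 1, a 2]) F E (fun u => u 1) where
  mulVec_moment i u := by
    rw [quarticMat, twMat_mulMat₁, mulMat₁_mulVec]
    simp only [tw_one_fin hK, tw_two_fin hK]
    rfl
  factor i u := by
    rw [conjForm, conjForm, moment_one, dotProduct_moment_two, dotProduct, Fin.sum_univ_two, ha]
    simp
    ring
  coprime u hu i j hij := by
    refine conjForm_ne_zero_of_coprime hK hb (f₁ := ![1, 0]) (f₂ := ![0, 1]) ?_ ?_ i j hij
    · intro j
      fin_cases j <;> simp
    · rintro ⟨h1, h2⟩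
      rw [moment_one, dotProduct, Fin.sum_univ_two] at h1 h2
      apply hu
      ext i
      fin_cases i
      · simpa using h1
      · simpa using h2

variable {R : Frame F K} {C : FqConic F K} {G : Matrix (Fin 3) (Fin 3) K}
  {D : Matrix (Fin 9) (Fin 3) K} {P : Fin 3 → Matrix (Fin 3) (Fin 9) K}

theorem moment_two_base {k : Type*} [Field k] : moment 2 ![(1 : k), 0] = ![1, 0, 0] := by
  rw [moment_two_eq]; ext i; fin_cases i <;> simp

theorem vecExt_base (k k' : Type*) [Field k] [Field k'] [Algebra k k'] :
    vecExt k k' 2 ![1, 0] = ![1, 0] := by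
  ext i; fin_cases i <;> simp [vecExt]

/-- The plane at infinity that represents the first base point. -/
theorem mem_br_iff (hK : Module.finrank F K = 3) (h : Coords R C G D P a) (ha : a 0 = 0)
    {T : PG 2 K} (hT : IsVec T (G *ᵥ moment 2 ![1, 0])) {v : Fin 9 → F} :
    v ∈ R.br T ↔ ∃ ω : K, v = traceVec D (ω • moment 2 ![1, 0]) := by
  rw [← h.mem_bose_iff hK hT]
  refine ⟨fun hv => hv.1, fun hv => ⟨hv, ?_⟩⟩
  obtain ⟨ω, rfl⟩ := (h.mem_bose_iff hK hT).1 hv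
  refine (h.S6_iff _).2 ⟨0, ?_⟩
  rw [dotProduct_smul, dotProduct_moment_two, ha]
  simp

theorem vecExt_traceVec_base (hK : Module.finrank F K = 3) {E : Type*} [Field E] [Algebra K E]
    [Algebra F E] [IsScalarTower F K E] (D : Matrix (Fin 9) (Fin 3) K) (ω : K) :
    vecExt F E 9 (traceVec D (ω • moment 2 ![1, 0])) =
      scrollLin F D (moment 2 ![1, 0]) fun i => algebraMap K E (tw F i ω) := by
  rw [vecExt_traceVec hK, scrollLin_apply]
  congr 1
  ext i j
  rw [moment_two_base, moment_two_base]
  fin_cases j <;> simp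

/-- The extension of the plane that represents the first base point is the plane of the scroll
with parameter `(1, 0)`. -/
theorem mem_spaceExt_br_iff (hK : Module.finrank F K = 3) (h : Coords R C G D P a) (ha : a 0 = 0)
    {T : PG 2 K} (hT : IsVec T (G *ᵥ moment 2 ![1, 0])) {E : Type*} [Field E] [Algebra K E]
    [Algebra F E] [IsScalarTower F K E] {z : Fin 9 → E} :
    z ∈ spaceExt E (R.br T) ↔ ∃ c, z = scrollLin F D (moment 2 ![1, 0]) c := by
  constructor
  · intro hz
    have hle : spaceExt E (R.br T) ≤ LinearMap.range (scrollLin F D (moment 2 ![(1 : E), 0])) := by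
      refine spaceExt_le fun v hv => ?_
      obtain ⟨ω, rfl⟩ := (mem_br_iff hK h ha hT).1 hv
      exact ⟨_, (vecExt_traceVec_base hK D ω).symm⟩
    obtain ⟨c, rfl⟩ := hle hz
    exact ⟨c, rfl⟩
  · rintro ⟨c, rfl⟩
    have hle : Submodule.span E
        (Set.range fun (ω : K) (i : Fin 3) => algebraMap K E (tw F i ω)) ≤
        (spaceExt E (R.br T)).comap (scrollLin F D (moment 2 ![(1 : E), 0])) := by
      refine Submodule.span_le.2 ?_
      rintro _ ⟨ω, rfl⟩
      change scrollLin F D (moment 2 ![(1 : E), 0]) (fun i => algebraMap K E (tw F i ω)) ∈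
        spaceExt E (R.br T)
      rw [← vecExt_traceVec_base hK]
      exact vecExt_mem_spaceExt E ((mem_br_iff hK h ha hT).2 ⟨ω, rfl⟩)
    rw [span_conjugates hK E] at hle
    exact hle Submodule.mem_top

theorem moment_two_of_snd_eq_zero {k : Type*} [Field k] {u : Fin 2 → k} (hu : u 1 = 0) :
    moment 2 u = u 0 ^ 2 • moment 2 ![1, 0] := by
  rw [moment_two_eq, moment_two_base]
  ext i
  fin_cases i <;> simp [hu]

theorem quartic_variety (hK : Module.finrank F K = 3) (hq : 4 ≤ Fintype.card F)
    (h : Coords R C G D P a) (ha : a 0 = 0) {T : PG 2 K} (hT : IsVec T (G *ᵥ moment 2 ![1, 0]))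
    {E : Type*} [Field E] [Algebra K E] [Algebra F E] [IsScalarTower F K E]
    (hc : CurveOver (d := 1) a ![a 1, a 2] (quarticMat F ![a 1, a 2]) F E (fun u => u 1))
    {N : NRC 4 8 F} (hN : N.mat = curveMat D (quarticMat F ![a 1, a 2])) :
    R.variety C.points E = pointsOf (spaceExt E (R.br T)) ∪ N.points E := by
  apply Set.Subset.antisymm
  · intro Z hZ
    rcases hc.mem_nrc_of_mem_variety hK hq h hN hZ with h1 | ⟨u, c, _, hu, hZu⟩
    · exact Or.inr h1
    · left
      rw [hZu.mem_pointsOf, mem_spaceExt_br_iff hK h ha hT]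
      refine ⟨u 0 ^ 2 • c, ?_⟩
      rw [moment_two_of_snd_eq_zero hu, scrollLin_apply, scrollLin_apply]
      congr 1
      ext i j
      simp only [Pi.smul_apply, smul_eq_mul]
      ring
  · rintro Z (hZ | hZ)
    · rw [(isVec_rep Z).mem_pointsOf] at hZ
      refine ⟨?_, ((isVec_rep Z).mem_pointsOf _).2 (spaceExt_mono inf_le_right hZ)⟩
      rw [h.mem_boseVariety_iff hK hq (isVec_rep Z)]
      obtain ⟨c, hcZ⟩ := (mem_spaceExt_br_iff hK h ha hT).1 hZ
      exact ⟨_, c, fun h0 => one_ne_zero (congrFun h0 0), hcZ⟩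
    · exact hc.nrc_subset_variety hK hq h (quarticMat_vecMul hK ha) hN hZ

theorem quartic_brSet (hK : Module.finrank F K = 3) (h : Coords R C G D P a)
    (ha : a 0 = 0) {T : PG 2 K} (hT : IsVec T (G *ᵥ moment 2 ![1, 0]))
    (hc : CurveOver (d := 1) a ![a 1, a 2] (quarticMat F ![a 1, a 2]) F K (fun u => u 1))
    {N : NRC 4 8 F} (hN : N.mat = curveMat D (quarticMat F ![a 1, a 2])) :
    R.brSet C.points = pointsOf (R.br T) ∪ N.points F := by
  have hTC : T ∈ C.points := h.mem_points_iff.2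
    ⟨![1, 0], fun h0 => one_ne_zero (congrFun h0 0), by rwa [vecExt_base]⟩
  apply Set.Subset.antisymm
  · rintro Z ⟨X, hX, hZ⟩
    obtain ⟨u, hu, hXu⟩ := h.mem_points_iff.1 hX
    by_cases hu1 : u 1 = 0
    · left
      have : X = T := by
        have hv : vecExt F K 2 u 1 = 0 := by simp [vecExt, hu1]
        rw [moment_two_of_snd_eq_zero hv, mulVec_smul] at hXu
        exact hXu.of_smul.eq hT
      rwa [← this]
    · right
      refine hc.mem_nrc_of_mem_br hK h hN hu ?_ hXu hZ
      simpa [vecExt] using hu1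
  · rintro Z (hZ | hZ)
    · exact ⟨T, hTC, hZ⟩
    · obtain ⟨u, hu, hZu⟩ := N.mem_points_iff.1 hZ
      rw [Algebra.algebraMap_self, RingHom.coe_id, Matrix.map_id] at hZu
      obtain ⟨X, hXu⟩ : ∃ X : PG 2 K, IsVec X (G *ᵥ moment 2 (vecExt F K 2 u)) := by
        refine ⟨_, isVec_mk fun h0 => ?_⟩
        refine moment_ne_zero 2 (vecExt F K 2 u) (fun h1 => hu (vecExt_injective F K 2
          (by rw [h1, map_zero]))) ?_
        exact mulVec_injective_iff_isUnit.2 h.G_unit (h0.trans (mulVec_zero G).symm)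
      exact ⟨X, h.mem_points_iff.2 ⟨u, hu, hXu⟩,
        hc.nrc_subset_brSet hK h (quarticMat_vecMul hK ha) hN hXu hZu⟩

/-- The conjugate of a factorization of a linear form. -/
theorem conjForm_linear_succ {E : Type*} [Field E] [Finite E] [Algebra K E] [Algebra F E]
    [IsScalarTower F K E] {e : Fin 2 → K} {i : ℕ} {p : Fin 2 → E} {c : E}
    (hf : ∀ w, conjForm F e i (moment 1 w) = c * (w 0 * p 1 - w 1 * p 0)) (w : Fin 2 → E) :
    conjForm F e (i + 1) (moment 1 w) =
      tw F 1 c * (w 0 * vecConj F E 2 p 1 - w 1 * vecConj F E 2 p 0) := by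
  obtain ⟨w, rfl⟩ := vecConj_surjective (F := F) 2 w
  rw [moment_vecConj, conjForm_vecConj, hf, map_mul, tw_cross]

/-- The four points at infinity of the quartic curve. -/
theorem quartic_meetsIn (hK : Module.finrank F K = 3) (h : Coords R C G D P a)
    (hne0 : (![a 2, -a 1] : Fin 2 → K) ≠ 0)
    (hc : CurveOver (d := 1) a ![a 1, a 2] (quarticMat F ![a 1, a 2]) F K (fun u => u 1))
    {N : NRC 4 8 F} (hN : N.mat = curveMat D (quarticMat F ![a 1, a 2])) {X : PG 2 K}
    (hX : IsVec X (G *ᵥ moment 2 ![a 2, -a 1])) {Z : PG 8 F}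
    (hZ : IsVec Z (N.mat *ᵥ moment 4 ![1, 0])) :
    N.MeetsIn K R.S6 R.Sinf
      ![ptExt K Z, R.toΓ X, conj F (R.toΓ X), conj F (conj F (R.toΓ X))] := by
  have : FiniteDimensional F K := Module.finite_of_finrank_pos (by omega)
  have : Finite K := Module.finite_of_finite F
  have hne : ∀ u : Fin 2 → K, u ≠ 0 → vecConj F K 2 u ≠ 0 := fun u hu h0 =>
    hu (vecConj_injective F K 2 (h0.trans (map_zero _).symm))
  set p : Fin 2 → K := ![a 2, -a 1] with hp
  have hf : ∀ w : Fin 2 → K, conjForm F ![a 1, a 2] 0 (moment 1 w) =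
      -1 * (w 0 * p 1 - w 1 * p 0) := by
    intro w
    rw [conjForm, moment_one, dotProduct, Fin.sum_univ_two]
    simp [hp]
    ring
  have hf1 := conjForm_linear_succ hf
  have hf2 := conjForm_linear_succ hf1
  have hX' : IsVec X (G.map (algebraMap K K) *ᵥ moment 2 p) := by
    rwa [Algebra.algebraMap_self, RingHom.coe_id, Matrix.map_id]
  obtain ⟨X0, X1, X2⟩ := hc.isVec_of_root hK h hne0 (by rw [hf]; ring) hX'
  rw [← hN] at X0 X1 X2
  have hZ' := hZ.ptExt K
  rw [vecExt_mulVec, ← vecExt_moment, vecExt_base] at hZ'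
  refine N.meetsIn_of_vec K (Coords.hyperplaneForm P a K F 0)
    ![![1, 0], p, vecConj F K 2 p, vecConj F K 2 (vecConj F K 2 p)]
    (-1 * tw F 1 (-1) * tw F 1 (tw F 1 (-1)) * -1)
    (h.hyperplaneForm_eq_zero_iff hK) ?_ ?_ ?_ ?_
  · intro i
    fin_cases i
    exacts [fun h0 => one_ne_zero (congrFun h0 0), hne0, hne _ hne0, hne _ (hne _ hne0)]
  · intro i
    fin_cases i
    exacts [hZ', X0, X1, X2]
  · simp
  · intro w
    rw [hN, hc.hyperplaneForm_curve hK h, hf, hf1, hf2, Fin.prod_univ_four]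
    simp only [cons_val, cons_val_zero, cons_val_one]
    ring

end Quartic

/-! ### The conics of a subplane with one point at infinity -/

section Main

open Matrix

variable {F K : Type*} [Field F] [Fintype F] [Field K] [Algebra F K]
  {R : Frame F K} {C : FqConic F K} {G : Matrix (Fin 3) (Fin 3) K}
  {D : Matrix (Fin 9) (Fin 3) K} {P : Fin 3 → Matrix (Fin 3) (Fin 9) K} {a : Fin 3 → K}

theorem Coords.exists_isVec (h : Coords R C G D P a) (E : Type*) [Field E] [Algebra K E]
    {x : Fin 3 → E} (hx : x ≠ 0) : ∃ X : PG 2 E, IsVec X (G.map (algebraMap K E) *ᵥ x) :=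
  ⟨_, isVec_mk fun h0 => hx (h.mulVec_injective (h0.trans (mulVec_zero _).symm))⟩

theorem map_algebraMap_self {m n : Type*} (A : Matrix m n K) : A.map (algebraMap K K) = A := by
  rw [Algebra.algebraMap_self, RingHom.coe_id, Matrix.map_id]

theorem conjForm_zero {E : Type*} [Field E] [Algebra K E] {n : ℕ} (a : Fin n → K)
    (x : Fin n → E) : conjForm F a 0 x = (fun j => algebraMap K E (a j)) ⬝ᵥ x := by
  simp [conjForm]

theorem Coords.mem_lineInf_iff_self (h : Coords R C G D P a) {X : PG 2 K} {x : Fin 3 → K}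
    (hX : IsVec X (G *ᵥ x)) : X ∈ R.lineInf K ↔ a ⬝ᵥ x = 0 := by
  rw [h.mem_lineInf_iff (x := x) (by rwa [map_algebraMap_self]), conjForm_zero]
  rfl

/-- If the subplane has only one point `T` at infinity, then the vectors over `F` that satisfy the
equation of the line at infinity represent `T`. -/
theorem Coords.isVec_of_dotProduct_eq_zero (h : Coords R C G D P a) {T : PG 2 K}
    (hT : C.subplane ∩ R.lineInf K = {T}) {x : Fin 3 → F} (hx : x ≠ 0)
    (hax : a ⬝ᵥ vecExt F K 3 x = 0) : IsVec T (G *ᵥ vecExt F K 3 x) := by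
  have hx' : vecExt F K 3 x ≠ 0 := fun h0 => hx (vecExt_injective F K 3 (h0.trans (map_zero _).symm))
  obtain ⟨X, hX⟩ := h.exists_isVec K hx'
  rw [map_algebraMap_self] at hX
  have : X ∈ C.subplane ∩ R.lineInf K := ⟨h.mem_subplane hX, (h.mem_lineInf_iff_self hX).2 hax⟩
  rw [hT] at this
  rwa [← Set.mem_singleton_iff.1 this]

/-- The conic through the point at infinity of the subplane. -/
theorem quartic_case {L : Type*} [Field L] [Algebra K L] [Algebra F L] [IsScalarTower F K L]
    (hK : Module.finrank F K = 3) (hq : 4 ≤ Fintype.card F) {T : PG 2 K}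
    (hT : C.subplane ∩ R.lineInf K = {T}) (hTC : T ∈ C.points) :
    ∃ (Q : PG 2 K) (N : NRC 4 8 F) (Z : PG 8 F),
      Q ≠ T ∧ C.ext K ∩ R.lineInf K = {T, Q} ∧
      R.brSet C.points = pointsOf (R.br T) ∪ N.points F ∧
      R.variety C.points K = pointsOf (spaceExt K (R.br T)) ∪ N.points K ∧
      R.variety C.points L = pointsOf (spaceExt L (R.br T)) ∪ N.points L ∧
      Z ∈ pointsOf (R.br T) ∧
      N.MeetsIn K R.S6 R.Sinf
        ![ptExt K Z, R.toΓ Q, conj F (R.toΓ Q), conj F (conj F (R.toΓ Q))] := by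
  obtain ⟨x, hx0, hxT⟩ := hTC
  -- the point `T` is taken as the first base point
  obtain ⟨G, D, P, a, h, hG⟩ := exists_coords hK R C x.rep x.rep_nonzero hx0
  have hTG : IsVec T (G *ᵥ moment 2 ![1, 0]) := by
    have := ((isVec_rep x).ptExt K).matMap C.B C.B_inj
    rwa [← hxT, map_algebraMap_self, ← hG, ← moment_two_base] at this
  have hTinf : T ∈ R.lineInf K :=
    (show T ∈ C.subplane ∩ R.lineInf K by rw [hT]; exact Set.mem_singleton T).2
  have ha0 : a 0 = 0 := by
    have := (h.mem_lineInf_iff_self hTG).1 hTinf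
    rw [dotProduct_moment_two] at this
    simpa using this
  -- a relation over `F` would give another point of the subplane at infinity
  have hb : ∀ c d : F, algebraMap F K c * a 1 + algebraMap F K d * a 2 = 0 → c = 0 ∧ d = 0 := by
    intro c d hcd
    by_contra hne
    have hx : (![0, c, d] : Fin 3 → F) ≠ 0 := fun h0 =>
      hne ⟨congrFun h0 1, congrFun h0 2⟩
    have hv := h.isVec_of_dotProduct_eq_zero hT hx (by
      rw [dotProduct, Fin.sum_univ_three]
      simpa [vecExt, mul_comm] using hcd)
    obtain ⟨b, hb0, hb⟩ := hTG.exists_smul hv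
    rw [← mulVec_smul] at hb
    have := congrFun (mulVec_injective_iff_isUnit.2 h.G_unit hb) 0
    rw [moment_two_base] at this
    exact hb0 (by simpa [vecExt] using this.symm)
  have ha1 : a 1 ≠ 0 := fun h0 => one_ne_zero (hb 1 0 (by simp [h0])).1
  have hcK := quarticMat_curveOver hK ha0 hb K
  have hcL := quarticMat_curveOver hK ha0 hb L
  let N : NRC 4 8 F := ⟨curveMat D (quarticMat F ![a 1, a 2]),
    curveMat_injective hK h (quarticMat_kernel hK hb)⟩
  have hne0 : (![a 2, -a 1] : Fin 2 → K) ≠ 0 := fun h0 => ha1 (by simpa using congrFun h0 1)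
  have hp0 : (![1, 0] : Fin 2 → K) ≠ 0 := fun h0 => one_ne_zero (congrFun h0 0)
  obtain ⟨Q, hQ⟩ := h.exists_isVec K (moment_ne_zero 2 _ hne0)
  obtain ⟨Z, hZ⟩ : ∃ Z : PG 8 F, IsVec Z (N.mat *ᵥ moment 4 ![1, 0]) :=
    ⟨_, isVec_mk fun h0 => moment_ne_zero 4 (![1, 0] : Fin 2 → F)
      (fun h1 => one_ne_zero (congrFun h1 0)) (N.inj (h0.trans (map_zero N.mat.mulVecLin).symm))⟩
  have hext := h.ext_inter_lineInf hp0 hne0 (one_ne_zero (α := K)) (fun w => by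
    rw [conjForm_zero]
    change a ⬝ᵥ _ = _
    rw [dotProduct_moment_two, ha0]
    simp
    ring) (X := T) (by rwa [map_algebraMap_self]) hQ
  rw [map_algebraMap_self] at hQ
  -- `Q ≠ T` since the last coordinate of `Q` is `(a 1)²`
  refine ⟨Q, N, Z, ?_, hext, quartic_brSet hK h ha0 hTG hcK rfl,
    quartic_variety hK hq h ha0 hTG hcK rfl, quartic_variety hK hq h ha0 hTG hcL rfl,
    hcK.nrc_subset_brSet hK h (quarticMat_vecMul hK ha0) rfl (u := ![1, 0])
      (by rwa [vecExt_base]) hZ, quartic_meetsIn hK h hne0 hcK rfl hQ hZ⟩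
  rintro rfl
  obtain ⟨b, hb0, hb⟩ := hTG.exists_smul hQ
  rw [← mulVec_smul] at hb
  have := congrFun (mulVec_injective_iff_isUnit.2 h.G_unit hb) 2
  rw [moment_two_base, moment_two_eq] at this
  exact ha1 (by simpa using this)

/-- The third iterate of the conjugation acts on parameters only, since it fixes the matrices over
`K`. -/
theorem isVec_conj_three (hK : Module.finrank F K = 3) {L : Type*} [Field L] [Algebra K L]
    [Algebra F L] [IsScalarTower F K L] {m n : ℕ} {A : Matrix (Fin (m + 1)) (Fin n) K}
    {X : PG m L} {x : Fin n → L} (hX : IsVec X (A.map (algebraMap K L) *ᵥ x)) :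
    IsVec ((conj F)^[3] X) (A.map (algebraMap K L) *ᵥ fun i => tw F 3 (x i)) := by
  have := ((hX.conj F).conj F).conj F
  have e : (A.map (algebraMap K L) *ᵥ fun i => tw F 3 (x i)) = vecConj F L (m + 1)
      (vecConj F L (m + 1) (vecConj F L (m + 1) (A.map (algebraMap K L) *ᵥ x))) := by
    ext i
    simp only [vecConj_apply, tw_tw, mulVec, dotProduct, map_sum, map_mul, Matrix.map_apply,
      tw_algebraMap, tw_three hK, Nat.reduceAdd]
  rwa [e]

/-- The conic not through the point at infinity of the subplane. -/
theorem sextic_case {L : Type*} [Field L] [Algebra K L] [Algebra F L] [IsScalarTower F K L]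
    (hK : Module.finrank F K = 3) (hL : Module.finrank K L = 2) (hq : 4 ≤ Fintype.card F)
    {T : PG 2 K} (hT : C.subplane ∩ R.lineInf K = {T}) (hTC : T ∉ C.points) :
    ∃ N : NRC 6 8 F,
      R.brSet C.points = N.points F ∧
      R.variety C.points K = N.points K ∧
      R.variety C.points L = N.points L ∧
      ((∃ P Q : PG 2 K,
          C.ext K ∩ R.lineInf K = {P, Q} ∧
          N.MeetsIn K R.S6 R.Sinf
            ![R.toΓ P, conj F (R.toΓ P), conj F (conj F (R.toΓ P)),
              R.toΓ Q, conj F (R.toΓ Q), conj F (conj F (R.toΓ Q))]) ∨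
        (C.ext K ∩ R.lineInf K = ∅ ∧
          ∃ P Q : PG 2 L,
            P ≠ Q ∧ Q = (conj F)^[3] P ∧ R.toΓ Q = (conj F)^[3] (R.toΓ P) ∧
            C.ext L ∩ R.lineInf L = {P, Q} ∧
            N.MeetsIn L R.S6 R.Sinf
              ![R.toΓ P, conj F (R.toΓ P), conj F (conj F (R.toΓ P)),
                R.toΓ Q, conj F (R.toΓ Q), conj F (conj F (R.toΓ Q))])) := by
  have : FiniteDimensional F K := Module.finite_of_finrank_pos (by omega)
  have : Finite K := Module.finite_of_finite F
  have : FiniteDimensional K L := Module.finite_of_finrank_pos (by omega)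
  have : Finite L := Module.finite_of_finite K
  have : Fintype K := Fintype.ofFinite K
  -- the base point is an arbitrary point of the conic
  obtain ⟨p₀, hp₀, hp₀Q⟩ := exists_ne_zero_eval_eq_zero C.homog
  obtain ⟨G, D, P, a, h, -⟩ := exists_coords hK R C p₀ hp₀ hp₀Q
  have hTmem : T ∈ C.subplane ∩ R.lineInf K := by rw [hT]; exact Set.mem_singleton T
  obtain ⟨t, ht, htT⟩ := h.exists_isVec_of_mem_subplane hTmem.1
  have hker : ∀ x : Fin 3 → F, a ⬝ᵥ vecExt F K 3 x = 0 ↔ ∃ c : F, x = c • t := by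
    have hat := (h.mem_lineInf_iff_self htT).1 hTmem.2
    refine fun x => ⟨fun hax => ?_, ?_⟩
    · by_cases hx : x = 0
      · exact ⟨0, by rw [hx, zero_smul]⟩
      obtain ⟨b, hb0, hb⟩ := htT.exists_smul (h.isVec_of_dotProduct_eq_zero hT hx hax)
      rw [← mulVec_smul] at hb
      exact exists_smul_of_vecExt ht (mulVec_injective_iff_isUnit.2 h.G_unit hb)
    · rintro ⟨c, rfl⟩
      rw [map_smulₛₗ, dotProduct_smul, hat, smul_zero]
  obtain ⟨b₁, b₂, f₁, f₂, hb, ha, hind⟩ := exists_decomposition ht hker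
  -- a common root of `f₁` and `f₂` would be a point of the conic at infinity, hence `T`
  have hres : (f₁ 0 * f₂ 2 - f₁ 2 * f₂ 0) ^ 2 ≠
      (f₁ 0 * f₂ 1 - f₁ 1 * f₂ 0) * (f₁ 1 * f₂ 2 - f₁ 2 * f₂ 1) := by
    intro hres
    obtain ⟨u, hu, hu1, hu2⟩ := exists_common_root hres hind
    refine hTC (h.mem_points_iff.2 ⟨u, hu, ?_⟩)
    rw [vecExt_moment]
    refine h.isVec_of_dotProduct_eq_zero hT (moment_ne_zero 2 u hu) ?_
    have e : a ⬝ᵥ vecExt F K 3 (moment 2 u) = algebraMap F K (f₁ ⬝ᵥ moment 2 u) * b₁ +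
        algebraMap F K (f₂ ⬝ᵥ moment 2 u) * b₂ := by
      simp only [dotProduct, Fin.sum_univ_three, ha, map_add, map_mul, vecExt, LinearMap.coe_mk,
        AddHom.coe_mk]
      ring
    rw [e, hu1, hu2, map_zero, zero_mul, zero_mul, add_zero]
  have hcK := sexticMat_curveOver hK hb ha hres K
  have hcL := sexticMat_curveOver hK hb ha hres L
  let N : NRC 6 8 F := ⟨curveMat D (sexticMat F a),
    curveMat_injective hK h (sexticMat_kernel hK hb ha hres)⟩
  refine ⟨N, sextic_brSet hK h hcK rfl, sextic_variety hK hq h hcK rfl,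
    sextic_variety hK hq h hcL rfl, ?_⟩
  by_cases hroot : ∃ p : Fin 2 → K, p ≠ 0 ∧ a ⬝ᵥ moment 2 p = 0
  · left
    obtain ⟨p, hp, hpa⟩ := hroot
    obtain ⟨r, hr, hf⟩ := exists_factor_of_root h.a_ne hp hpa
    obtain ⟨X, hX⟩ := h.exists_isVec K (moment_ne_zero 2 p hp)
    obtain ⟨Y, hY⟩ := h.exists_isVec K (moment_ne_zero 2 r hr)
    have hf' : ∀ w : Fin 2 → K, conjForm F a 0 (moment 2 w) =
        1 * ((w 0 * p 1 - w 1 * p 0) * (w 0 * r 1 - w 1 * r 0)) := fun w => by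
      rw [conjForm_zero, one_mul]
      exact hf w
    exact ⟨X, Y, h.ext_inter_lineInf hp hr one_ne_zero hf' hX hY,
      sextic_meetsIn hK h hcK rfl hp hr one_ne_zero hf' hX hY⟩
  · right
    push Not at hroot
    constructor
    · rw [Set.eq_empty_iff_forall_notMem]
      rintro X ⟨hXC, hXinf⟩
      obtain ⟨u, hu, hXu⟩ := h.mem_ext_iff.1 hXC
      rw [map_algebraMap_self] at hXu
      exact hroot u hu ((h.mem_lineInf_iff_self hXu).1 hXinf)
    obtain ⟨θ, hθ, ha0, hf⟩ := exists_conjugate_roots hL hroot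
    have htw : ∀ x : L, tw F 3 x = tw K 1 x := fun x => by
      rw [tw_one, Module.card_eq_pow_finrank (K := F) (V := K), hK, tw_succ, tw_succ, tw_one,
        ← pow_mul, ← pow_mul, pow_succ, pow_two, mul_assoc]
    have ha0' : algebraMap K L (a 0) ≠ 0 := (map_ne_zero _).2 ha0
    have hne : ∀ x : L, (![x, 1] : Fin 2 → L) ≠ 0 := fun x h0 => one_ne_zero (congrFun h0 1)
    obtain ⟨X, hX⟩ := h.exists_isVec L (moment_ne_zero 2 _ (hne θ))
    obtain ⟨Y, hY⟩ := h.exists_isVec L (moment_ne_zero 2 _ (hne (tw K 1 θ)))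
    have hf' : ∀ w : Fin 2 → L, conjForm F a 0 (moment 2 w) =
        algebraMap K L (a 0) * ((w 0 * ![θ, 1] 1 - w 1 * ![θ, 1] 0) *
          (w 0 * ![tw K 1 θ, 1] 1 - w 1 * ![tw K 1 θ, 1] 0)) := fun w => by
      rw [conjForm_zero, hf]
      simp
    have hmom : (fun i => tw F 3 (moment 2 ![θ, 1] i)) = moment 2 ![tw K 1 θ, 1] := by
      ext i
      simp [moment, htw]
    refine ⟨X, Y, ?_, ?_, ?_, h.ext_inter_lineInf (hne _) (hne _) ha0' hf' hX hY,
      sextic_meetsIn hK h hcL rfl (hne _) (hne _) ha0' hf' hX hY⟩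
    · rintro rfl
      obtain ⟨b, -, hb⟩ := hX.exists_smul hY
      rw [← mulVec_smul] at hb
      have hb := h.mulVec_injective hb
      rw [moment_two_eq, moment_two_eq] at hb
      have h2 : b = 1 := by simpa using (congrFun hb 2).symm
      have h1 := congrFun hb 1
      rw [h2] at h1
      exact hθ (by simpa using h1)
    · have := isVec_conj_three (F := F) hK hX
      rw [hmom] at this
      exact hY.eq this
    · have hX' := h.isVec_toΓ hX
      have hY' := h.isVec_toΓ hY
      rw [twMat_zero] at hX' hY'
      have := isVec_conj_three (F := F) hK hX'
      rw [hmom] at this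
      exact hY'.eq this

end Main

end BBConic

end

open BBConic in
theorem mainTheorem4 {F K L : Type*} [Field F] [Fintype F] [Field K] [Field L]
    [Algebra F K] [Algebra K L] [Algebra F L] [IsScalarTower F K L]
    (hK : Module.finrank F K = 3) (hL : Module.finrank K L = 2) (hq : 4 ≤ Fintype.card F)
    (R : Frame F K) (C : FqConic F K) (T : PG 2 K)
    (hT : C.subplane ∩ R.lineInf K = {T}) :
    (T ∈ C.points →
      ∃ (Q : PG 2 K) (N : NRC 4 8 F) (Z : PG 8 F),
        Q ≠ T ∧ C.ext K ∩ R.lineInf K = {T, Q} ∧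
        R.brSet C.points = pointsOf (R.br T) ∪ N.points F ∧
        R.variety C.points K = pointsOf (spaceExt K (R.br T)) ∪ N.points K ∧
        R.variety C.points L = pointsOf (spaceExt L (R.br T)) ∪ N.points L ∧
        Z ∈ pointsOf (R.br T) ∧
        N.MeetsIn K R.S6 R.Sinf
          ![ptExt K Z, R.toΓ Q, conj F (R.toΓ Q), conj F (conj F (R.toΓ Q))]) ∧
    (T ∉ C.points →
      ∃ N : NRC 6 8 F,
        R.brSet C.points = N.points F ∧
        R.variety C.points K = N.points K ∧
        R.variety C.points L = N.points L ∧
        ((∃ P Q : PG 2 K,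
            C.ext K ∩ R.lineInf K = {P, Q} ∧
            N.MeetsIn K R.S6 R.Sinf
              ![R.toΓ P, conj F (R.toΓ P), conj F (conj F (R.toΓ P)),
                R.toΓ Q, conj F (R.toΓ Q), conj F (conj F (R.toΓ Q))]) ∨
          (C.ext K ∩ R.lineInf K = ∅ ∧
            ∃ P Q : PG 2 L,
              P ≠ Q ∧ Q = (conj F)^[3] P ∧ R.toΓ Q = (conj F)^[3] (R.toΓ P) ∧
              C.ext L ∩ R.lineInf L = {P, Q} ∧
              N.MeetsIn L R.S6 R.Sinf
                ![R.toΓ P, conj F (R.toΓ P), conj F (conj F (R.toΓ P)),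
                  R.toΓ Q, conj F (R.toΓ Q), conj F (conj F (R.toΓ Q))]))) :=
  ⟨fun h => quartic_case hK hq hT h, fun h => sextic_case hK hL hq hT h⟩
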